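/- **Theorem 1.4 (fast fusion).** Write $\eta=(a,v)\in(0,\infty)^2$ and $c_0=(36\pi)^{1/3}$. Let $\mathscr M_+^I$ be the space of nonnegative Radon measures $h$ on $(0,\infty)^2$ with $h(\{a<c_0v^{2/3}\})=0$, endowed with the weak-$*$ topology (tested against $C_c((0,\infty)^2)$). Let $K:(0,\infty)^2\times(0,\infty)^2\to[0,\infty)$ be continuous and symmetric, $K(\eta,\eta')=K(\eta',\eta)$, and suppose that for some $K_0,K_1>0$ and all $\eta=(a,v)$, $\eta'=(a',v')$, $$K_1\big(v^{-\alpha}v'^{\beta}+v'^{-\alpha}v^{\beta}\big)\le K(\eta,\eta')\le K_0\big(v^{-\alpha}v'^{\beta}+v'^{-\alpha}v^{\beta}\big),$$ where $\alpha>0$, $\beta\in(0,1)$ and $\beta-\alpha\in(0,1)$. Let $\mu>0$, $\sigma\in\mathbb R$, and let $r\in C^1((0,\infty)^2)$ be such that for some $R_0,R_1,B>0$ $$R_0a^\mu v^\sigma\le r(a,v)\le R_1a^\mu v^\sigma\quad\text{for all }(a,v)\in(0,\infty)^2,$$ $$\mu a^{-1}r(a,v)\le\partial_a r(a,v)\le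 B a^{-1}r(a,v)\quad\text{whenever }a\ge c_0v^{2/3}.$$ For $\epsilon>0$ and $f_{\rm in}\in\mathscr M_+^I$, a function $f\in C([0,\infty);\mathscr M_+^I)$ is called a weak solution of the $\epsilon$-fusion problem with initial datum $f_{\rm in}$ if $\sup_{t\in[0,T']}\int(v^{-\alpha}+v^{\beta})f(d\eta,t)<\infty$ for every $T'>0$ and, for every $\varphi\in C^1_c([0,\infty)\times(0,\infty)^2)$ and every $t\ge0$, $$\int\varphi(\eta,t)f(d\eta,t)-\int\varphi(\eta,0)f_{\rm in}(d\eta)-\int_0^t\!\!\int\partial_s\varphi(\eta,s)f(d\eta,s)\,ds$$ $$=\int_0^t\langle\mathbb K[f(s)],\varphi(s)\rangle\,ds+\frac1\epsilon\int_0^t\!\!\int r(\eta)(c_0v^{2/3}-a)\,\partial_a\varphi(\eta,s)f(d\eta,s)\,ds,$$ where $\langle\mathbb K[h],\psi\rangle=\frac12\iint K(\eta,\eta')[\psi(\eta+\eta')-\psi(\eta)-\psi(\eta')]\,h(d\eta')\,h(d\eta)$ and all integrals over $\eta,\eta'$ are over $(0,\infty)^2$. Let $f_{\rm in}\in\mathscr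 M_+^I$ satisfy $\int(v^{-\mu-3}+v^{\mu+3}+v^{\sigma(\mu+3)}+a^{\mu+3})f_{\rm in}(d\eta)<\infty$, and let $T>0$. Then there exists a family $\{f_\epsilon\}_{\epsilon\in(0,1)}$ with the following properties. 1. For every $\epsilon\in(0,1)$, $f_\epsilon$ is a weak solution of the $\epsilon$-fusion problem with initial datum $f_{\rm in}$. 2. There is a constant $C(T)>0$, independent of $\epsilon\in(0,1)$, such that $$\sup_{t\in[0,T]}\int\big(v^{-\mu-3}+v^{\mu+3}+v^{\sigma(\mu+3)}+a^{\mu+3}\big)f_\epsilon(d\eta,t)\le C(T)\quad\text{for all }\epsilon\in(0,1).$$ 3. There exist a sequence $\epsilon_n\in(0,1)$ with $\epsilon_n\to0$ and $\overline f\in C((0,T];\mathscr M_+^I)$ such that $f_{\epsilon_n}(t)\to\overline f(t)$ in the weak-$*$ topology as $n\to\infty$, for every $\overline\sigma>0$ and every $t\in[\overline\sigma,T]$. -/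

import Mathlib

open Set Filter Topology MeasureTheory
open scoped ENNReal

noncomputable section

namespace AreaVolume

/-- The phase space `(0,∞)²`; its points are pairs `η = (a, v)` of area and volume. -/
abbrev Quadrant : Set (ℝ × ℝ) := Ioi 0 ×ˢ Ioi 0

/-- The isoperimetric constant `c₀ = (36π)^{1/3}`. -/
def c₀ : ℝ := (36 * Real.pi) ^ (1 / 3 : ℝ)

/-- The area `c₀ v^{2/3}` of a ball of volume `v`. -/
def sphereArea (v : ℝ) : ℝ := c₀ * v ^ (2 / 3 : ℝ)

/-- The space of nonnegative Radon measures on `(0,∞)²` that do not charge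
`{a < c₀ v^{2/3}}`. (On the locally compact separable metric space `(0,∞)²` the Radon measures
are the locally finite Borel measures.) -/
structure IsoMeasure where
  toMeasure : Measure Quadrant
  locallyFinite : IsLocallyFiniteMeasure toMeasure
  isoperimetric : toMeasure {η | (η : ℝ × ℝ).1 < sphereArea (η : ℝ × ℝ).2} = 0

/-- The weak-* topology on Radon measures: the coarsest one for which `h ↦ ∫ φ dh` is continuous
for every `φ ∈ C_c((0,∞)²)`. -/
instance : TopologicalSpace IsoMeasure :=
  TopologicalSpace.induced
    (fun (h : IsoMeasure) (φ : CompactlySupportedContinuousMap Quadrant ℝ) =>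
      ∫ η, φ η ∂h.toMeasure)
    Pi.topologicalSpace

/-- The assumptions on the coagulation kernel `K(η, η')`: continuity on `(0,∞)⁴`, symmetry,
two-sided power-law bounds in the volumes, and the range of the exponents. -/
structure IsCoagulationKernel (K : ℝ × ℝ → ℝ × ℝ → ℝ) (α β : ℝ) : Prop where
  continuousOn : ContinuousOn (Function.uncurry K) (Quadrant ×ˢ Quadrant)
  nonneg : ∀ η ∈ Quadrant, ∀ η' ∈ Quadrant, 0 ≤ K η η'
  symm : ∀ η ∈ Quadrant, ∀ η' ∈ Quadrant, K η η' = K η' η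
  bounds : ∃ K₁ > 0, ∃ K₀ > 0, ∀ η ∈ Quadrant, ∀ η' ∈ Quadrant,
    K₁ * (η.2 ^ (-α) * η'.2 ^ β + η'.2 ^ (-α) * η.2 ^ β) ≤ K η η' ∧
    K η η' ≤ K₀ * (η.2 ^ (-α) * η'.2 ^ β + η'.2 ^ (-α) * η.2 ^ β)
  alpha_pos : 0 < α
  beta_mem : β ∈ Ioo (0 : ℝ) 1
  beta_sub_alpha_mem : β - α ∈ Ioo (0 : ℝ) 1

/-- The partial derivative in the area variable. -/
def partialArea (g : ℝ × ℝ → ℝ) (η : ℝ × ℝ) : ℝ := deriv (fun a => g (a, η.2)) η.1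

/-- The assumptions on the fusion kernel `r(a, v)`. -/
structure IsFusionKernel (r : ℝ × ℝ → ℝ) (μ σ : ℝ) : Prop where
  contDiffOn : ContDiffOn ℝ 1 r Quadrant
  bounds : ∃ R₀ > 0, ∃ R₁ > 0, ∀ η ∈ Quadrant,
    R₀ * (η.1 ^ μ * η.2 ^ σ) ≤ r η ∧ r η ≤ R₁ * (η.1 ^ μ * η.2 ^ σ)
  derivative_bounds : ∃ B > 0, ∀ η ∈ Quadrant, sphereArea η.2 ≤ η.1 →
    (0 < μ → 0 ≤ partialArea r η - μ * η.1⁻¹ * r η) ∧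
    (μ ≤ 0 → 0 ≤ partialArea r η * (η.1 - sphereArea η.2) + r η) ∧
    partialArea r η ≤ B * η.1⁻¹ * r η

/-- The test functions `φ(t, η)`: restrictions to `t ≥ 0` of these are exactly the `C¹` functions
on `[0,∞) × (0,∞)²` with compact support there (extended by zero in `η`, and to negative times). -/
structure IsTestFunction (φ : ℝ → ℝ × ℝ → ℝ) : Prop where
  contDiff : ContDiff ℝ 1 (Function.uncurry φ)
  hasCompactSupport : HasCompactSupport (Function.uncurry φ)
  tsupport_subset : tsupport (Function.uncurry φ) ⊆ univ ×ˢ Quadrant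

/-- The weak coagulation operator
`⟨𝕂[h], φ⟩ = ½ ∫∫ K(η,η') [φ(η+η') - φ(η) - φ(η')] h(dη') h(dη)`. -/
def coagulationForm (K : ℝ × ℝ → ℝ × ℝ → ℝ) (h : Measure Quadrant) (φ : ℝ × ℝ → ℝ) : ℝ :=
  (1 / 2) * ∫ η : Quadrant, ∫ η' : Quadrant,
    K η η' * (φ ((η : ℝ × ℝ) + (η' : ℝ × ℝ)) - φ η - φ η') ∂h ∂h

/-- `f ∈ C([0,∞); M₊ᴵ)` is a weak solution, with initial datum `fin`, of
`∂ₜ f + Λ⁻¹ ∂ₐ[r (c₀ v^{2/3} - a) f] = 𝕂[f]`. -/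
structure IsWeakSolution (K : ℝ × ℝ → ℝ × ℝ → ℝ) (r : ℝ × ℝ → ℝ) (α β Λ : ℝ)
    (fin : IsoMeasure) (f : ℝ → IsoMeasure) : Prop where
  continuousOn : ContinuousOn f (Ici 0)
  moment_bound : ∀ T : ℝ, 0 < T →
    (⨆ t ∈ Icc 0 T, ∫⁻ η : Quadrant,
      ENNReal.ofReal ((η : ℝ × ℝ).2 ^ (-α) + (η : ℝ × ℝ).2 ^ β) ∂(f t).toMeasure) < ⊤
  weak_form : ∀ φ : ℝ → ℝ × ℝ → ℝ, IsTestFunction φ → ∀ t : ℝ, 0 ≤ t →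
    (∫ η : Quadrant, φ t η ∂(f t).toMeasure) - (∫ η : Quadrant, φ 0 η ∂fin.toMeasure)
        - (∫ s in (0 : ℝ)..t, ∫ η : Quadrant, deriv (fun τ => φ τ η) s ∂(f s).toMeasure)
      = (∫ s in (0 : ℝ)..t, coagulationForm K (f s).toMeasure (φ s))
        + (1 / Λ) * ∫ s in (0 : ℝ)..t, ∫ η : Quadrant,
            r η * (sphereArea (η : ℝ × ℝ).2 - (η : ℝ × ℝ).1) * partialArea (φ s) η
              ∂(f s).toMeasure

/-- The moment
`∫ (v^{-μ-3} + v^{μ+3} + v^{σ(μ+3)} + a^{μ+3}) h(da dv) ∈ [0,∞]`. -/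
def highMoment (μ σ : ℝ) (h : Measure Quadrant) : ℝ≥0∞ :=
  ∫⁻ η : Quadrant, ENNReal.ofReal
    ((η : ℝ × ℝ).2 ^ (-μ - 3) + (η : ℝ × ℝ).2 ^ (μ + 3) + (η : ℝ × ℝ).2 ^ (σ * (μ + 3))
      + (η : ℝ × ℝ).1 ^ (μ + 3)) ∂h

end AreaVolume

end

/-! The natural state space is `IsoRegion`, the set `a ≥ c₀ v^(2/3)` in the quadrant. It is closed
under addition, because `v^(2/3)` is subadditive, and fusion preserves it, because fusion keeps the
volume and shrinks the excess `a - c₀ v^(2/3)` towards zero. There the weight `W = 1 + v^(-k) + v^k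
+ v^p + a^k`, with `k = μ + 3` and `p = σ(μ + 3)`, has compact sublevel sets, so a bound on `∫ W` is
a tightness statement.

Existence for fixed `ε`: take explicit Euler steps for coagulation, with the kernel truncated at
`n`, each followed by one relaxation of the area. Fusion can only lower the moments in `W`, so the
bounds are those of pure coagulation and do not depend on `ε`. They come from a hierarchy of
Gronwall estimates (`exists_moment_bound`): `1 + v` has no gain, it controls `1 + v²`, this controls
`a v^(-α) + a v^β`, and the last two control `W`. Curves of measures with almost Lipschitz
observables are relatively compact for vague convergence (`exists_subseq_vagueTendsto`). The limit
satisfies the weak equation because test function and kernel together grow at most like `√W` in each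
variable, while `∫ W` is bounded: tails are uniformly small and continuous convergence of the
integrands suffices (`tendsto_integral_of_vagueTendsto` and its double version).

Fast fusion: as `ε → 0` the equation gives no uniform time regularity for a general observable `φ`,
since fusion contributes a term of order `1 / ε`. Two facts replace it. Evaluating `φ` at the ball
of the same volume gives an observable which fusion does not see, so its integral is Lipschitz in
time uniformly in `ε` (`IsFusionSystem.exists_abs_integral_toBall_sub_le`). The excess area,
localized in volume, is damped at rate at least `r₀ / ε` and created by coagulation at a bounded
rate, hence is at most `ε D / t` at time `t` (`IsFusionSystem.exists_excess_le`), and it controls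
the difference between `φ` and its value at the ball. The solutions are therefore asymptotically
equicontinuous on `(0, T]`, and the same compactness theorem gives the limit. Time zero is excluded
because of the initial layer in which particles become round. -/

noncomputable section

namespace AreaVolume

/-! ### Vague convergence on a space with a proper weight -/

section Vague

variable {X : Type*}

/-- A cutoff equal to `1` on `{W ≤ R}` and to `0` on `{W ≥ R + 1}`. -/
def cutoff (W : X → ℝ) (R : ℝ) (x : X) : ℝ := max 0 (min 1 (R + 1 - W x))

lemma cutoff_nonneg (W : X → ℝ) (R : ℝ) (x : X) : 0 ≤ cutoff W R x := le_max_left _ _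

lemma cutoff_le_one (W : X → ℝ) (R : ℝ) (x : X) : cutoff W R x ≤ 1 :=
  max_le zero_le_one (min_le_left _ _)

lemma cutoff_eq_one {W : X → ℝ} {R : ℝ} {x : X} (h : W x ≤ R) : cutoff W R x = 1 := by
  unfold cutoff
  rw [min_eq_left (by linarith), max_eq_right zero_le_one]

lemma cutoff_eq_zero {W : X → ℝ} {R : ℝ} {x : X} (h : R + 1 ≤ W x) : cutoff W R x = 0 := by
  unfold cutoff
  rw [max_eq_left ((min_le_right _ _).trans (by linarith))]

variable [TopologicalSpace X]

/-- A continuous weight, bounded below by `1`, all of whose sublevel sets are compact. -/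
structure IsProperWeight (W : X → ℝ) : Prop where
  continuous : Continuous W
  one_le : ∀ x, 1 ≤ W x
  isCompact_le : ∀ R, IsCompact {x | W x ≤ R}

lemma continuous_cutoff {W : X → ℝ} (hW : Continuous W) (R : ℝ) : Continuous (cutoff W R) := by
  unfold cutoff
  fun_prop

lemma hasCompactSupport_of_weight {W : X → ℝ} (hW : IsProperWeight W) {φ : X → ℝ} {R : ℝ}
    (h : ∀ x, R < W x → φ x = 0) : HasCompactSupport φ := by
  refine (hW.isCompact_le R).of_isClosed_subset isClosed_closure
    (closure_minimal (fun x hx => ?_) (isClosed_le hW.continuous continuous_const))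
  by_contra hx'
  exact hx (h x (not_le.1 hx'))

lemma hasCompactSupport_mul_cutoff {W : X → ℝ} (hW : IsProperWeight W) (φ : X → ℝ) (R : ℝ) :
    HasCompactSupport (fun x => φ x * cutoff W R x) :=
  hasCompactSupport_of_weight hW (R := R + 1) fun x hx => by rw [cutoff_eq_zero hx.le, mul_zero]

lemma exists_weight_bound_of_hasCompactSupport {W : X → ℝ} (hW : IsProperWeight W) {φ : X → ℝ}
    (hφ : HasCompactSupport φ) : ∃ R, ∀ x, R < W x → φ x = 0 := by
  obtain ⟨R, hR⟩ := (hφ.isCompact.image hW.continuous).bddAbove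
  refine ⟨R, fun x hx => ?_⟩
  by_contra h
  exact absurd (hR ⟨x, subset_tsupport _ h, rfl⟩) (not_le.2 hx)

lemma IsProperWeight.sqrt_le {W : X → ℝ} (hW : IsProperWeight W) (x : X) : √(W x) ≤ W x := by
  rw [Real.sqrt_le_left (by linarith [hW.one_le x])]
  nlinarith [hW.one_le x]

lemma IsProperWeight.one_le_sqrt {W : X → ℝ} (hW : IsProperWeight W) (x : X) : 1 ≤ √(W x) := by
  simpa using Real.sqrt_le_sqrt (hW.one_le x)

/-- Convergence jointly in the index and the point, with a continuous limit, is uniform on compact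
sets by a finite cover. -/
lemma eventually_forall_abs_sub_lt {ι : Type*} {l : Filter ι} {G : ι → X → ℝ} {g : X → ℝ}
    (hg : Continuous g)
    (hG : ∀ x, Tendsto (fun p : ι × X => G p.1 p.2) (l ×ˢ 𝓝 x) (𝓝 (g x)))
    {Q : Set X} (hQ : IsCompact Q) {δ : ℝ} (hδ : 0 < δ) :
    ∀ᶠ i in l, ∀ x ∈ Q, |G i x - g x| < δ := by
  have h : {p : ι × X | |G p.1 p.2 - g p.2| < δ} ∈ l ×ˢ 𝓝ˢ Q := by
    refine hQ.mem_prod_nhdsSet_of_forall fun x _ => ?_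
    have h1 : Tendsto (fun p : ι × X => |G p.1 p.2 - g p.2|) (l ×ˢ 𝓝 x) (𝓝 |g x - g x|) :=
      ((hG x).sub ((hg.tendsto x).comp tendsto_snd)).abs
    rw [sub_self, abs_zero] at h1
    exact h1.eventually (gt_mem_nhds hδ)
  obtain ⟨s, hs, t, ht, hst⟩ := mem_prod_iff.1 h
  filter_upwards [hs] with i hi x hx
  exact hst (mk_mem_prod hi (subset_of_mem_nhdsSet ht hx))

/-- Beyond the level `(A / η)²` one has `A ≤ η √W`, so growth like `√W` is a small multiple of `W`.
This is how a bound on `∫ W` makes tails uniformly negligible. -/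
lemma abs_mul_one_sub_cutoff_le {W : X → ℝ} (hW : IsProperWeight W) {A η R : ℝ} (hη : 0 < η)
    (hR : (A / η) ^ 2 ≤ R) {G : X → ℝ} (hb : ∀ x, |G x| ≤ A * √(W x)) (x : X) :
    |G x * (1 - cutoff W R x)| ≤ η * W x := by
  have hW0 : 0 ≤ W x := zero_le_one.trans (hW.one_le x)
  have h1 : 0 ≤ 1 - cutoff W R x := by linarith [cutoff_le_one W R x]
  have h2 : 1 - cutoff W R x ≤ 1 := by linarith [cutoff_nonneg W R x]
  rcases le_or_gt (W x) R with h | h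
  · rw [cutoff_eq_one h, sub_self, mul_zero, abs_zero]
    positivity
  · have h3 : A / η ≤ √(W x) := Real.le_sqrt_of_sq_le (hR.trans h.le)
    rw [div_le_iff₀ hη] at h3
    rw [abs_mul, abs_of_nonneg h1]
    calc |G x| * (1 - cutoff W R x) ≤ |G x| * 1 := by gcongr
      _ ≤ A * √(W x) := by simpa using hb x
      _ ≤ √(W x) * η * √(W x) := by gcongr
      _ = η * W x := by rw [mul_comm _ η, mul_assoc, Real.mul_self_sqrt hW0]

variable [MeasurableSpace X]

/-- Vague convergence of measures, tested against compactly supported continuous functions. -/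
def VagueTendsto {ι : Type*} (F : ι → Measure X) (l : Filter ι) (m : Measure X) : Prop :=
  ∀ φ : X → ℝ, Continuous φ → HasCompactSupport φ →
    Tendsto (fun i => ∫ x, φ x ∂(F i)) l (𝓝 (∫ x, φ x ∂m))

/-- The bound `∫ W dm ≤ C`, including integrability. -/
def WeightBound (W : X → ℝ) (C : ℝ) (m : Measure X) : Prop :=
  Integrable W m ∧ ∫ x, W x ∂m ≤ C

lemma IsProperWeight.integrable_one {W : X → ℝ} (hW : IsProperWeight W) {m : Measure X}
    (hm : Integrable W m) : Integrable (fun _ => (1 : ℝ)) m :=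
  hm.mono' aestronglyMeasurable_const (ae_of_all _ fun x => by simpa using hW.one_le x)

lemma IsProperWeight.isFiniteMeasure {W : X → ℝ} (hW : IsProperWeight W) {m : Measure X}
    (hm : Integrable W m) : IsFiniteMeasure m := by
  have := hW.integrable_one hm
  rwa [integrable_const_iff_isFiniteMeasure one_ne_zero] at this

lemma WeightBound.nonneg {W : X → ℝ} (hW : IsProperWeight W) {m : Measure X} {C : ℝ}
    (h : WeightBound W C m) : 0 ≤ C :=
  (integral_nonneg fun x => zero_le_one.trans (hW.one_le x)).trans h.2

lemma WeightBound.abs_integral_le {W : X → ℝ} {m : Measure X} {C : ℝ}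
    (h : WeightBound W C m) {G : X → ℝ} {A : ℝ} (hA : 0 ≤ A)
    (hb : ∀ x, |G x| ≤ A * W x) : |∫ x, G x ∂m| ≤ A * C := by
  calc |∫ x, G x ∂m| ≤ ∫ x, A * W x ∂m :=
        norm_integral_le_of_norm_le (f := G) (h.1.const_mul A) (ae_of_all _ hb)
    _ = A * ∫ x, W x ∂m := integral_const_mul _ _
    _ ≤ A * C := mul_le_mul_of_nonneg_left h.2 hA

lemma vagueTendsto_const {ι : Type*} (l : Filter ι) (m : Measure X) :
    VagueTendsto (fun _ : ι => m) l m := fun _ _ _ => tendsto_const_nhds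

lemma VagueTendsto.comp {ι κ : Type*} {F : ι → Measure X} {l : Filter ι} {m : Measure X}
    (h : VagueTendsto F l m) {u : κ → ι} {l' : Filter κ} (hu : Tendsto u l' l) :
    VagueTendsto (fun j => F (u j)) l' m := fun φ hφ hφ' => (h φ hφ hφ').comp hu

variable [BorelSpace X]

lemma integrable_of_abs_le_sqrt {W : X → ℝ} (hW : IsProperWeight W) {m : Measure X}
    (hm : Integrable W m) {G : X → ℝ} (hG : Continuous G) {A : ℝ}
    (hb : ∀ x, |G x| ≤ A * √(W x)) : Integrable G m := by
  refine (hm.const_mul |A|).mono' hG.aestronglyMeasurable (ae_of_all _ fun x => ?_)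
  calc ‖G x‖ ≤ A * √(W x) := hb x
    _ ≤ |A| * W x := mul_le_mul (le_abs_self A) (hW.sqrt_le x) (Real.sqrt_nonneg _) (abs_nonneg _)

lemma weightBound_of_lintegral {W : X → ℝ} (hW : IsProperWeight W) {m : Measure X} {C : ℝ}
    (hC : 0 ≤ C) (h : ∫⁻ x, ENNReal.ofReal (W x) ∂m ≤ ENNReal.ofReal C) : WeightBound W C m := by
  have h0 : ∀ x, 0 ≤ W x := fun x => zero_le_one.trans (hW.one_le x)
  refine ⟨⟨hW.continuous.aestronglyMeasurable, ?_⟩, ?_⟩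
  · rw [hasFiniteIntegral_iff_ofReal (ae_of_all _ h0)]
    exact h.trans_lt ENNReal.ofReal_lt_top
  · rw [integral_eq_lintegral_of_nonneg_ae (ae_of_all _ h0) hW.continuous.aestronglyMeasurable]
    exact ENNReal.toReal_le_of_le_ofReal hC h

/-- Convergence of integrals of functions that converge continuously, are dominated by the square
root of the weight, against vaguely convergent measures with bounded weight. -/
theorem tendsto_integral_of_vagueTendsto {ι : Type*} {l : Filter ι} {F : ι → Measure X}
    {m : Measure X} {W : X → ℝ} (hW : IsProperWeight W) (hv : VagueTendsto F l m) {C : ℝ}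
    (hF : ∀ᶠ i in l, WeightBound W C (F i)) (hm : WeightBound W C m) {G : ι → X → ℝ} {g : X → ℝ}
    (hg : Continuous g) (hGc : ∀ᶠ i in l, Continuous (G i))
    (hG : ∀ x, Tendsto (fun p : ι × X => G p.1 p.2) (l ×ˢ 𝓝 x) (𝓝 (g x))) {A : ℝ}
    (hGb : ∀ᶠ i in l, ∀ x, |G i x| ≤ A * √(W x)) (hgb : ∀ x, |g x| ≤ A * √(W x)) :
    Tendsto (fun i => ∫ x, G i x ∂(F i)) l (𝓝 (∫ x, g x ∂m)) := by
  rw [Metric.tendsto_nhds]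
  intro δ hδ
  have hC := hm.nonneg hW
  -- The errors are `2ηC` under `F i`, `η` from vague convergence and `ηC` under `m`; the total `(3C
  -- + 1)η` is below `δ`.
  set η := δ / (4 * C + 4) with hηdef
  have hη : 0 < η := by positivity
  set R := (A / η) ^ 2
  set χ := cutoff W R
  have hχc : Continuous χ := continuous_cutoff hW.continuous R
  have hgχ : Continuous fun x => g x * χ x := hg.mul hχc
  have e1 := Metric.tendsto_nhds.1 (hv _ hgχ (hasCompactSupport_mul_cutoff hW g R)) η hη
  have e2 := eventually_forall_abs_sub_lt hg hG (hW.isCompact_le (R + 1)) hη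
  filter_upwards [e1, e2, hF, hGc, hGb] with i h1 h2 h3 h4 h5
  have i1 : Integrable (G i) (F i) := integrable_of_abs_le_sqrt hW h3.1 h4 h5
  have i2 : Integrable g m := integrable_of_abs_le_sqrt hW hm.1 hg hgb
  have i3 : Integrable (fun x => g x * χ x) m := i2.mul_of_top_left
    (memLp_top_of_bound hχc.aestronglyMeasurable 1 (ae_of_all _ fun x => by
      rw [Real.norm_eq_abs, abs_of_nonneg (cutoff_nonneg W R x)]; exact cutoff_le_one W R x))
  have i4 : Integrable (fun x => g x * χ x) (F i) :=
    (integrable_of_abs_le_sqrt hW h3.1 hg hgb).mul_of_top_left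
    (memLp_top_of_bound hχc.aestronglyMeasurable 1 (ae_of_all _ fun x => by
      rw [Real.norm_eq_abs, abs_of_nonneg (cutoff_nonneg W R x)]; exact cutoff_le_one W R x))
  have b1 : |∫ x, (G i x - g x * χ x) ∂(F i)| ≤ (2 * η) * C := by
    refine h3.abs_integral_le (by positivity) fun x => ?_
    have q1 := abs_mul_one_sub_cutoff_le hW hη le_rfl h5 x
    have q2 : |(G i x - g x) * χ x| ≤ η * W x := by
      rw [abs_mul, abs_of_nonneg (cutoff_nonneg W R x)]
      rcases le_or_gt (W x) (R + 1) with h | h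
      · calc |G i x - g x| * χ x ≤ η * 1 :=
              mul_le_mul (h2 x h).le (cutoff_le_one W R x) (cutoff_nonneg W R x) hη.le
          _ ≤ η * W x := by gcongr; exact hW.one_le x
      · rw [cutoff_eq_zero h.le, mul_zero]
        have := hW.one_le x
        positivity
    calc |G i x - g x * χ x| = |G i x * (1 - χ x) + (G i x - g x) * χ x| := by congr 1; ring
      _ ≤ |G i x * (1 - χ x)| + |(G i x - g x) * χ x| := abs_add_le _ _
      _ ≤ 2 * η * W x := by linarith
  have b2 : |∫ x, (g x - g x * χ x) ∂m| ≤ η * C := by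
    refine hm.abs_integral_le hη.le fun x => ?_
    have q1 := abs_mul_one_sub_cutoff_le hW hη le_rfl hgb x
    rwa [mul_sub, mul_one] at q1
  rw [integral_sub i1 i4] at b1
  rw [integral_sub i2 i3] at b2
  rw [Real.dist_eq] at h1 ⊢
  have hsum : (4 * C + 4) * η = δ := by rw [hηdef]; field_simp
  have hCη : 0 ≤ C * η := by positivity
  rw [abs_lt] at h1 ⊢
  rw [abs_le] at b1 b2
  constructor <;> nlinarith

/-- This is the preceding convergence theorem with a fixed measure and the filter `𝓝 x`; near `x`
the factor `√(W z)` stays below `√(W x) + 1`. -/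
lemma continuous_integral_of_abs_le {W : X → ℝ} (hW : IsProperWeight W) {m : Measure X} {C : ℝ}
    (hm : WeightBound W C m) {g : X → X → ℝ} (hg : Continuous (Function.uncurry g)) {A : ℝ}
    (hgb : ∀ x y, |g x y| ≤ A * √(W x) * √(W y)) : Continuous fun x => ∫ y, g x y ∂m := by
  -- The hypothesis forces `A ≥ 0` as soon as there is a point, since `W ≥ 1`.
  have hA : 0 ≤ A ∨ IsEmpty X := by
    by_cases h : Nonempty X
    · obtain ⟨x⟩ := h
      left
      have h1 := (abs_nonneg _).trans (hgb x x)
      have h2 := hW.one_le_sqrt x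
      by_contra hA
      push Not at hA
      have : A * √(W x) * √(W x) < 0 := by
        apply mul_neg_of_neg_of_pos (mul_neg_of_neg_of_pos hA _) <;> linarith
      linarith
    · exact Or.inr (not_nonempty_iff.1 h)
  rcases hA with hA | hA
  swap
  · exact continuous_of_const fun x => hA.elim x
  rw [continuous_iff_continuousAt]
  intro x
  have hnear : ∀ᶠ z in 𝓝 x, √(W z) < √(W x) + 1 :=
    (hW.continuous.sqrt.tendsto x).eventually (gt_mem_nhds (by linarith))
  refine tendsto_integral_of_vagueTendsto hW (vagueTendsto_const _ m) (C := C)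
    (Eventually.of_forall fun _ => hm) hm (A := A * (√(W x) + 1))
    (hg.comp (Continuous.prodMk_right x)) (Eventually.of_forall fun z => hg.comp (.prodMk_right z))
    (fun y => ?_) ?_ (fun y => ?_)
  · rw [← nhds_prod_eq]
    exact hg.tendsto (x, y)
  · filter_upwards [hnear] with z hz y
    refine (hgb z y).trans ?_
    gcongr
  · refine (hgb x y).trans ?_
    gcongr
    linarith

/-- The version of `tendsto_integral_of_vagueTendsto` for double integrals. -/
theorem tendsto_integral_integral_of_vagueTendsto {ι : Type*} {l : Filter ι} {F : ι → Measure X}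
    {m : Measure X} {W : X → ℝ} (hW : IsProperWeight W) (hv : VagueTendsto F l m) {C : ℝ}
    (hF : ∀ᶠ i in l, WeightBound W C (F i)) (hm : WeightBound W C m) {G : ι → X → X → ℝ}
    {g : X → X → ℝ} (hg : Continuous (Function.uncurry g))
    (hGc : ∀ᶠ i in l, Continuous (Function.uncurry (G i)))
    (hG : ∀ z : X × X, Tendsto (fun p : ι × (X × X) => G p.1 p.2.1 p.2.2) (l ×ˢ 𝓝 z)
      (𝓝 (g z.1 z.2))) {A : ℝ} (hA : 0 ≤ A)
    (hGb : ∀ᶠ i in l, ∀ x y, |G i x y| ≤ A * √(W x) * √(W y))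
    (hgb : ∀ x y, |g x y| ≤ A * √(W x) * √(W y)) :
    Tendsto (fun i => ∫ x, ∫ y, G i x y ∂(F i) ∂(F i)) l (𝓝 (∫ x, ∫ y, g x y ∂m ∂m)) := by
  have inner : ∀ (n : Measure X), WeightBound W C n → ∀ (k : X → X → ℝ),
      (∀ x y, |k x y| ≤ A * √(W x) * √(W y)) → ∀ x, |∫ y, k x y ∂n| ≤ A * C * √(W x) := by
    intro n hn k hk x
    have := hn.abs_integral_le (G := k x) (A := A * √(W x)) (by positivity) fun y =>
      (hk x y).trans (by gcongr; exact hW.sqrt_le y)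
    linarith
  -- The inner integrals are the integrands of the outer one; they grow at most like `A C √W`,
  -- because `√W ≤ W` in the inner variable.
  refine tendsto_integral_of_vagueTendsto hW hv hF hm (A := A * C)
    (continuous_integral_of_abs_le hW hm hg hgb) ?_ (fun x => ?_) ?_ (inner m hm g hgb)
  · filter_upwards [hF, hGc, hGb] with i h1 h2 h3
    exact continuous_integral_of_abs_le hW h1 h2 h3
  -- Continuous convergence of the inner integrals is again the single-integral theorem, along the
  -- product filter, with the outer point as part of the index.
  · have hnear : ∀ᶠ p : ι × X in l ×ˢ 𝓝 x, √(W p.2) < √(W x) + 1 :=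
      tendsto_snd.eventually ((hW.continuous.sqrt.tendsto x).eventually (gt_mem_nhds (by linarith)))
    refine tendsto_integral_of_vagueTendsto (l := l ×ˢ 𝓝 x) (F := fun p => F p.1)
      (G := fun p => G p.1 p.2) hW (hv.comp tendsto_fst) (C := C)
      (tendsto_fst.eventually hF) hm (A := A * (√(W x) + 1))
      (hg.comp (Continuous.prodMk_right x)) ?_ (fun y => ?_) ?_ (fun y => ?_)
    · filter_upwards [tendsto_fst.eventually hGc] with p hp
      exact hp.comp (Continuous.prodMk_right p.2)
    · have h := hG (x, y)
      rw [nhds_prod_eq, ← prod_assoc] at h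
      exact tendsto_map'_iff.1 h
    · filter_upwards [hnear, tendsto_fst.eventually hGb] with p hp hp' y
      refine (hp' p.2 y).trans ?_
      gcongr
    · refine (hgb x y).trans ?_
      gcongr
      linarith
  · filter_upwards [hF, hGb] with i h1 h2
    exact inner _ h1 _ h2

/-- Lower semicontinuity of integrals of nonnegative continuous functions. -/
theorem lintegral_le_of_vagueTendsto {ι : Type*} {l : Filter ι} [l.NeBot] {F : ι → Measure X}
    {m : Measure X} {W : X → ℝ} (hW : IsProperWeight W) [∀ i, IsFiniteMeasureOnCompacts (F i)]
    [IsFiniteMeasureOnCompacts m] (hv : VagueTendsto F l m) {g : X → ℝ} (hg : Continuous g)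
    (hg0 : ∀ x, 0 ≤ g x) {c : ℝ≥0∞} (hF : ∀ᶠ i in l, ∫⁻ x, ENNReal.ofReal (g x) ∂(F i) ≤ c) :
    ∫⁻ x, ENNReal.ofReal (g x) ∂m ≤ c := by
  have hc : ∀ R, Continuous fun x => g x * cutoff W R x := fun R =>
    hg.mul (continuous_cutoff hW.continuous R)
  have h0 : ∀ R x, 0 ≤ g x * cutoff W R x := fun R x => mul_nonneg (hg0 x) (cutoff_nonneg W R x)
  have hs : ∀ R, HasCompactSupport fun x => g x * cutoff W R x := fun R =>
    hasCompactSupport_mul_cutoff hW g R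
  have conv : ∀ (R : ℝ) (n : Measure X) [IsFiniteMeasureOnCompacts n],
      ∫⁻ x, ENNReal.ofReal (g x * cutoff W R x) ∂n
        = ENNReal.ofReal (∫ x, g x * cutoff W R x ∂n) := fun R n _ =>
    (ofReal_integral_eq_lintegral_ofReal ((hc R).integrable_of_hasCompactSupport (hs R))
      (ae_of_all _ (h0 R))).symm
  have hR : ∀ R, ∫⁻ x, ENNReal.ofReal (g x * cutoff W R x) ∂m ≤ c := by
    intro R
    rw [conv]
    refine le_of_tendsto (ENNReal.tendsto_ofReal (hv _ (hc R) (hs R))) ?_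
    filter_upwards [hF] with i hi
    rw [← conv]
    refine le_trans (lintegral_mono fun x => ENNReal.ofReal_le_ofReal ?_) hi
    exact mul_le_of_le_one_right (hg0 x) (cutoff_le_one W R x)
  -- Each point eventually lies where the cutoff is `1`, so Fatou's lemma removes the truncation.
  have hlim : ∀ x, liminf (fun n : ℕ => ENNReal.ofReal (g x * cutoff W n x)) atTop
      = ENNReal.ofReal (g x) := by
    intro x
    refine (Tendsto.congr' ?_ tendsto_const_nhds).liminf_eq
    obtain ⟨N, hN⟩ := exists_nat_ge (W x)
    filter_upwards [eventually_ge_atTop N] with n hn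
    rw [cutoff_eq_one (hN.trans (by exact_mod_cast hn)), mul_one]
  calc ∫⁻ x, ENNReal.ofReal (g x) ∂m
      = ∫⁻ x, liminf (fun n : ℕ => ENNReal.ofReal (g x * cutoff W n x)) atTop ∂m := by
        simp_rw [hlim]
    _ ≤ liminf (fun n : ℕ => ∫⁻ x, ENNReal.ofReal (g x * cutoff W n x) ∂m) atTop :=
        lintegral_liminf_le fun n => (ENNReal.continuous_ofReal.comp (hc n)).measurable
    _ ≤ c := liminf_le_of_frequently_le' (Frequently.of_forall fun n => hR n)

end Vague

/-! ### Compactness for vague convergence -/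

section Compactness

variable {X : Type*} [TopologicalSpace X]

/-- There is a countable family of compactly supported functions which is uniformly dense. -/
lemma exists_countable_family_dense [SecondCountableTopology X] [LocallyCompactSpace X]
    {W : X → ℝ} (hW : IsProperWeight W) :
    ∃ ψ : ℕ × ℕ → X → ℝ, (∀ j, Continuous (ψ j) ∧ HasCompactSupport (ψ j)) ∧
      ∀ φ : X → ℝ, Continuous φ → HasCompactSupport φ → ∀ δ > 0, ∃ j, ∀ x, |φ x - ψ j x| ≤ δ := by
  -- `C(X, ℝ)` is second countable in the compact-open topology, so every subset is separable. For
  -- functions vanishing outside `{W ≤ R}`, closeness on that compact set is uniform closeness.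
  let T : ℕ → Set C(X, ℝ) := fun R => {φ | ∀ x, (R : ℝ) < W x → φ x = 0}
  have hne : ∀ R, Nonempty (T R) := fun R => ⟨⟨0, fun x _ => rfl⟩⟩
  let d : ∀ R, ℕ → T R := fun R => TopologicalSpace.denseSeq (T R)
  refine ⟨fun j => (d j.1 j.2 : C(X, ℝ)), fun j => ⟨(d j.1 j.2 : C(X, ℝ)).continuous,
    hasCompactSupport_of_weight hW (d j.1 j.2).2⟩, fun φ hφ hφ' δ hδ => ?_⟩
  obtain ⟨R₀, hR₀⟩ := exists_weight_bound_of_hasCompactSupport hW hφ'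
  obtain ⟨R, hR⟩ := exists_nat_ge R₀
  have hφR : ∀ x, (R : ℝ) < W x → φ x = 0 := fun x hx => hR₀ x (hR.trans_lt hx)
  let Φ : T R := ⟨⟨φ, hφ⟩, hφR⟩
  let U : Set (T R) := {g | MapsTo ((Φ : C(X, ℝ)) - (g : C(X, ℝ)) : C(X, ℝ)) {x | W x ≤ R}
    (Metric.ball 0 δ)}
  have hU : IsOpen U := (ContinuousMap.isOpen_setOfPred_mapsTo (hW.isCompact_le R)
    Metric.isOpen_ball).preimage (by fun_prop)
  have hΦ : Φ ∈ U := fun x _ => by simpa using hδ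
  obtain ⟨n, hn⟩ := (TopologicalSpace.denseRange_denseSeq (T R)).exists_mem_open hU ⟨Φ, hΦ⟩
  refine ⟨(R, n), fun x => ?_⟩
  rcases le_or_gt (W x) R with h | h
  · have := hn h
    rw [mem_ball_zero_iff] at this
    exact this.le
  · change |φ x - (d R n : C(X, ℝ)) x| ≤ δ
    rw [hφR x h, (d R n).2 x h, sub_zero, abs_zero]
    exact hδ.le

variable [MeasurableSpace X] [BorelSpace X]

lemma integrable_of_hasCompactSupport {m : Measure X} [IsFiniteMeasureOnCompacts m] {φ : X → ℝ}
    (h : Continuous φ) (h' : HasCompactSupport φ) : Integrable φ m :=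
  h.integrable_of_hasCompactSupport h'

/-- A sequence of measures whose integrals of test functions all converge has a vague limit. -/
lemma exists_vagueTendsto [T2Space X] [LocallyCompactSpace X] {F : ℕ → Measure X}
    [∀ n, IsFiniteMeasureOnCompacts (F n)]
    (h : ∀ φ : X → ℝ, Continuous φ → HasCompactSupport φ →
      ∃ c, Tendsto (fun n => ∫ x, φ x ∂(F n)) atTop (𝓝 c)) :
    ∃ m : Measure X, IsFiniteMeasureOnCompacts m ∧ VagueTendsto F atTop m := by
  have h' : ∀ φ : CompactlySupportedContinuousMap X ℝ,
      ∃ c, Tendsto (fun n => ∫ x, φ x ∂(F n)) atTop (𝓝 c) :=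
    fun φ => h φ φ.continuous φ.hasCompactSupport
  choose L hL using h'
  have hint : ∀ (φ : CompactlySupportedContinuousMap X ℝ) n, Integrable (fun x => φ x) (F n) :=
    fun φ n => integrable_of_hasCompactSupport φ.continuous φ.hasCompactSupport
  -- The limit of the integrals is a positive linear functional, which the Riesz–Markov–Kakutani
  -- theorem represents by a measure.
  let Λ : CompactlySupportedContinuousMap X ℝ →ₚ[ℝ] ℝ :=
    { toFun := L
      map_add' := fun φ ψ => by
        refine tendsto_nhds_unique (hL (φ + ψ)) (((hL φ).add (hL ψ)).congr fun n => ?_)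
        rw [← integral_add (hint φ n) (hint ψ n)]
        rfl
      map_smul' := fun c φ => by
        refine tendsto_nhds_unique (hL (c • φ)) (((hL φ).const_mul c).congr fun n => ?_)
        rw [← integral_const_mul]
        rfl
      monotone' := fun φ ψ hφψ => by
        refine le_of_tendsto_of_tendsto' (hL φ) (hL ψ) fun n => ?_
        exact integral_mono (hint φ n) (hint ψ n) hφψ }
  refine ⟨RealRMK.rieszMeasure Λ, inferInstance, fun φ hφ hφ' => ?_⟩
  have := RealRMK.integral_rieszMeasure Λ ⟨⟨φ, hφ⟩, hφ'⟩
  change ∫ x, φ x ∂_ = L _ at this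
  rw [this]
  exact hL ⟨⟨φ, hφ⟩, hφ'⟩

lemma abs_integral_sub_le {m : Measure X} [IsFiniteMeasure m] {M : ℝ} (hM : m.real univ ≤ M)
    {φ ψ : X → ℝ} (hφ : Integrable φ m) (hψ : Integrable ψ m) {δ : ℝ} (hδ : 0 ≤ δ)
    (h : ∀ x, |φ x - ψ x| ≤ δ) : |∫ x, φ x ∂m - ∫ x, ψ x ∂m| ≤ δ * M := by
  rw [← integral_sub hφ hψ]
  refine (norm_integral_le_of_norm_le_const (f := fun x => φ x - ψ x) (ae_of_all _ h)).trans ?_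
  gcongr

/-- Asymptotic equicontinuity of a sequence of curves of measures at a time `t`. -/
def AsympEquicontinuousAt (F : ℕ → ℝ → Measure X) (J : Set ℝ) (φ : X → ℝ) (t : ℝ) : Prop :=
  ∀ δ > 0, ∃ ρ > 0, ∀ s ∈ J, |s - t| < ρ →
    ∀ᶠ n in atTop, |∫ x, φ x ∂(F n s) - ∫ x, φ x ∂(F n t)| ≤ δ

/-- An asymptotically equicontinuous sequence of curves of measures with bounded mass has a
subsequence which converges vaguely at all times, and the limit is vaguely continuous. -/
theorem exists_subseq_vagueTendsto [T2Space X] [SecondCountableTopology X] [LocallyCompactSpace X]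
    {W : X → ℝ} (hW : IsProperWeight W) {F : ℕ → ℝ → Measure X} [∀ n t, IsFiniteMeasure (F n t)]
    {J : Set ℝ} {M : ℝ → ℝ} (hM : ∀ n, ∀ t ∈ J, (F n t).real univ ≤ M t)
    (heq : ∀ φ : X → ℝ, Continuous φ → HasCompactSupport φ → ∀ t ∈ J,
      AsympEquicontinuousAt F J φ t) :
    ∃ θ : ℕ → ℕ, StrictMono θ ∧ ∃ f : ℝ → Measure X,
      (∀ t, IsFiniteMeasureOnCompacts (f t)) ∧
      (∀ t ∈ J, VagueTendsto (fun n => F (θ n) t) atTop (f t)) ∧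
      ∀ φ : X → ℝ, Continuous φ → HasCompactSupport φ →
        ContinuousOn (fun t => ∫ x, φ x ∂(f t)) J := by
  obtain ⟨ψ, hψ, hψd⟩ := exists_countable_family_dense hW
  have hint : ∀ φ : X → ℝ, Continuous φ → HasCompactSupport φ → ∀ n t, Integrable φ (F n t) :=
    fun φ h h' n t => integrable_of_hasCompactSupport h h'
  obtain ⟨D, hDc, hDd⟩ := TopologicalSpace.exists_countable_dense J
  have : Countable D := hDc
  have hb : ∀ j, ∃ B, 0 ≤ B ∧ ∀ x, |ψ j x| ≤ B := fun j => by
    obtain ⟨B, hB⟩ := (hψ j).1.bounded_above_of_compact_support (hψ j).2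
    exact ⟨|B|, abs_nonneg _, fun x => (hB x).trans (le_abs_self B)⟩
  choose B hB0 hB using hb
  have hM0 : ∀ t ∈ J, 0 ≤ M t := fun t ht => measureReal_nonneg.trans (hM 0 t ht)
  -- One bounded sequence for each dense test function and each time in a countable dense set;
  -- compactness of the product of intervals replaces a diagonal extraction.
  let xs : ℕ → ((ℕ × ℕ) × D → ℝ) := fun n p => ∫ x, ψ p.1 x ∂(F n p.2)
  have hmem : ∀ n, xs n ∈ pi univ fun p : (ℕ × ℕ) × D =>
      Icc (-(B p.1 * M p.2)) (B p.1 * M p.2) := by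
    intro n p _
    refine abs_le.1 ((norm_integral_le_of_norm_le_const (f := ψ p.1)
      (ae_of_all _ (hB p.1))).trans ?_)
    exact mul_le_mul_of_nonneg_left (hM n _ p.2.1.2) (hB0 _)
  obtain ⟨ℓ, -, θ, hθ, hlim⟩ := (isCompact_univ_pi fun _ => isCompact_Icc).tendsto_subseq hmem
  rw [tendsto_pi_nhds] at hlim
  have key : ∀ t ∈ J, ∀ φ : X → ℝ, Continuous φ → HasCompactSupport φ →
      ∃ c, Tendsto (fun n => ∫ x, φ x ∂(F (θ n) t)) atTop (𝓝 c) := by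
    intro t ht φ hφ hφ'
    refine cauchySeq_tendsto_of_complete (Metric.cauchySeq_iff'.2 fun δ hδ => ?_)
    obtain ⟨ρ, hρ, hequi⟩ := heq φ hφ hφ' t ht (δ / 8) (by positivity)
    obtain ⟨⟨s, hs⟩, hsD, hst⟩ := hDd.exists_dist_lt ⟨t, ht⟩ hρ
    rw [dist_comm] at hst
    change |s - t| < ρ at hst
    have hMs := hM0 s hs
    obtain ⟨j, hj⟩ := hψd φ hφ hφ' (δ / (8 * (M s + 1))) (by positivity)
    have hc := (hlim (j, ⟨⟨s, hs⟩, hsD⟩)).cauchySeq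
    obtain ⟨N₁, hN₁⟩ := Metric.cauchySeq_iff'.1 hc (δ / 8) (by positivity)
    obtain ⟨N₂, hN₂⟩ := eventually_atTop.1 (hequi s hs hst)
    have hsmall : δ / (8 * (M s + 1)) * M s ≤ δ / 8 := by
      rw [div_mul_eq_mul_div, div_le_div_iff₀ (by positivity) (by positivity)]
      nlinarith
    have hclose : ∀ n, |∫ x, φ x ∂(F n s) - ∫ x, ψ j x ∂(F n s)| ≤ δ / 8 := fun n =>
      (abs_integral_sub_le (hM n s hs) (hint φ hφ hφ' n s) (hint _ (hψ j).1 (hψ j).2 n s)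
        (by positivity) hj).trans hsmall
    -- Three errors of `δ / 8`: from `t` to a nearby dense time `s`, from `φ` to `ψ j`, and the
    -- Cauchy bound for `ψ j` at `s`. Comparing two indices doubles this to `6δ / 8`.
    have hdist : ∀ n, max N₁ N₂ ≤ n → |∫ x, φ x ∂(F (θ n) t) - xs (θ N₁) (j, ⟨⟨s, hs⟩, hsD⟩)|
        ≤ 3 * (δ / 8) := by
      intro n hn
      have a1 := hN₂ (θ n) (((le_max_right _ _).trans hn).trans (hθ.id_le n))
      have a2 := hclose (θ n)
      have a3 := hN₁ n ((le_max_left _ _).trans hn)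
      rw [Real.dist_eq] at a3
      change |∫ x, ψ j x ∂(F (θ n) s) - xs (θ N₁) (j, ⟨⟨s, hs⟩, hsD⟩)| < δ / 8 at a3
      rw [abs_le] at a1 a2 ⊢
      rw [abs_lt] at a3
      constructor <;> linarith [a1.1, a1.2, a2.1, a2.2, a3.1, a3.2]
    refine ⟨max N₁ N₂, fun n hn => ?_⟩
    have b1 := hdist n hn
    have b2 := hdist _ le_rfl
    rw [Real.dist_eq]
    rw [abs_le] at b1 b2
    rw [abs_lt]
    constructor <;> linarith [b1.1, b1.2, b2.1, b2.2]
  have hex : ∀ t, ∃ m : Measure X, IsFiniteMeasureOnCompacts m ∧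
      (t ∈ J → VagueTendsto (fun n => F (θ n) t) atTop m) := by
    intro t
    by_cases ht : t ∈ J
    · obtain ⟨m, hm, hm'⟩ := exists_vagueTendsto (F := fun n => F (θ n) t) (key t ht)
      exact ⟨m, hm, fun _ => hm'⟩
    · exact ⟨0, inferInstance, fun h => absurd h ht⟩
  choose f hf hft using hex
  refine ⟨θ, hθ, f, hf, hft, fun φ hφ hφ' t ht => ?_⟩
  rw [ContinuousWithinAt, Metric.tendsto_nhds]
  intro δ hδ
  obtain ⟨ρ, hρ, hequi⟩ := heq φ hφ hφ' t ht (δ / 2) (by positivity)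
  filter_upwards [self_mem_nhdsWithin, mem_nhdsWithin_of_mem_nhds (Metric.ball_mem_nhds t hρ)]
    with s hs hst
  have hle : |∫ x, φ x ∂(f s) - ∫ x, φ x ∂(f t)| ≤ δ / 2 :=
    le_of_tendsto ((hft s hs φ hφ hφ').sub (hft t ht φ hφ hφ')).abs
      (hθ.tendsto_atTop.eventually (hequi s hs hst))
  rw [Real.dist_eq]
  linarith

end Compactness

/-! ### An explicit time discretization of the coagulation equation -/

section Scheme

variable {X : Type*} [MeasurableSpace X]

lemma integrable_of_bounded {m : Measure X} [IsFiniteMeasure m] {φ : X → ℝ}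
    (hφ : Measurable φ) {B : ℝ} (hB : ∀ x, |φ x| ≤ B) : Integrable φ m :=
  Integrable.of_bound hφ.aestronglyMeasurable B (ae_of_all _ hB)

/-- The rate `∫ κ(x, y) m(dy)` at which a particle `x` disappears. -/
def lossRate (κ : X → X → ℝ) (m : Measure X) (x : X) : ℝ≥0∞ := ∫⁻ y, ENNReal.ofReal (κ x y) ∂m

/-- A bounded kernel which is measurable, nonnegative and symmetric. -/
structure IsBoundedKernel (κ : X → X → ℝ) (N : ℝ) : Prop where
  measurable : Measurable (Function.uncurry κ)
  nonneg : ∀ x y, 0 ≤ κ x y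
  symm : ∀ x y, κ x y = κ y x
  le : ∀ x y, κ x y ≤ N

lemma IsBoundedKernel.measurable_ofReal {κ : X → X → ℝ} {N : ℝ} (hκ : IsBoundedKernel κ N) :
    Measurable fun p : X × X => ENNReal.ofReal (κ p.1 p.2) :=
  ENNReal.measurable_ofReal.comp hκ.measurable

lemma IsBoundedKernel.measurable_lossRate {κ : X → X → ℝ} {N : ℝ} (hκ : IsBoundedKernel κ N)
    (m : Measure X) [SFinite m] : Measurable (lossRate κ m) :=
  hκ.measurable_ofReal.lintegral_prod_right'

lemma lossRate_le {κ : X → X → ℝ} {N : ℝ} (hκ : IsBoundedKernel κ N) (m : Measure X) (x : X) :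
    lossRate κ m x ≤ ENNReal.ofReal N * m univ := by
  calc lossRate κ m x ≤ ∫⁻ _, ENNReal.ofReal N ∂m :=
        lintegral_mono fun y => ENNReal.ofReal_le_ofReal (hκ.le x y)
    _ = _ := lintegral_const _

variable [Add X]

/-- An explicit Euler step of length `h` for the coagulation equation with kernel `κ`. -/
def coagStep (κ : X → X → ℝ) (h : ℝ) (m : Measure X) : Measure X :=
  m.withDensity (fun x => 1 - ENNReal.ofReal h * lossRate κ m x) +
    ENNReal.ofReal (h / 2) • ((m.prod m).withDensity fun p => ENNReal.ofReal (κ p.1 p.2)).map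
      fun p => p.1 + p.2

/-- The iterates of a coagulation step followed by the transport map `S`. -/
def schemeIter (κ : X → X → ℝ) (S : X → X) (h : ℝ) (m : Measure X) : ℕ → Measure X
  | 0 => m
  | j + 1 => (coagStep κ h (schemeIter κ S h m j)).map S

variable [MeasurableAdd₂ X]

lemma lintegral_coagStep {κ : X → X → ℝ} {N : ℝ} (hκ : IsBoundedKernel κ N) {h : ℝ}
    {m : Measure X} [IsFiniteMeasure m] {ψ : X → ℝ≥0∞} (hψ : Measurable ψ) :
    ∫⁻ x, ψ x ∂(coagStep κ h m) = ∫⁻ x, (1 - ENNReal.ofReal h * lossRate κ m x) * ψ x ∂m +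
      ENNReal.ofReal (h / 2) * ∫⁻ x, ∫⁻ y, ENNReal.ofReal (κ x y) * ψ (x + y) ∂m ∂m := by
  have hadd : Measurable fun p : X × X => p.1 + p.2 := measurable_fst.add measurable_snd
  have hψadd : Measurable fun p : X × X => ψ (p.1 + p.2) := hψ.comp hadd
  have hdens : Measurable fun x => 1 - ENNReal.ofReal h * lossRate κ m x :=
    measurable_const.sub ((hκ.measurable_lossRate m).const_mul _)
  rw [coagStep, lintegral_add_measure, lintegral_smul_measure,
    lintegral_withDensity_eq_lintegral_mul _ hdens hψ,
    lintegral_map hψ hadd,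
    lintegral_withDensity_eq_lintegral_mul _ hκ.measurable_ofReal hψadd,
    lintegral_prod _ (hκ.measurable_ofReal.mul hψadd).aemeasurable]
  rfl

/-- The basic moment inequality for a coagulation step. -/
lemma lintegral_coagStep_le {κ : X → X → ℝ} {N : ℝ} (hκ : IsBoundedKernel κ N) {h : ℝ}
    (hh : 0 ≤ h) {m : Measure X} [IsFiniteMeasure m]
    (hle : ∀ x, ENNReal.ofReal h * lossRate κ m x ≤ 1) {ψ : X → ℝ≥0∞} (hψ : Measurable ψ)
    {D : X → X → ℝ≥0∞}
    (hψD : ∀ x y, ψ (x + y) ≤ ψ x + ψ y + D x y) :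
    ∫⁻ x, ψ x ∂(coagStep κ h m) ≤ ∫⁻ x, ψ x ∂m +
      ENNReal.ofReal (h / 2) * ∫⁻ x, ∫⁻ y, ENNReal.ofReal (κ x y) * D x y ∂m ∂m := by
  have hk := hκ.measurable_ofReal
  have hkx : ∀ x, Measurable fun y => ENNReal.ofReal (κ x y) := fun x =>
    hk.comp measurable_prodMk_left
  have hlr := hκ.measurable_lossRate m
  have e1 : ∫⁻ x, ∫⁻ y, ENNReal.ofReal (κ x y) * ψ x ∂m ∂m = ∫⁻ x, lossRate κ m x * ψ x ∂m :=
    lintegral_congr fun x => lintegral_mul_const _ (hkx x)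
  have e2 : ∫⁻ x, ∫⁻ y, ENNReal.ofReal (κ x y) * ψ y ∂m ∂m
      = ∫⁻ x, lossRate κ m x * ψ x ∂m := by
    rw [← e1, lintegral_lintegral_swap (hk.mul (hψ.comp measurable_snd)).aemeasurable]
    exact lintegral_congr fun x => lintegral_congr fun y => by rw [hκ.symm]
  have e3 : ∫⁻ x, ∫⁻ y, ENNReal.ofReal (κ x y) * (ψ x + ψ y + D x y) ∂m ∂m
      = ∫⁻ x, lossRate κ m x * ψ x ∂m + ∫⁻ x, lossRate κ m x * ψ x ∂m
        + ∫⁻ x, ∫⁻ y, ENNReal.ofReal (κ x y) * D x y ∂m ∂m := by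
    have i1 : ∀ x, ∫⁻ y, ENNReal.ofReal (κ x y) * (ψ x + ψ y + D x y) ∂m
        = ∫⁻ y, ENNReal.ofReal (κ x y) * ψ x ∂m + ∫⁻ y, ENNReal.ofReal (κ x y) * ψ y ∂m
          + ∫⁻ y, ENNReal.ofReal (κ x y) * D x y ∂m := by
      intro x
      simp_rw [mul_add]
      have m0 : Measurable fun y => ENNReal.ofReal (κ x y) * ψ x := (hkx x).mul_const _
      have m1 : Measurable fun y => ENNReal.ofReal (κ x y) * ψ x + ENNReal.ofReal (κ x y) * ψ y :=
        m0.add ((hkx x).mul hψ)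
      rw [lintegral_add_left m1, lintegral_add_left m0]
    simp_rw [i1]
    have m1 : Measurable fun x => ∫⁻ y, ENNReal.ofReal (κ x y) * ψ x ∂m :=
      (hk.mul (hψ.comp measurable_fst)).lintegral_prod_right'
    have m2 : Measurable fun x => ∫⁻ y, ENNReal.ofReal (κ x y) * ψ y ∂m :=
      (hk.mul (hψ.comp measurable_snd)).lintegral_prod_right'
    have m3 : Measurable fun x => ∫⁻ y, ENNReal.ofReal (κ x y) * ψ x ∂m
        + ∫⁻ y, ENNReal.ofReal (κ x y) * ψ y ∂m := m1.add m2
    rw [lintegral_add_left m3, lintegral_add_left m1, e1, e2]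
  have half : ENNReal.ofReal (h / 2) + ENNReal.ofReal (h / 2) = ENNReal.ofReal h := by
    rw [← ENNReal.ofReal_add (by positivity) (by positivity), add_halves]
  calc ∫⁻ x, ψ x ∂(coagStep κ h m)
      ≤ ∫⁻ x, (1 - ENNReal.ofReal h * lossRate κ m x) * ψ x ∂m + ENNReal.ofReal (h / 2) *
          ∫⁻ x, ∫⁻ y, ENNReal.ofReal (κ x y) * (ψ x + ψ y + D x y) ∂m ∂m := by
        rw [lintegral_coagStep hκ hψ]
        gcongr
        exact hψD _ _
    _ = (∫⁻ x, (1 - ENNReal.ofReal h * lossRate κ m x) * ψ x ∂m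
          + ENNReal.ofReal h * ∫⁻ x, lossRate κ m x * ψ x ∂m)
          + ENNReal.ofReal (h / 2) * ∫⁻ x, ∫⁻ y, ENNReal.ofReal (κ x y) * D x y ∂m ∂m := by
        rw [e3, mul_add, mul_add, ← add_mul, half, add_assoc]
    _ = _ := by
        congr 1
        have m1 : Measurable fun x => lossRate κ m x * ψ x := hlr.mul hψ
        rw [← lintegral_const_mul _ m1, ← lintegral_add_right _ (m1.const_mul _)]
        refine lintegral_congr fun x => ?_
        -- Since `h · lossRate ≤ 1`, the truncated subtraction is a true one and the loss term
        -- cancels exactly.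
        rw [← mul_assoc, ← add_mul, tsub_add_cancel_of_le (hle x), one_mul]

/-- The conditions under which the discretization is well behaved. -/
structure IsScheme (κ : X → X → ℝ) (S : X → X) (h N : ℝ) (m : Measure X) : Prop where
  kernel : IsBoundedKernel κ N
  measurable : Measurable S
  step_pos : 0 < h
  finite : IsFiniteMeasure m
  small : ENNReal.ofReal h * (ENNReal.ofReal N * m univ) ≤ 1

variable {κ : X → X → ℝ} {S : X → X} {h N : ℝ} {m : Measure X}

/-- Measures of no larger mass inherit the smallness of the step, so one condition at time zero
serves every iterate. -/
lemma IsScheme.step_lossRate_le (hs : IsScheme κ S h N m) {n : Measure X} (hn : n univ ≤ m univ)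
    (x : X) : ENNReal.ofReal h * lossRate κ n x ≤ 1 := by
  refine le_trans ?_ hs.small
  gcongr
  exact (lossRate_le hs.kernel n x).trans (by gcongr)

/-- Merging two particles into one satisfies `1 ≤ 1 + 1`, so the number of particles does not grow.
The induction also supplies the finiteness and the step condition that the moment inequality needs.
-/
lemma IsScheme.mass_le (hs : IsScheme κ S h N m) (j : ℕ) :
    schemeIter κ S h m j univ ≤ m univ := by
  have := hs.finite
  induction j with
  | zero => exact le_rfl
  | succ j ih =>
    have hfin : IsFiniteMeasure (schemeIter κ S h m j) := ⟨ih.trans_lt (measure_lt_top m univ)⟩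
    have key := lintegral_coagStep_le hs.kernel hs.step_pos.le
      (hs.step_lossRate_le ih) (ψ := fun _ => 1) measurable_const (D := fun _ _ => 0)
      (fun x y => by simp)
    simp only [lintegral_one, mul_zero, lintegral_zero, add_zero] at key
    rw [schemeIter, Measure.map_apply hs.measurable MeasurableSet.univ, preimage_univ]
    exact key.trans ih

lemma IsScheme.isFiniteMeasure (hs : IsScheme κ S h N m) (j : ℕ) :
    IsFiniteMeasure (schemeIter κ S h m j) := by
  have := hs.finite
  exact ⟨(hs.mass_le j).trans_lt (measure_lt_top m univ)⟩

/-- Allowing `ψ'` to differ from `ψ` lets a contraction produced by the transport map be recorded;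
the estimate of the excess area relies on this. -/
lemma IsScheme.lintegral_succ_le (hs : IsScheme κ S h N m) {ψ ψ' : X → ℝ≥0∞} (hψ : Measurable ψ)
    (hψ' : Measurable ψ') (hS : ∀ x, ψ' (S x) ≤ ψ x) {D : X → X → ℝ≥0∞}
    (hψD : ∀ x y, ψ (x + y) ≤ ψ x + ψ y + D x y) (j : ℕ) :
    ∫⁻ x, ψ' x ∂(schemeIter κ S h m (j + 1)) ≤ ∫⁻ x, ψ x ∂(schemeIter κ S h m j) +
      ENNReal.ofReal (h / 2) * ∫⁻ x, ∫⁻ y, ENNReal.ofReal (κ x y) * D x y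
        ∂(schemeIter κ S h m j) ∂(schemeIter κ S h m j) := by
  have := hs.isFiniteMeasure j
  rw [schemeIter, lintegral_map hψ' hs.measurable]
  exact (lintegral_mono hS).trans (lintegral_coagStep_le hs.kernel hs.step_pos.le
    (hs.step_lossRate_le (hs.mass_le j)) hψ hψD)

/-- A discrete Gronwall estimate for moments: the coagulation gain `D` of the moment `ψ` is
controlled, through the kernel, by `ψ` itself and by a moment `ℓ` which is already bounded. -/
lemma IsScheme.lintegral_le_pow (hs : IsScheme κ S h N m) {ψ ℓ : X → ℝ≥0∞} (hψ : Measurable ψ)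
    (hℓ : Measurable ℓ) (hS : ∀ x, ψ (S x) ≤ ψ x) {D : X → X → ℝ≥0∞}
    (hψD : ∀ x y, ψ (x + y) ≤ ψ x + ψ y + D x y)
    (hκD : ∀ x y, ENNReal.ofReal (κ x y) * D x y ≤ ψ x * ℓ y + ℓ x * ψ y) {B : ℝ≥0∞} {J : ℕ}
    (hB : ∀ j < J, ∫⁻ x, ℓ x ∂(schemeIter κ S h m j) ≤ B) (j : ℕ) (hj : j ≤ J) :
    ∫⁻ x, ψ x ∂(schemeIter κ S h m j) ≤ (1 + ENNReal.ofReal h * B) ^ j * ∫⁻ x, ψ x ∂m := by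
  induction j with
  | zero => simp [schemeIter]
  | succ j ih =>
    have := hs.isFiniteMeasure j
    set f := schemeIter κ S h m j
    have half : ENNReal.ofReal (h / 2) * 2 = ENNReal.ofReal h := by
      rw [← ENNReal.ofReal_ofNat 2, ← ENNReal.ofReal_mul (by linarith [hs.step_pos])]
      congr 1
      ring
    have hBj := hB j (by omega)
    have key : ∫⁻ x, ∫⁻ y, ENNReal.ofReal (κ x y) * D x y ∂f ∂f ≤ 2 * (B * ∫⁻ x, ψ x ∂f) := by
      calc ∫⁻ x, ∫⁻ y, ENNReal.ofReal (κ x y) * D x y ∂f ∂f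
          ≤ ∫⁻ x, ∫⁻ y, (ψ x * ℓ y + ℓ x * ψ y) ∂f ∂f :=
            lintegral_mono fun x => lintegral_mono fun y => hκD x y
        _ = ∫⁻ x, (ψ x * ∫⁻ y, ℓ y ∂f + ℓ x * ∫⁻ y, ψ y ∂f) ∂f := by
            refine lintegral_congr fun x => ?_
            rw [lintegral_add_left (hℓ.const_mul _), lintegral_const_mul _ hℓ,
              lintegral_const_mul _ hψ]
        _ = 2 * ((∫⁻ x, ℓ x ∂f) * ∫⁻ x, ψ x ∂f) := by
            rw [lintegral_add_left (hψ.mul_const _), lintegral_mul_const _ hψ,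
              lintegral_mul_const _ hℓ, two_mul, mul_comm (∫⁻ x, ψ x ∂f)]
        _ ≤ _ := by gcongr
    calc ∫⁻ x, ψ x ∂(schemeIter κ S h m (j + 1))
        ≤ ∫⁻ x, ψ x ∂f + ENNReal.ofReal (h / 2) * (2 * (B * ∫⁻ x, ψ x ∂f)) :=
          (hs.lintegral_succ_le hψ hψ hS hψD j).trans (by gcongr)
      _ = (1 + ENNReal.ofReal h * B) * ∫⁻ x, ψ x ∂f := by
          rw [← mul_assoc, half, ← mul_assoc, add_mul, one_mul]
      _ ≤ (1 + ENNReal.ofReal h * B) * ((1 + ENNReal.ofReal h * B) ^ j * ∫⁻ x, ψ x ∂m) := by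
          gcongr
          exact ih (by omega)
      _ = _ := by rw [← mul_assoc, pow_succ']

lemma one_add_mul_pow_le_exp {h B t : ℝ} (hh : 0 ≤ h) (hB : 0 ≤ B) {j : ℕ} (hj : h * j ≤ t) :
    (1 + ENNReal.ofReal h * ENNReal.ofReal B) ^ j ≤ ENNReal.ofReal (Real.exp (B * t)) := by
  rw [← ENNReal.ofReal_mul hh, ← ENNReal.ofReal_one, ← ENNReal.ofReal_add zero_le_one
    (by positivity), ← ENNReal.ofReal_pow (by positivity)]
  refine ENNReal.ofReal_le_ofReal ?_
  calc (1 + h * B) ^ j ≤ Real.exp (h * B) ^ j := by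
        gcongr
        linarith [Real.add_one_le_exp (h * B)]
    _ = Real.exp (B * (h * j)) := by rw [← Real.exp_nat_mul]; ring_nf
    _ ≤ _ := by gcongr

/-- The action of a coagulation step on bounded test functions. -/
lemma integral_coagStep (hκ : IsBoundedKernel κ N) (hh : 0 ≤ h) [IsFiniteMeasure m]
    (hle : ∀ x, ENNReal.ofReal h * lossRate κ m x ≤ 1) {φ : X → ℝ} (hφ : Measurable φ) {B : ℝ}
    (hB : ∀ x, |φ x| ≤ B) :
    ∫ x, φ x ∂(coagStep κ h m) = ∫ x, φ x ∂m +
      h * ((1 / 2) * ∫ x, ∫ y, κ x y * (φ (x + y) - φ x - φ y) ∂m ∂m) := by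
  have hadd : Measurable fun p : X × X => p.1 + p.2 := measurable_fst.add measurable_snd
  have hlr := hκ.measurable_lossRate m
  have hκ2 : Measurable fun p : X × X => κ p.1 p.2 := hκ.measurable
  have hκb : ∀ x y, |κ x y| ≤ N := fun x y => by rw [abs_of_nonneg (hκ.nonneg x y)]; exact hκ.le x y
  have hmulb : ∀ {u : X × X → ℝ}, (∀ p, |u p| ≤ B) → ∀ p : X × X, |κ p.1 p.2 * u p| ≤ N * B := by
    intro u hu p
    rw [abs_mul]
    exact mul_le_mul (hκb _ _) (hu p) (abs_nonneg _) ((abs_nonneg _).trans (hκb p.1 p.2))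
  have I : ∀ {u : X × X → ℝ}, Measurable u → (∀ p, |u p| ≤ B) →
      Integrable (fun p : X × X => κ p.1 p.2 * u p) (m.prod m) := fun hu hub =>
    integrable_of_bounded (hκ2.mul hu) (hmulb hub)
  have i0 : Integrable (fun p : X × X => κ p.1 p.2 * φ (p.1 + p.2)) (m.prod m) :=
    I (hφ.comp hadd) fun p => hB _
  have i1 : Integrable (fun p : X × X => κ p.1 p.2 * φ p.1) (m.prod m) :=
    I (hφ.comp measurable_fst) fun p => hB _
  have i2 : Integrable (fun p : X × X => κ p.1 p.2 * φ p.2) (m.prod m) :=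
    I (hφ.comp measurable_snd) fun p => hB _
  have hrate : ∀ x, (lossRate κ m x).toReal = ∫ y, κ x y ∂m := fun x =>
    (integral_eq_lintegral_of_nonneg_ae (ae_of_all _ (hκ.nonneg x))
      (hκ2.comp measurable_prodMk_left).aestronglyMeasurable).symm
  have hratetop : ∀ x, ENNReal.ofReal h * lossRate κ m x ≠ ⊤ := fun x =>
    ((hle x).trans_lt ENNReal.one_lt_top).ne
  have hdens : Measurable fun x => 1 - ENNReal.ofReal h * lossRate κ m x :=
    measurable_const.sub (hlr.const_mul _)
  have t1 : ∫ x, φ x ∂(m.withDensity fun x => 1 - ENNReal.ofReal h * lossRate κ m x)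
      = ∫ x, φ x ∂m - h * ∫ p, κ p.1 p.2 * φ p.1 ∂(m.prod m) := by
    rw [integral_withDensity_eq_integral_toReal_smul hdens
      (ae_of_all _ fun x => (tsub_le_self).trans_lt ENNReal.one_lt_top), integral_prod _ i1,
      ← integral_const_mul, ← integral_sub (integrable_of_bounded hφ hB)
        (i1.integral_prod_left.const_mul h)]
    refine integral_congr_ae (ae_of_all _ fun x => ?_)
    simp only [smul_eq_mul]
    rw [ENNReal.toReal_sub_of_le (hle x) ENNReal.one_ne_top, ENNReal.toReal_mul,
      ENNReal.toReal_ofReal hh, hrate, integral_mul_const, ENNReal.toReal_one]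
    ring
  have hfin : IsFiniteMeasure ((m.prod m).withDensity fun p => ENNReal.ofReal (κ p.1 p.2)) :=
    isFiniteMeasure_withDensity (ne_of_lt (by
      calc ∫⁻ p, ENNReal.ofReal (κ p.1 p.2) ∂(m.prod m) ≤ ∫⁻ _, ENNReal.ofReal N ∂(m.prod m) :=
            lintegral_mono fun p => ENNReal.ofReal_le_ofReal (hκ.le _ _)
        _ < ⊤ := by
            rw [lintegral_const]
            exact ENNReal.mul_lt_top ENNReal.ofReal_lt_top (measure_lt_top _ _)))
  have t2 : ∫ x, φ x ∂(((m.prod m).withDensity fun p => ENNReal.ofReal (κ p.1 p.2)).map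
      fun p => p.1 + p.2) = ∫ p, κ p.1 p.2 * φ (p.1 + p.2) ∂(m.prod m) := by
    rw [integral_map hadd.aemeasurable hφ.aestronglyMeasurable,
      integral_withDensity_eq_integral_toReal_smul hκ.measurable_ofReal
        (ae_of_all _ fun _ => ENNReal.ofReal_lt_top)]
    refine integral_congr_ae (ae_of_all _ fun p => ?_)
    simp only [smul_eq_mul, ENNReal.toReal_ofReal (hκ.nonneg p.1 p.2)]
  have t3 : ∫ p, κ p.1 p.2 * φ p.2 ∂(m.prod m) = ∫ p, κ p.1 p.2 * φ p.1 ∂(m.prod m) := by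
    rw [← integral_prod_swap]
    refine integral_congr_ae (ae_of_all _ fun p => ?_)
    simp only [Prod.fst_swap, Prod.snd_swap]
    rw [hκ.symm]
  have hfin1 : IsFiniteMeasure (m.withDensity fun x => 1 - ENNReal.ofReal h * lossRate κ m x) :=
    isFiniteMeasure_withDensity (ne_of_lt (by
      calc ∫⁻ x, (1 - ENNReal.ofReal h * lossRate κ m x) ∂m ≤ ∫⁻ _, 1 ∂m :=
            lintegral_mono fun _ => tsub_le_self
        _ < ⊤ := by simp))
  have t4 : ∫ x, ∫ y, κ x y * (φ (x + y) - φ x - φ y) ∂m ∂m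
      = ∫ p, κ p.1 p.2 * φ (p.1 + p.2) ∂(m.prod m) - ∫ p, κ p.1 p.2 * φ p.1 ∂(m.prod m)
        - ∫ p, κ p.1 p.2 * φ p.2 ∂(m.prod m) := by
    have i3 : Integrable (fun p : X × X => κ p.1 p.2 * φ (p.1 + p.2) - κ p.1 p.2 * φ p.1)
      (m.prod m) := i0.sub i1
    have i4 : Integrable (fun p : X × X => κ p.1 p.2 * φ (p.1 + p.2) - κ p.1 p.2 * φ p.1
      - κ p.1 p.2 * φ p.2) (m.prod m) := i3.sub i2
    rw [← integral_sub i0 i1, ← integral_sub i3 i2, integral_prod _ i4]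
    refine integral_congr_ae (ae_of_all _ fun x => integral_congr_ae (ae_of_all _ fun y => ?_))
    ring
  rw [coagStep, integral_add_measure (integrable_of_bounded hφ hB)
    ((integrable_of_bounded hφ hB).smul_measure ENNReal.ofReal_ne_top), integral_smul_measure,
    t1, t2, t4, t3, ENNReal.toReal_ofReal (by positivity), smul_eq_mul]
  ring

/-- The increment of the integral of a time dependent test function along the discretization. -/
lemma IsScheme.integral_succ_sub (hs : IsScheme κ S h N m) {φ φ' : X → ℝ} (hφ : Measurable φ)
    (hφ' : Measurable φ') {B : ℝ} (hB : ∀ x, |φ x| ≤ B) (hB' : ∀ x, |φ' x| ≤ B) (j : ℕ) :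
    ∫ x, φ' x ∂(schemeIter κ S h m (j + 1)) - ∫ x, φ x ∂(schemeIter κ S h m j)
      = h * (∫ x, (φ' (S x) - φ x) / h ∂(schemeIter κ S h m j)
        + (1 / 2) * ∫ x, ∫ y, κ x y * (φ' (S (x + y)) - φ' (S x) - φ' (S y))
          ∂(schemeIter κ S h m j) ∂(schemeIter κ S h m j)) := by
  have := hs.isFiniteMeasure j
  have hSφ : Measurable fun x => φ' (S x) := hφ'.comp hs.measurable
  have hh := hs.step_pos.ne'
  rw [schemeIter, integral_map hs.measurable.aemeasurable hφ'.aestronglyMeasurable,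
    integral_coagStep hs.kernel hs.step_pos.le (hs.step_lossRate_le (hs.mass_le j)) hSφ
      (fun x => hB' (S x)), integral_div, integral_sub (integrable_of_bounded hSφ fun x => hB' _)
      (integrable_of_bounded hφ hB)]
  field_simp
  ring

end Scheme

/-! ### Inequalities for real powers -/

section Powers

lemma rpow_le_rpow_add_rpow {v q q₁ q₂ : ℝ} (hv : 0 < v) (h₁ : q₁ ≤ q) (h₂ : q ≤ q₂) :
    v ^ q ≤ v ^ q₁ + v ^ q₂ := by
  have p₁ := Real.rpow_pos_of_pos hv q₁
  have p₂ := Real.rpow_pos_of_pos hv q₂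
  rcases le_total v 1 with h | h
  · linarith [Real.rpow_le_rpow_of_exponent_ge hv h h₁]
  · linarith [Real.rpow_le_rpow_of_exponent_le h h₂]

lemma rpow_le_one_add_sq {v q : ℝ} (hv : 0 < v) (h₁ : 0 ≤ q) (h₂ : q ≤ 2) :
    v ^ q ≤ 1 + v ^ 2 := by
  have := rpow_le_rpow_add_rpow hv h₁ h₂
  rwa [Real.rpow_zero, Real.rpow_two] at this

/-- The product is at most the `k`-th power of the larger of the two numbers: a Young inequality
with constant `1`. -/
lemma mul_rpow_sub_one_le {x y k : ℝ} (hx : 0 < x) (hy : 0 < y) (hk : 1 ≤ k) :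
    x * y ^ (k - 1) ≤ x ^ k + y ^ k := by
  have px := Real.rpow_pos_of_pos hx k
  have py := Real.rpow_pos_of_pos hy k
  have split : ∀ {z : ℝ}, 0 < z → z ^ k = z * z ^ (k - 1) := fun {z} hz => by
    rw [← Real.rpow_one_add' hz.le (by linarith)]
    ring_nf
  rcases le_total x y with h | h
  · have : x * y ^ (k - 1) ≤ y ^ k := by
      rw [split hy]
      gcongr
    linarith
  · have : x * y ^ (k - 1) ≤ x ^ k := by
      rw [split hx]
      gcongr
    linarith

/-- Bernoulli's inequality at `s / (s + t) = 1 - t / (s + t)` gives `(s + t)^q - s^q ≤ q t (s +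
t)^(q - 1)`, and `s + t ≤ 2 s` because `s` is the larger size. -/
lemma add_rpow_le_of_le {q s t : ℝ} (hq : 1 ≤ q) (hs : 0 < s) (ht : 0 < t) (hts : t ≤ s) :
    (s + t) ^ q ≤ s ^ q + q * 2 ^ (q - 1) * (s ^ (q - 1) * t) := by
  have hst : 0 < s + t := by positivity
  have h1 : 1 + q * (-(t / (s + t))) ≤ (1 + -(t / (s + t))) ^ q :=
    one_add_mul_self_le_rpow_one_add (by
      have : t / (s + t) ≤ 1 := by rw [div_le_one hst]; linarith
      linarith) hq
  have h2 : 1 + -(t / (s + t)) = s / (s + t) := by field_simp; ring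
  rw [h2, Real.div_rpow hs.le hst.le, le_div_iff₀ (Real.rpow_pos_of_pos hst q)] at h1
  have h3 : (s + t) ^ q = (s + t) * (s + t) ^ (q - 1) := by
    rw [← Real.rpow_one_add' hst.le (by linarith)]
    ring_nf
  have h4 : (1 + q * -(t / (s + t))) * (s + t) ^ q
      = (s + t) ^ q - q * t * (s + t) ^ (q - 1) := by
    rw [add_mul, one_mul]
    nth_rewrite 2 [h3]
    field_simp
    ring
  have h5 : (s + t) ^ (q - 1) ≤ 2 ^ (q - 1) * s ^ (q - 1) := by
    rw [← Real.mul_rpow (by norm_num) hs.le]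
    exact Real.rpow_le_rpow hst.le (by linarith) (by linarith)
  have h6 : q * t * (s + t) ^ (q - 1) ≤ q * t * (2 ^ (q - 1) * s ^ (q - 1)) := by gcongr
  linarith

/-- The gain of the moment of order `q` when two particles of sizes `s` and `t` merge. -/
lemma exists_add_rpow_le (q : ℝ) : ∃ C, 0 ≤ C ∧ (q < 1 → C = 0) ∧ ∀ s t : ℝ, 0 < s → 0 < t →
    (s + t) ^ q ≤ s ^ q + t ^ q + C * (s ^ (q - 1) * t + s * t ^ (q - 1)) := by
  rcases lt_or_ge q 1 with h | h
  -- Below exponent `1` there is no gain: the power is decreasing for `q ≤ 0` and subadditive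
  -- otherwise. Recording `C = 0` matters, since products with the kernel are only estimated for `q
  -- ≥ 1`, while the exponent `p` of the weight is arbitrary.
  · refine ⟨0, le_rfl, fun _ => rfl, fun s t hs ht => ?_⟩
    rw [zero_mul, add_zero]
    rcases le_total q 0 with h0 | h0
    · have := Real.rpow_le_rpow_of_nonpos hs (by linarith : s ≤ s + t) h0
      linarith [Real.rpow_pos_of_pos ht q]
    · exact Real.rpow_add_le_add_rpow hs.le ht.le h0 h.le
  · refine ⟨q * 2 ^ (q - 1), by positivity, fun h' => absurd h' (not_lt.2 h), fun s t hs ht => ?_⟩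
    have a1 := Real.rpow_pos_of_pos hs q
    have a2 := Real.rpow_pos_of_pos ht q
    have a3 : 0 ≤ q * 2 ^ (q - 1) * (s ^ (q - 1) * t) := by positivity
    have a4 : 0 ≤ q * 2 ^ (q - 1) * (s * t ^ (q - 1)) := by positivity
    rcases le_total t s with hts | hts
    · have := add_rpow_le_of_le h hs ht hts
      linarith
    · have := add_rpow_le_of_le h ht hs hts
      rw [add_comm t s, mul_comm _ s] at this
      linarith

/-- The product of the kernel bound with the gain of a volume moment. -/
lemma kernel_mul_volume_gain_le {α β k q v w : ℝ} (hα : 0 < α) (hα1 : α < 1) (hβ : 0 < β)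
    (hβ1 : β < 1) (hk : 1 ≤ k) (hq : 1 ≤ q) (hv : 0 < v) (hw : 0 < w) :
    (v ^ (-α) * w ^ β + w ^ (-α) * v ^ β) * (v ^ (q - 1) * w)
      ≤ 2 * ((v ^ (-k) + v ^ q) * (1 + w ^ 2)) := by
  have e1 : v ^ (-α) * v ^ (q - 1) = v ^ (q - 1 - α) := by
    rw [← Real.rpow_add hv]; ring_nf
  have e2 : v ^ β * v ^ (q - 1) = v ^ (q - 1 + β) := by
    rw [← Real.rpow_add hv]; ring_nf
  have e3 : w ^ β * w = w ^ (1 + β) := by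
    rw [Real.rpow_one_add' hw.le (by linarith)]; ring
  have e4 : w ^ (-α) * w = w ^ (1 - α) := by
    rw [sub_eq_add_neg, Real.rpow_one_add' hw.le (by linarith)]; ring
  have b1 : v ^ (q - 1 - α) ≤ v ^ (-k) + v ^ q :=
    rpow_le_rpow_add_rpow hv (by linarith) (by linarith)
  have b2 : v ^ (q - 1 + β) ≤ v ^ (-k) + v ^ q :=
    rpow_le_rpow_add_rpow hv (by linarith) (by linarith)
  have b3 : w ^ (1 + β) ≤ 1 + w ^ 2 := rpow_le_one_add_sq hw (by linarith) (by linarith)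
  have b4 : w ^ (1 - α) ≤ 1 + w ^ 2 := rpow_le_one_add_sq hw (by linarith) (by linarith)
  calc (v ^ (-α) * w ^ β + w ^ (-α) * v ^ β) * (v ^ (q - 1) * w)
      = (v ^ (-α) * v ^ (q - 1)) * (w ^ β * w) + (v ^ β * v ^ (q - 1)) * (w ^ (-α) * w) := by ring
    _ = v ^ (q - 1 - α) * w ^ (1 + β) + v ^ (q - 1 + β) * w ^ (1 - α) := by rw [e1, e2, e3, e4]
    _ ≤ (v ^ (-k) + v ^ q) * (1 + w ^ 2) + (v ^ (-k) + v ^ q) * (1 + w ^ 2) := by gcongr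
    _ = _ := by ring

/-- The product of the kernel bound with the gain of an area moment. -/
lemma kernel_mul_area_gain_le {α β k a b v w : ℝ} (hα : 0 < α) (hα1 : α < 1) (hβ : 0 < β)
    (hβ1 : β < 1) (hk : 1 ≤ k) (ha : 0 < a) (hb : 0 < b) (hv : 0 < v) (hw : 0 < w) :
    (v ^ (-α) * w ^ β + w ^ (-α) * v ^ β) * (a ^ (k - 1) * b)
      ≤ (1 + v ^ (-k) + v ^ k + a ^ k) * (b * w ^ (-α) + b * w ^ β) := by
  have pv := Real.rpow_pos_of_pos hv
  have pw := Real.rpow_pos_of_pos hw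
  have b1 : v ^ (-α) * a ^ (k - 1) ≤ 1 + v ^ (-k) + v ^ k + a ^ k := by
    have h1 := mul_rpow_sub_one_le (pv (-α)) ha hk
    rw [← Real.rpow_mul hv.le] at h1
    have h2 : v ^ (-α * k) ≤ v ^ (-k) + v ^ (0 : ℝ) :=
      rpow_le_rpow_add_rpow hv (by nlinarith) (by nlinarith)
    rw [Real.rpow_zero] at h2
    linarith [pv k]
  have b2 : v ^ β * a ^ (k - 1) ≤ 1 + v ^ (-k) + v ^ k + a ^ k := by
    have h1 := mul_rpow_sub_one_le (pv β) ha hk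
    rw [← Real.rpow_mul hv.le] at h1
    have h2 : v ^ (β * k) ≤ v ^ (0 : ℝ) + v ^ k :=
      rpow_le_rpow_add_rpow hv (by nlinarith) (by nlinarith)
    rw [Real.rpow_zero] at h2
    linarith [pv (-k)]
  have q1 := pw β
  have q2 := pw (-α)
  calc (v ^ (-α) * w ^ β + w ^ (-α) * v ^ β) * (a ^ (k - 1) * b)
      = (v ^ (-α) * a ^ (k - 1)) * (b * w ^ β) + (v ^ β * a ^ (k - 1)) * (b * w ^ (-α)) := by ring
    _ ≤ (1 + v ^ (-k) + v ^ k + a ^ k) * (b * w ^ β)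
        + (1 + v ^ (-k) + v ^ k + a ^ k) * (b * w ^ (-α)) := by gcongr
    _ = _ := by ring

/-- The product of the kernel bound with the gain of the square of the volume. -/
lemma kernel_mul_square_gain_le {α β v w : ℝ} (hα : 0 < α) (hα1 : α < 1) (hβ : 0 < β)
    (hβ1 : β < 1) (hv : 0 < v) (hw : 0 < w) :
    (v ^ (-α) * w ^ β + w ^ (-α) * v ^ β) * (2 * v * w)
      ≤ (1 + v ^ 2) * (2 * (1 + w)) + (2 * (1 + v)) * (1 + w ^ 2) := by
  have le1 : ∀ {z : ℝ}, 0 < z → z ^ (1 - α) ≤ 1 + z := fun {z} hz => by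
    have := rpow_le_rpow_add_rpow hz (q₁ := 0) (q := 1 - α) (q₂ := 1) (by linarith) (by linarith)
    rwa [Real.rpow_zero, Real.rpow_one] at this
  have le2 : ∀ {z : ℝ}, 0 < z → z ^ (1 + β) ≤ 1 + z ^ 2 := fun {z} hz =>
    rpow_le_one_add_sq hz (by linarith) (by linarith)
  have e3 : ∀ {z : ℝ}, 0 < z → z ^ β * z = z ^ (1 + β) := fun {z} hz => by
    rw [Real.rpow_one_add' hz.le (by linarith)]; ring
  have e4 : ∀ {z : ℝ}, 0 < z → z ^ (-α) * z = z ^ (1 - α) := fun {z} hz => by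
    rw [sub_eq_add_neg, Real.rpow_one_add' hz.le (by linarith)]; ring
  calc (v ^ (-α) * w ^ β + w ^ (-α) * v ^ β) * (2 * v * w)
      = 2 * ((v ^ (-α) * v) * (w ^ β * w)) + 2 * ((v ^ β * v) * (w ^ (-α) * w)) := by ring
    _ = 2 * (v ^ (1 - α) * w ^ (1 + β)) + 2 * (v ^ (1 + β) * w ^ (1 - α)) := by
        rw [e4 hv, e4 hw, e3 hv, e3 hw]
    _ ≤ 2 * ((1 + v) * (1 + w ^ 2)) + 2 * ((1 + v ^ 2) * (1 + w)) := by
        gcongr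
        exacts [le1 hv, le2 hw, le2 hv, le1 hw]
    _ = _ := by ring

/-- The product of the kernel bound with the gain of the mixed moments `a v^{-α} + a v^β`. -/
lemma kernel_mul_mixed_gain_le {α β a b v w : ℝ} (hαβ : 0 ≤ β - α) (hα : 0 < α) (hβ1 : β < 1)
    (ha : 0 < a) (hb : 0 < b) (hv : 0 < v) (hw : 0 < w) :
    (v ^ (-α) * w ^ β + w ^ (-α) * v ^ β) * (a * w ^ β + b * v ^ β)
      ≤ (a * v ^ (-α) + a * v ^ β) * (2 * (1 + w ^ 2))
        + (2 * (1 + v ^ 2)) * (b * w ^ (-α) + b * w ^ β) := by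
  have e1 : ∀ {z : ℝ}, 0 < z → z ^ β * z ^ β ≤ 1 + z ^ 2 := fun {z} hz => by
    rw [← Real.rpow_add hz]
    exact rpow_le_one_add_sq hz (by linarith) (by linarith)
  have e2 : ∀ {z : ℝ}, 0 < z → z ^ (-α) * z ^ β ≤ 1 + z ^ 2 := fun {z} hz => by
    rw [← Real.rpow_add hz]
    exact rpow_le_one_add_sq hz (by linarith) (by linarith)
  have pv := Real.rpow_pos_of_pos hv
  have pw := Real.rpow_pos_of_pos hw
  have q1 := pv (-α)
  have q2 := pv β
  have q3 := pw (-α)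
  have q4 := pw β
  calc (v ^ (-α) * w ^ β + w ^ (-α) * v ^ β) * (a * w ^ β + b * v ^ β)
      = (a * v ^ (-α)) * (w ^ β * w ^ β) + (a * v ^ β) * (w ^ (-α) * w ^ β)
        + ((v ^ (-α) * v ^ β) * (b * w ^ β) + (v ^ β * v ^ β) * (b * w ^ (-α))) := by ring
    _ ≤ (a * v ^ (-α)) * (1 + w ^ 2) + (a * v ^ β) * (1 + w ^ 2)
        + ((1 + v ^ 2) * (b * w ^ β) + (1 + v ^ 2) * (b * w ^ (-α))) := by
        gcongr
        exacts [e1 hw, e2 hw, e2 hv, e1 hv]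
    _ ≤ _ := by
        have : 0 ≤ (a * v ^ (-α) + a * v ^ β) * (1 + w ^ 2)
          + (1 + v ^ 2) * (b * w ^ (-α) + b * w ^ β) := by positivity
        linarith

/-- Subadditivity, up to a gain, of the mixed moments `a v^{-α} + a v^β`. -/
lemma mixed_moment_add_le {α β a b v w : ℝ} (hα : 0 < α) (hβ : 0 < β) (hβ1 : β < 1)
    (ha : 0 < a) (hb : 0 < b) (hv : 0 < v) (hw : 0 < w) :
    (a + b) * (v + w) ^ (-α) + (a + b) * (v + w) ^ β
      ≤ (a * v ^ (-α) + a * v ^ β) + (b * w ^ (-α) + b * w ^ β) + (a * w ^ β + b * v ^ β) := by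
  have h1 : (v + w) ^ (-α) ≤ v ^ (-α) :=
    Real.rpow_le_rpow_of_nonpos hv (by linarith) (by linarith)
  have h2 : (v + w) ^ (-α) ≤ w ^ (-α) :=
    Real.rpow_le_rpow_of_nonpos hw (by linarith) (by linarith)
  have h3 : (v + w) ^ β ≤ v ^ β + w ^ β := Real.rpow_add_le_add_rpow hv.le hw.le hβ.le hβ1.le
  calc (a + b) * (v + w) ^ (-α) + (a + b) * (v + w) ^ β
      = a * (v + w) ^ (-α) + b * (v + w) ^ (-α) + (a + b) * (v + w) ^ β := by ring
    _ ≤ a * v ^ (-α) + b * w ^ (-α) + (a + b) * (v ^ β + w ^ β) := by gcongr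
    _ = _ := by ring

end Powers

/-! ### The region `{a ≥ c₀ v^{2/3}}` as a state space -/

section Region

lemma c₀_pos : 0 < c₀ := Real.rpow_pos_of_pos (by positivity) _

lemma continuous_sphereArea : Continuous sphereArea :=
  continuous_const.mul (Real.continuous_rpow_const (by norm_num))

lemma sphereArea_pos {v : ℝ} (hv : 0 < v) : 0 < sphereArea v :=
  mul_pos c₀_pos (Real.rpow_pos_of_pos hv _)

lemma sphereArea_mono {v w : ℝ} (hv : 0 ≤ v) (hvw : v ≤ w) : sphereArea v ≤ sphereArea w :=
  mul_le_mul_of_nonneg_left (Real.rpow_le_rpow hv hvw (by norm_num)) c₀_pos.le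

lemma sphereArea_add_le {v w : ℝ} (hv : 0 ≤ v) (hw : 0 ≤ w) :
    sphereArea (v + w) ≤ sphereArea v + sphereArea w := by
  unfold sphereArea
  rw [← mul_add]
  exact mul_le_mul_of_nonneg_left
    (Real.rpow_add_le_add_rpow hv hw (by norm_num) (by norm_num)) c₀_pos.le

/-- The pairs `(a, v)` of a positive volume and an area compatible with the isoperimetric
inequality. -/
def IsoRegion : Set (ℝ × ℝ) := {η | 0 < η.2 ∧ sphereArea η.2 ≤ η.1}

/-- The area of a particle. -/
abbrev area (x : IsoRegion) : ℝ := (x : ℝ × ℝ).1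

/-- The volume of a particle. -/
abbrev vol (x : IsoRegion) : ℝ := (x : ℝ × ℝ).2

lemma vol_pos (x : IsoRegion) : 0 < vol x := x.2.1

lemma sphereArea_vol_le (x : IsoRegion) : sphereArea (vol x) ≤ area x := x.2.2

lemma area_pos (x : IsoRegion) : 0 < area x :=
  (sphereArea_pos (vol_pos x)).trans_le (sphereArea_vol_le x)

lemma coe_mem_quadrant (x : IsoRegion) : (x : ℝ × ℝ) ∈ Quadrant := ⟨area_pos x, vol_pos x⟩

/-- Merging adds areas and volumes, and `v^(2/3)` is subadditive, so the isoperimetric inequality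
survives coagulation. -/
instance : Add IsoRegion := ⟨fun x y => ⟨x.1 + y.1, add_pos x.2.1 y.2.1,
  (sphereArea_add_le x.2.1.le y.2.1.le).trans (add_le_add x.2.2 y.2.2)⟩⟩

lemma area_add (x y : IsoRegion) : area (x + y) = area x + area y := rfl

lemma vol_add (x y : IsoRegion) : vol (x + y) = vol x + vol y := rfl

instance : ContinuousAdd IsoRegion :=
  ⟨((continuous_subtype_val.comp continuous_fst).add
    (continuous_subtype_val.comp continuous_snd)).subtype_mk _⟩

lemma continuous_area : Continuous area := continuous_fst.comp continuous_subtype_val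

lemma continuous_vol : Continuous vol := continuous_snd.comp continuous_subtype_val

lemma continuous_vol_rpow (q : ℝ) : Continuous fun x => vol x ^ q :=
  continuous_vol.rpow_const fun x => Or.inl (vol_pos x).ne'

lemma continuous_area_rpow (q : ℝ) : Continuous fun x => area x ^ q :=
  continuous_area.rpow_const fun x => Or.inl (area_pos x).ne'

lemma isLocallyClosed_isoRegion : IsLocallyClosed IsoRegion :=
  ⟨{η | 0 < η.2}, {η | sphereArea η.2 ≤ η.1}, isOpen_lt continuous_const continuous_snd,
    isClosed_le (continuous_sphereArea.comp continuous_snd) continuous_fst, rfl⟩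

instance : LocallyCompactSpace IsoRegion := isLocallyClosed_isoRegion.locallyCompactSpace

/-- The weight that controls all moments of the solutions. -/
def momentWeight (k p : ℝ) (x : IsoRegion) : ℝ :=
  1 + vol x ^ (-k) + vol x ^ k + vol x ^ p + area x ^ k

lemma continuous_momentWeight (k p : ℝ) : Continuous (momentWeight k p) :=
  (((continuous_const.add (continuous_vol_rpow _)).add (continuous_vol_rpow _)).add
    (continuous_vol_rpow _)).add (continuous_area_rpow _)

lemma one_le_momentWeight (k p : ℝ) (x : IsoRegion) : 1 ≤ momentWeight k p x := by
  have hv := fun q : ℝ => Real.rpow_pos_of_pos (vol_pos x) q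
  have ha := Real.rpow_pos_of_pos (area_pos x) k
  unfold momentWeight
  linarith [hv k, hv (-k), hv p]

lemma rpow_vol_le_momentWeight {k p q : ℝ} (hq : -k ≤ q) (hq' : q ≤ k) (x : IsoRegion) :
    vol x ^ q ≤ momentWeight k p x := by
  have h := rpow_le_rpow_add_rpow (vol_pos x) hq hq'
  have h1 := Real.rpow_pos_of_pos (vol_pos x) p
  have h2 := Real.rpow_pos_of_pos (area_pos x) k
  unfold momentWeight
  linarith

lemma rpow_area_le_momentWeight {k p q : ℝ} (hq : 0 ≤ q) (hq' : q ≤ k) (x : IsoRegion) :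
    area x ^ q ≤ momentWeight k p x := by
  have h := rpow_le_rpow_add_rpow (area_pos x) hq hq'
  rw [Real.rpow_zero] at h
  have h1 := Real.rpow_pos_of_pos (vol_pos x)
  unfold momentWeight
  linarith [h1 p, h1 k, h1 (-k)]

lemma rpow_vol_le_sqrt_momentWeight {k p q : ℝ} (hq : -k ≤ 2 * q) (hq' : 2 * q ≤ k)
    (x : IsoRegion) : vol x ^ q ≤ √(momentWeight k p x) := by
  apply Real.le_sqrt_of_sq_le
  rw [← Real.rpow_natCast, ← Real.rpow_mul (vol_pos x).le]
  refine rpow_vol_le_momentWeight ?_ ?_ x <;> push_cast <;> linarith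

/-- The sets `{δ ≤ v ≤ M, a ≤ M}` are compact. -/
lemma isCompact_region_box {δ M : ℝ} (hδ : 0 < δ) :
    IsCompact {x : IsoRegion | δ ≤ vol x ∧ vol x ≤ M ∧ area x ≤ M} := by
  have hc : IsCompact ((Icc ((0 : ℝ), δ) (M, M)) ∩ {η | sphereArea η.2 ≤ η.1}) :=
    isCompact_Icc.inter_right
      (isClosed_le (continuous_sphereArea.comp continuous_snd) continuous_fst)
  rw [Subtype.isCompact_iff]
  convert hc using 1
  ext η
  simp only [mem_image, mem_ofPred_eq, Subtype.exists, exists_and_right, exists_eq_right,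
    mem_inter_iff, mem_Icc, Prod.le_def]
  constructor
  · rintro ⟨hη, h1, h2, h3⟩
    exact ⟨⟨⟨(area_pos ⟨η, hη⟩).le, h1⟩, h3, h2⟩, hη.2⟩
  · rintro ⟨⟨⟨h1, h2⟩, h3, h4⟩, h5⟩
    exact ⟨⟨hδ.trans_le h2, h5⟩, h2, h4, h3⟩

/-- The negative power keeps the volume away from `0`, the positive ones bound volume and area; `k ≥
1` allows comparison with the exponents `±1`. -/
lemma mem_box_of_momentWeight_le {k p R : ℝ} (hk : 1 ≤ k) {x : IsoRegion}
    (hx : momentWeight k p x ≤ R) :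
    (max 1 R)⁻¹ ≤ vol x ∧ vol x ≤ max 1 R ∧ area x ≤ max 1 R := by
  have hR : momentWeight k p x ≤ max 1 R := hx.trans (le_max_right _ _)
  have h1 : vol x ^ (-1 : ℝ) ≤ max 1 R :=
    (rpow_vol_le_momentWeight (by linarith) (by linarith) x).trans hR
  have h2 : vol x ^ (1 : ℝ) ≤ max 1 R := (rpow_vol_le_momentWeight (by linarith) hk x).trans hR
  have h3 : area x ^ (1 : ℝ) ≤ max 1 R := (rpow_area_le_momentWeight (by linarith) hk x).trans hR
  rw [Real.rpow_one] at h2 h3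
  rw [Real.rpow_neg_one] at h1
  exact ⟨inv_le_of_inv_le₀ (vol_pos x) h1, h2, h3⟩

lemma isProperWeight_momentWeight {k p : ℝ} (hk : 1 ≤ k) : IsProperWeight (momentWeight k p) := by
  refine ⟨continuous_momentWeight k p, one_le_momentWeight k p, fun R => ?_⟩
  exact (isCompact_region_box (δ := (max 1 R)⁻¹) (M := max 1 R)
    (inv_pos.2 (lt_max_of_lt_left one_pos))).of_isClosed_subset
    (isClosed_le (continuous_momentWeight k p) continuous_const) fun x hx =>
      mem_box_of_momentWeight_le hk hx

end Region

/-! ### Moment bounds for the discretization -/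

section Moments

lemma lintegral_ofReal_le_mul {X : Type*} [MeasurableSpace X] {m : Measure X} {f g : X → ℝ}
    {c B : ℝ} (hc : 0 ≤ c) (hfg : ∀ x, f x ≤ c * g x) (hg : ∫⁻ x, ENNReal.ofReal (g x) ∂m
      ≤ ENNReal.ofReal B) : ∫⁻ x, ENNReal.ofReal (f x) ∂m ≤ ENNReal.ofReal (c * B) := by
  calc ∫⁻ x, ENNReal.ofReal (f x) ∂m ≤ ∫⁻ x, ENNReal.ofReal c * ENNReal.ofReal (g x) ∂m :=
        lintegral_mono fun x => by
          rw [← ENNReal.ofReal_mul hc]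
          exact ENNReal.ofReal_le_ofReal (hfg x)
    _ = ENNReal.ofReal c * ∫⁻ x, ENNReal.ofReal (g x) ∂m :=
        lintegral_const_mul' _ _ ENNReal.ofReal_ne_top
    _ ≤ ENNReal.ofReal c * ENNReal.ofReal B := by gcongr
    _ = _ := (ENNReal.ofReal_mul hc).symm

/-- Gronwall on `[0, T]` in real-valued form. The bound sees neither the step, nor the truncation,
nor the transport map, but only the bound `B` on the auxiliary moment. -/
lemma IsScheme.moment_le {X : Type*} [MeasurableSpace X] [Add X] [MeasurableAdd₂ X]
    {κ : X → X → ℝ} {S : X → X} {h N : ℝ} {m : Measure X} (hs : IsScheme κ S h N m)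
    {ψ ℓ : X → ℝ} (hψ : Measurable ψ) (hℓ : Measurable ℓ) (hψ0 : ∀ x, 0 ≤ ψ x)
    (hℓ0 : ∀ x, 0 ≤ ℓ x) (hS : ∀ x, ψ (S x) ≤ ψ x) {D : X → X → ℝ} (hD0 : ∀ x y, 0 ≤ D x y)
    (hψD : ∀ x y, ψ (x + y) ≤ ψ x + ψ y + D x y)
    (hκD : ∀ x y, κ x y * D x y ≤ ψ x * ℓ y + ℓ x * ψ y) {A B T : ℝ} (hB0 : 0 ≤ B)
    (hB : ∀ j : ℕ, h * j ≤ T →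
      ∫⁻ x, ENNReal.ofReal (ℓ x) ∂(schemeIter κ S h m j) ≤ ENNReal.ofReal B)
    (hA : ∫⁻ x, ENNReal.ofReal (ψ x) ∂m ≤ ENNReal.ofReal A) (j : ℕ) (hj : h * j ≤ T) :
    ∫⁻ x, ENNReal.ofReal (ψ x) ∂(schemeIter κ S h m j)
      ≤ ENNReal.ofReal (Real.exp (B * T) * A) := by
  have key := hs.lintegral_le_pow (ψ := fun x => ENNReal.ofReal (ψ x))
    (ℓ := fun x => ENNReal.ofReal (ℓ x)) (D := fun x y => ENNReal.ofReal (D x y))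
    (B := ENNReal.ofReal B) (J := j) (ENNReal.measurable_ofReal.comp hψ)
    (ENNReal.measurable_ofReal.comp hℓ) (fun x => ENNReal.ofReal_le_ofReal (hS x))
    (fun x y => by
      rw [← ENNReal.ofReal_add (hψ0 x) (hψ0 y),
        ← ENNReal.ofReal_add (add_nonneg (hψ0 x) (hψ0 y)) (hD0 x y)]
      exact ENNReal.ofReal_le_ofReal (hψD x y))
    (fun x y => by
      rw [← ENNReal.ofReal_mul (hs.kernel.nonneg x y), ← ENNReal.ofReal_mul (hψ0 x),
        ← ENNReal.ofReal_mul (hℓ0 x), ← ENNReal.ofReal_add (mul_nonneg (hψ0 x) (hℓ0 y))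
          (mul_nonneg (hℓ0 x) (hψ0 y))]
      exact ENNReal.ofReal_le_ofReal (hκD x y))
    (fun i hi => hB i (le_trans (mul_le_mul_of_nonneg_left (by exact_mod_cast hi.le)
      hs.step_pos.le) hj)) j le_rfl
  refine key.trans ?_
  rw [ENNReal.ofReal_mul (Real.exp_nonneg _)]
  gcongr
  exact one_add_mul_pow_le_exp hs.step_pos.le hB0 hj

/-- The power law that bounds the coagulation kernel. -/
def kernelPower (α β : ℝ) (x y : IsoRegion) : ℝ :=
  vol x ^ (-α) * vol y ^ β + vol y ^ (-α) * vol x ^ β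

/-- A map that decreases the area and preserves the volume. -/
structure IsAreaDecreasing (S : IsoRegion → IsoRegion) : Prop where
  vol_eq : ∀ x, vol (S x) = vol x
  area_le : ∀ x, area (S x) ≤ area x

/-- The range of the exponents of the kernel and of the moments. -/
structure ExponentRange (α β k : ℝ) : Prop where
  alpha_pos : 0 < α
  alpha_lt : α < 1
  beta_pos : 0 < β
  beta_lt : β < 1
  le : α ≤ β
  two_le : 2 ≤ k

variable {α β k : ℝ}

/-- Both factors are at most `√W`: the area because `k ≥ 2`, the power of the volume because its
exponent has modulus below `1 ≤ k / 2`. -/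
lemma mixed_moment_le (he : ExponentRange α β k) (p : ℝ) (x : IsoRegion) :
    area x * vol x ^ (-α) + area x * vol x ^ β ≤ 4 * momentWeight k p x := by
  have h2 := he.two_le
  have hsq : ∀ q : ℝ, -k ≤ 2 * q → 2 * q ≤ k →
      area x * vol x ^ q ≤ 2 * momentWeight k p x := by
    intro q hq hq'
    have h1 := rpow_vol_le_sqrt_momentWeight (p := p) hq hq' x
    have h3 : area x ≤ √(momentWeight k p x) := Real.le_sqrt_of_sq_le (by
      have := rpow_area_le_momentWeight (p := p) (by norm_num : (0 : ℝ) ≤ 2) h2 x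
      rwa [Real.rpow_two] at this)
    have h0 := one_le_momentWeight k p x
    calc area x * vol x ^ q ≤ √(momentWeight k p x) * √(momentWeight k p x) :=
          mul_le_mul h3 h1 (Real.rpow_pos_of_pos (vol_pos x) q).le (Real.sqrt_nonneg _)
      _ = momentWeight k p x := Real.mul_self_sqrt (by linarith)
      _ ≤ _ := by linarith
  have a1 := hsq (-α) (by linarith [he.alpha_lt]) (by linarith [he.alpha_pos])
  have a2 := hsq β (by linarith [he.beta_pos]) (by linarith [he.beta_lt])
  linarith

/-- Places the kernel in the growth class of `tendsto_integral_integral_of_vagueTendsto`, so that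
the coagulation term passes to vague limits. -/
lemma kernelPower_le_sqrt (he : ExponentRange α β k) (p : ℝ) (x y : IsoRegion) :
    kernelPower α β x y ≤ 2 * √(momentWeight k p x) * √(momentWeight k p y) := by
  have h2 := he.two_le
  have a1 : ∀ z : IsoRegion, vol z ^ (-α) ≤ √(momentWeight k p z) := fun z =>
    rpow_vol_le_sqrt_momentWeight (by linarith [he.alpha_lt]) (by linarith [he.alpha_pos]) z
  have a2 : ∀ z : IsoRegion, vol z ^ β ≤ √(momentWeight k p z) := fun z =>
    rpow_vol_le_sqrt_momentWeight (by linarith [he.beta_pos]) (by linarith [he.beta_lt]) z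
  have pos := fun (z : IsoRegion) (q : ℝ) => (Real.rpow_pos_of_pos (vol_pos z) q).le
  have b1 := mul_le_mul (a1 x) (a2 y) (pos y _) (Real.sqrt_nonneg _)
  have b2 := mul_le_mul (a2 x) (a1 y) (pos y _) (Real.sqrt_nonneg _)
  unfold kernelPower
  linarith

/-- Bounds the rate at which coagulation creates excess area, since the excess of a merged particle
is at most its area `area x + area y`. -/
lemma kernelPower_mul_area_le (he : ExponentRange α β k) (p : ℝ) (x y : IsoRegion) :
    kernelPower α β x y * (area x + area y) ≤ 8 * momentWeight k p x * momentWeight k p y := by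
  have h2 := he.two_le
  have pos := fun (z : IsoRegion) (q : ℝ) => (Real.rpow_pos_of_pos (vol_pos z) q).le
  have w1 := fun z => one_le_momentWeight k p z
  have v1 : ∀ z : IsoRegion, vol z ^ (-α) ≤ momentWeight k p z := fun z =>
    rpow_vol_le_momentWeight (by linarith [he.alpha_lt]) (by linarith [he.alpha_pos]) z
  have v2 : ∀ z : IsoRegion, vol z ^ β ≤ momentWeight k p z := fun z =>
    rpow_vol_le_momentWeight (by linarith [he.beta_pos]) (by linarith [he.beta_lt]) z
  have mix : ∀ z u : IsoRegion, kernelPower α β z u * area z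
      ≤ 4 * momentWeight k p z * momentWeight k p u := by
    intro z u
    have b1 := mul_le_mul_of_nonneg_left (v2 u) (mul_nonneg (area_pos z).le (pos z (-α)))
    have b2 := mul_le_mul_of_nonneg_left (v1 u) (mul_nonneg (area_pos z).le (pos z β))
    have b3 := mul_le_mul_of_nonneg_right (mixed_moment_le he p z)
      (by linarith [w1 u] : 0 ≤ momentWeight k p u)
    have : kernelPower α β z u * area z
        = area z * vol z ^ (-α) * vol u ^ β + area z * vol z ^ β * vol u ^ (-α) := by
      unfold kernelPower
      ring
    linarith
  have c1 := mix x y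
  have c2 := mix y x
  have hsymm : kernelPower α β y x = kernelPower α β x y := by
    unfold kernelPower
    ring
  rw [hsymm] at c2
  linarith

/-- The moment bound for the discretization, which is uniform in the discretization and in the
transport map. -/
theorem exists_moment_bound (he : ExponentRange α β k) (p : ℝ) {K₀ : ℝ} (hK₀ : 0 ≤ K₀) {M₀ : ℝ}
    (hM₀ : 0 ≤ M₀) {T : ℝ} : ∃ C, 0 ≤ C ∧
    ∀ (κ : IsoRegion → IsoRegion → ℝ) (S : IsoRegion → IsoRegion) (h N : ℝ)
      (m : Measure IsoRegion), IsScheme κ S h N m → (∀ x y, κ x y ≤ K₀ * kernelPower α β x y) →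
      IsAreaDecreasing S →
      ∫⁻ x, ENNReal.ofReal (momentWeight k p x) ∂m ≤ ENNReal.ofReal M₀ →
      ∀ j : ℕ, h * j ≤ T →
        ∫⁻ x, ENNReal.ofReal (momentWeight k p x) ∂(schemeIter κ S h m j)
          ≤ ENNReal.ofReal C := by
  have hk2 := he.two_le
  obtain ⟨Ck, hCk0, -, hCk⟩ := exists_add_rpow_le k
  obtain ⟨Cp, hCp0, hCp1, hCp⟩ := exists_add_rpow_le p
  -- Each bound feeds the Gronwall coefficient of a later one: `A₁` for `1 + v`, which has no gain,
  -- `A₂` for `1 + v²`, `A₃` for `a v^(-α) + a v^β`, then `B₄` for the weight. The factors `2`, `2`,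
  -- `4` compare these moments with the weight at time zero.
  set A₁ := 2 * M₀
  set B₂ := 2 * K₀ * A₁
  set A₂ := Real.exp (B₂ * T) * (2 * M₀)
  set B₃ := 2 * K₀ * A₂
  set A₃ := Real.exp (B₃ * T) * (4 * M₀)
  set c₄ := K₀ * (2 * Ck + 2 * Cp + Ck)
  set B₄ := c₄ * A₂ + c₄ * A₃
  have hA₁ : 0 ≤ A₁ := by positivity
  have hA₂ : 0 ≤ A₂ := by positivity
  have hA₃ : 0 ≤ A₃ := by positivity
  have hc₄ : 0 ≤ c₄ := by positivity
  refine ⟨Real.exp (B₄ * T) * M₀, by positivity, fun κ S h N m hs hκ hS hm => ?_⟩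
  have pv := fun (x : IsoRegion) (q : ℝ) => Real.rpow_pos_of_pos (vol_pos x) q
  have hκ0 := hs.kernel.nonneg
  have w1 := fun z => one_le_momentWeight k p z
  have hκD : ∀ {x y : IsoRegion} {d e : ℝ}, 0 ≤ d → kernelPower α β x y * d ≤ e →
      κ x y * d ≤ K₀ * e := fun {x y d e} hd hde =>
    calc κ x y * d ≤ K₀ * kernelPower α β x y * d := mul_le_mul_of_nonneg_right (hκ x y) hd
      _ = K₀ * (kernelPower α β x y * d) := by ring
      _ ≤ _ := mul_le_mul_of_nonneg_left hde hK₀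
  have hvolS : ∀ (x : IsoRegion), vol (S x) = vol x := hS.vol_eq
  have cv := continuous_vol
  have cvr := continuous_vol_rpow
  -- the moment `1 + v`
  have s₁ : ∀ j : ℕ, h * j ≤ T → ∫⁻ x, ENNReal.ofReal (1 + vol x) ∂(schemeIter κ S h m j)
      ≤ ENNReal.ofReal A₁ := by
    intro j hj
    have := hs.moment_le (ψ := fun x => 1 + vol x) (ℓ := fun _ => 0) (D := fun _ _ => 0) (B := 0)
      (A := A₁) (T := T) (continuous_const.add cv).measurable measurable_const
      (fun x => by linarith [vol_pos x]) (fun _ => le_rfl) (fun x => by rw [hvolS])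
      (fun _ _ => le_rfl) (fun x y => by rw [vol_add]; linarith) (fun x y => by simp) le_rfl
      (fun j _ => by simp)
      (lintegral_ofReal_le_mul (by norm_num) (fun x => by
        have := rpow_vol_le_momentWeight (p := p) (k := k) (q := 1) (by linarith) (by linarith) x
        rw [Real.rpow_one] at this
        linarith [w1 x]) hm) j hj
    simpa using this
  -- the moment `1 + v²`
  have s₂ : ∀ j : ℕ, h * j ≤ T → ∫⁻ x, ENNReal.ofReal (1 + vol x ^ 2) ∂(schemeIter κ S h m j)
      ≤ ENNReal.ofReal A₂ :=
    hs.moment_le (ψ := fun x => 1 + vol x ^ 2) (ℓ := fun x => 2 * K₀ * (1 + vol x))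
      (D := fun x y => 2 * vol x * vol y) (by fun_prop) (by fun_prop)
      (fun x => by positivity) (fun x => by have := vol_pos x; positivity)
      (fun x => by rw [hvolS]) (fun x y => by have := vol_pos x; have := vol_pos y; positivity)
      (fun x y => by rw [vol_add]; nlinarith)
      (fun x y => by
        have hd : 0 ≤ 2 * vol x * vol y := by
          have := vol_pos x; have := vol_pos y; positivity
        refine (hκD hd (kernel_mul_square_gain_le he.alpha_pos he.alpha_lt he.beta_pos
          he.beta_lt (vol_pos x) (vol_pos y))).trans (le_of_eq ?_)
        ring)
      (by positivity)
      (fun j hj => lintegral_ofReal_le_mul (by positivity) (fun x => le_rfl) (s₁ j hj))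
      (lintegral_ofReal_le_mul (by norm_num) (fun x => by
        have := rpow_vol_le_momentWeight (p := p) (k := k) (q := 2) (by linarith) (by linarith) x
        rw [Real.rpow_two] at this
        linarith [w1 x]) hm)
  -- the mixed moments
  have s₃ : ∀ j : ℕ, h * j ≤ T → ∫⁻ x, ENNReal.ofReal (area x * vol x ^ (-α) + area x * vol x ^ β)
      ∂(schemeIter κ S h m j) ≤ ENNReal.ofReal A₃ :=
    hs.moment_le (ψ := fun x => area x * vol x ^ (-α) + area x * vol x ^ β)
      (ℓ := fun x => 2 * K₀ * (1 + vol x ^ 2))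
      (D := fun x y => area x * vol y ^ β + area y * vol x ^ β)
      ((continuous_area.mul (cvr _)).add (continuous_area.mul (cvr _))).measurable (by fun_prop)
      (fun x => by
        have := area_pos x; have := pv x (-α); have := pv x β; positivity)
      (fun x => by positivity)
      (fun x => by
        have := pv x (-α)
        have := pv x β
        have := hS.area_le x
        rw [hvolS]
        gcongr)
      (fun x y => by
        have := area_pos x; have := area_pos y; have := pv x β; have := pv y β; positivity)
      (fun x y => by
        rw [area_add, vol_add]
        exact mixed_moment_add_le he.alpha_pos he.beta_pos he.beta_lt (area_pos x) (area_pos y)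
          (vol_pos x) (vol_pos y))
      (fun x y => by
        have hd : 0 ≤ area x * vol y ^ β + area y * vol x ^ β := by
          have := area_pos x; have := area_pos y; have := pv x β; have := pv y β; positivity
        refine (hκD hd (kernel_mul_mixed_gain_le (sub_nonneg.2 he.le) he.alpha_pos he.beta_lt
          (area_pos x) (area_pos y) (vol_pos x) (vol_pos y))).trans (le_of_eq ?_)
        ring)
      (by positivity)
      (fun j hj => lintegral_ofReal_le_mul (by positivity) (fun x => le_rfl) (s₂ j hj))
      (lintegral_ofReal_le_mul (by norm_num) (mixed_moment_le he p) hm)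
  -- the full weight
  let ℓ₄ : IsoRegion → ℝ := fun x =>
    c₄ * (1 + vol x ^ 2) + c₄ * (area x * vol x ^ (-α) + area x * vol x ^ β)
  have cmix : Continuous fun x => area x * vol x ^ (-α) + area x * vol x ^ β :=
    (continuous_area.mul (cvr _)).add (continuous_area.mul (cvr _))
  have hmix0 : ∀ x, 0 ≤ area x * vol x ^ (-α) + area x * vol x ^ β := fun x => by
    have := area_pos x; have := pv x (-α); have := pv x β; positivity
  have hD0 : ∀ (q s t : ℝ), 0 < s → 0 < t → 0 ≤ s ^ (q - 1) * t + s * t ^ (q - 1) :=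
    fun q s t hs ht => by
      have := Real.rpow_pos_of_pos hs (q - 1)
      have := Real.rpow_pos_of_pos ht (q - 1)
      positivity
  refine hs.moment_le (ψ := momentWeight k p) (ℓ := ℓ₄)
    (D := fun x y => Ck * (vol x ^ (k - 1) * vol y + vol x * vol y ^ (k - 1))
      + Cp * (vol x ^ (p - 1) * vol y + vol x * vol y ^ (p - 1))
      + Ck * (area x ^ (k - 1) * area y + area x * area y ^ (k - 1)))
    (continuous_momentWeight k p).measurable
    (((by fun_prop : Continuous fun x => c₄ * (1 + vol x ^ 2)).add
      (continuous_const.mul cmix)).measurable)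
    (fun x => by linarith [w1 x])
    (fun x => add_nonneg (by positivity) (mul_nonneg hc₄ (hmix0 x)))
    (fun x => by
      unfold momentWeight
      rw [hvolS]
      have := Real.rpow_le_rpow (area_pos (S x)).le (hS.area_le x) (by linarith : 0 ≤ k)
      linarith)
    (fun x y => by
      have e1 := hD0 k _ _ (vol_pos x) (vol_pos y)
      have e2 := hD0 p _ _ (vol_pos x) (vol_pos y)
      have e3 := hD0 k _ _ (area_pos x) (area_pos y)
      positivity)
    (fun x y => by
      have e1 := hCk _ _ (vol_pos x) (vol_pos y)
      have e2 := hCp _ _ (vol_pos x) (vol_pos y)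
      have e3 := hCk _ _ (area_pos x) (area_pos y)
      have e4 : (vol x + vol y) ^ (-k) ≤ vol x ^ (-k) :=
        Real.rpow_le_rpow_of_nonpos (vol_pos x) (by linarith [vol_pos y]) (by linarith)
      have e5 := pv y (-k)
      unfold momentWeight
      rw [vol_add, area_add]
      linarith)
    (fun x y => ?_) (by positivity)
    (fun j hj => ?_) hm
  · -- the kernel times the gain
    have volume_part : ∀ (q C : ℝ), 0 ≤ C → (q < 1 → C = 0) →
        (∀ z : IsoRegion, vol z ^ (-k) + vol z ^ q ≤ momentWeight k p z) →
        kernelPower α β x y * (C * (vol x ^ (q - 1) * vol y + vol x * vol y ^ (q - 1)))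
          ≤ 2 * C * (momentWeight k p x * (1 + vol y ^ 2))
            + 2 * C * ((1 + vol x ^ 2) * momentWeight k p y) := by
      intro q C hC0 hC1 hq
      rcases lt_or_ge q 1 with h1 | h1
      · rw [hC1 h1]
        simp
      · have g1 := kernel_mul_volume_gain_le he.alpha_pos he.alpha_lt he.beta_pos he.beta_lt
          (by linarith : 1 ≤ k) h1 (vol_pos x) (vol_pos y)
        have g2 := kernel_mul_volume_gain_le he.alpha_pos he.alpha_lt he.beta_pos he.beta_lt
          (by linarith : 1 ≤ k) h1 (vol_pos y) (vol_pos x)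
        have g3 : kernelPower α β x y * (C * (vol x ^ (q - 1) * vol y + vol x * vol y ^ (q - 1)))
            = C * ((vol x ^ (-α) * vol y ^ β + vol y ^ (-α) * vol x ^ β)
                * (vol x ^ (q - 1) * vol y))
              + C * ((vol y ^ (-α) * vol x ^ β + vol x ^ (-α) * vol y ^ β)
                * (vol y ^ (q - 1) * vol x)) := by
          unfold kernelPower
          ring
        rw [g3]
        have g4 := mul_le_mul_of_nonneg_left g1 hC0
        have g5 := mul_le_mul_of_nonneg_left g2 hC0
        have g6 := mul_le_mul_of_nonneg_left (mul_le_mul_of_nonneg_right (hq x)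
          (by positivity : 0 ≤ 1 + vol y ^ 2)) (by positivity : 0 ≤ 2 * C)
        have g7 := mul_le_mul_of_nonneg_left (mul_le_mul_of_nonneg_right (hq y)
          (by positivity : 0 ≤ 1 + vol x ^ 2)) (by positivity : 0 ≤ 2 * C)
        linarith
    have vk := volume_part k Ck hCk0 (fun h' => absurd h' (by linarith)) (fun z => by
      unfold momentWeight
      linarith [pv z p, Real.rpow_pos_of_pos (area_pos z) k])
    have vp := volume_part p Cp hCp0 hCp1 (fun z => by
      unfold momentWeight
      linarith [pv z k, Real.rpow_pos_of_pos (area_pos z) k])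
    have area_part : kernelPower α β x y
        * (Ck * (area x ^ (k - 1) * area y + area x * area y ^ (k - 1)))
        ≤ Ck * (momentWeight k p x * (area y * vol y ^ (-α) + area y * vol y ^ β))
          + Ck * ((area x * vol x ^ (-α) + area x * vol x ^ β) * momentWeight k p y) := by
      have hq : ∀ z : IsoRegion, 1 + vol z ^ (-k) + vol z ^ k + area z ^ k
          ≤ momentWeight k p z := fun z => by
        unfold momentWeight
        linarith [pv z p]
      have g1 := kernel_mul_area_gain_le he.alpha_pos he.alpha_lt he.beta_pos he.beta_lt
        (by linarith : 1 ≤ k) (area_pos x) (area_pos y) (vol_pos x) (vol_pos y)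
      have g2 := kernel_mul_area_gain_le he.alpha_pos he.alpha_lt he.beta_pos he.beta_lt
        (by linarith : 1 ≤ k) (area_pos y) (area_pos x) (vol_pos y) (vol_pos x)
      have g3 := mul_le_mul_of_nonneg_right (hq x) (hmix0 y)
      have g4 := mul_le_mul_of_nonneg_right (hq y) (hmix0 x)
      have g5 := mul_le_mul_of_nonneg_left (g1.trans g3) hCk0
      have g6 := mul_le_mul_of_nonneg_left (g2.trans g4) hCk0
      have g7 : kernelPower α β x y
          * (Ck * (area x ^ (k - 1) * area y + area x * area y ^ (k - 1)))
          = Ck * ((vol x ^ (-α) * vol y ^ β + vol y ^ (-α) * vol x ^ β)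
              * (area x ^ (k - 1) * area y))
            + Ck * ((vol y ^ (-α) * vol x ^ β + vol x ^ (-α) * vol y ^ β)
              * (area y ^ (k - 1) * area x)) := by
        unfold kernelPower
        ring
      rw [g7]
      linarith
    have e1 := hD0 k _ _ (vol_pos x) (vol_pos y)
    have e2 := hD0 p _ _ (vol_pos x) (vol_pos y)
    have e3 := hD0 k _ _ (area_pos x) (area_pos y)
    have gain := add_le_add (add_le_add vk vp) area_part
    rw [← mul_add, ← mul_add] at gain
    have total := hκD (by positivity) gain
    refine total.trans ?_
    have n1 : 0 ≤ momentWeight k p x * (area y * vol y ^ (-α) + area y * vol y ^ β) :=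
      mul_nonneg (by linarith [w1 x]) (hmix0 y)
    have n2 : 0 ≤ (area x * vol x ^ (-α) + area x * vol x ^ β) * momentWeight k p y :=
      mul_nonneg (hmix0 x) (by linarith [w1 y])
    have n3 : 0 ≤ momentWeight k p x * (1 + vol y ^ 2) :=
      mul_nonneg (by linarith [w1 x]) (by positivity)
    have n4 : 0 ≤ (1 + vol x ^ 2) * momentWeight k p y :=
      mul_nonneg (by positivity) (by linarith [w1 y])
    have n5 : 0 ≤ K₀ * Ck := by positivity
    have n6 : 0 ≤ K₀ * (2 * Ck + 2 * Cp) := by positivity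
    -- `ℓ₄` carries the single constant `c₄` in front of both auxiliary moments; its surplus over
    -- what the gain requires is a sum of nonnegative terms.
    have diff : momentWeight k p x * ℓ₄ y + ℓ₄ x * momentWeight k p y
        - K₀ * (2 * Ck * (momentWeight k p x * (1 + vol y ^ 2))
            + 2 * Ck * ((1 + vol x ^ 2) * momentWeight k p y)
          + (2 * Cp * (momentWeight k p x * (1 + vol y ^ 2))
            + 2 * Cp * ((1 + vol x ^ 2) * momentWeight k p y))
          + (Ck * (momentWeight k p x * (area y * vol y ^ (-α) + area y * vol y ^ β))
            + Ck * ((area x * vol x ^ (-α) + area x * vol x ^ β) * momentWeight k p y)))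
        = K₀ * Ck * (momentWeight k p x * (1 + vol y ^ 2))
          + K₀ * Ck * ((1 + vol x ^ 2) * momentWeight k p y)
          + K₀ * (2 * Ck + 2 * Cp)
            * (momentWeight k p x * (area y * vol y ^ (-α) + area y * vol y ^ β))
          + K₀ * (2 * Ck + 2 * Cp)
            * ((area x * vol x ^ (-α) + area x * vol x ^ β) * momentWeight k p y) := by
      simp only [ℓ₄, c₄]
      ring
    have := mul_nonneg n5 n3
    have := mul_nonneg n5 n4
    have := mul_nonneg n6 n1
    have := mul_nonneg n6 n2
    linarith
  · have d1 := lintegral_ofReal_le_mul hc₄ (fun x => le_rfl) (s₂ j hj)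
    have d2 := lintegral_ofReal_le_mul hc₄ (fun x => le_rfl) (s₃ j hj)
    calc ∫⁻ x, ENNReal.ofReal (ℓ₄ x) ∂(schemeIter κ S h m j)
        = ∫⁻ x, ENNReal.ofReal (c₄ * (1 + vol x ^ 2)) ∂(schemeIter κ S h m j)
          + ∫⁻ x, ENNReal.ofReal (c₄ * (area x * vol x ^ (-α) + area x * vol x ^ β))
            ∂(schemeIter κ S h m j) := by
          rw [← lintegral_add_left (by fun_prop)]
          exact lintegral_congr fun x =>
            ENNReal.ofReal_add (by positivity) (mul_nonneg hc₄ (hmix0 x))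
      _ ≤ ENNReal.ofReal (c₄ * A₂) + ENNReal.ofReal (c₄ * A₃) := add_le_add d1 d2
      _ = ENNReal.ofReal B₄ := (ENNReal.ofReal_add (by positivity) (by positivity)).symm

end Moments

/-! ### The discretized coagulation-fusion equation -/

section Relax

/-- One explicit step of the relaxation `a' = -ρ (a - c₀ v^{2/3})` over the time `τ`, with the
contraction factor bounded below. -/
def relax (τ : ℝ) (ρ : IsoRegion → ℝ) (x : IsoRegion) : IsoRegion :=
  ⟨(sphereArea (vol x) + max (1 / 2) (1 - τ * ρ x) * (area x - sphereArea (vol x)), vol x),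
    vol_pos x, le_add_of_nonneg_right (mul_nonneg (le_max_of_le_left (by norm_num))
      (sub_nonneg.2 (sphereArea_vol_le x)))⟩

variable {ρ : IsoRegion → ℝ} {τ : ℝ}

@[simp] lemma vol_relax (τ : ℝ) (ρ : IsoRegion → ℝ) (x : IsoRegion) :
    vol (relax τ ρ x) = vol x := rfl

lemma area_relax (τ : ℝ) (ρ : IsoRegion → ℝ) (x : IsoRegion) : area (relax τ ρ x) =
    sphereArea (vol x) + max (1 / 2) (1 - τ * ρ x) * (area x - sphereArea (vol x)) := rfl

lemma area_relax_le (hτ : 0 ≤ τ) (hρ : ∀ x, 0 ≤ ρ x) (x : IsoRegion) :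
    area (relax τ ρ x) ≤ area x := by
  have h1 : max (1 / 2) (1 - τ * ρ x) ≤ 1 :=
    max_le (by norm_num) (by linarith [mul_nonneg hτ (hρ x)])
  have h2 := sub_nonneg.2 (sphereArea_vol_le x)
  rw [area_relax]
  nlinarith

lemma isAreaDecreasing_relax (hτ : 0 ≤ τ) (hρ : ∀ x, 0 ≤ ρ x) : IsAreaDecreasing (relax τ ρ) :=
  ⟨vol_relax τ ρ, area_relax_le hτ hρ⟩

lemma area_sub_area_relax_le (x : IsoRegion) :
    area x - area (relax τ ρ x) ≤ τ * (ρ x * (area x - sphereArea (vol x))) := by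
  have h1 : 1 - τ * ρ x ≤ max (1 / 2) (1 - τ * ρ x) := le_max_right _ _
  have h2 := sub_nonneg.2 (sphereArea_vol_le x)
  rw [area_relax]
  nlinarith

/-- The floor `1 / 2` on the contraction factor prevents points of large area from being thrown into
a bounded set in one step, however large the rate. -/
lemma area_le_two_mul_area_relax (x : IsoRegion) : area x ≤ 2 * area (relax τ ρ x) := by
  have h1 : 1 / 2 ≤ max (1 / 2) (1 - τ * ρ x) := le_max_left _ _
  have h2 := sub_nonneg.2 (sphereArea_vol_le x)
  have h3 := sphereArea_pos (vol_pos x)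
  rw [area_relax]
  nlinarith

lemma continuous_relax (hρ : Continuous ρ) (τ : ℝ) : Continuous (relax τ ρ) := by
  have h := continuous_sphereArea.comp continuous_vol
  refine Continuous.subtype_mk (Continuous.prodMk (h.add (Continuous.mul ?_
    (continuous_area.sub h))) continuous_vol) _
  fun_prop

/-- On compact sets, the relaxation moves points by at most a multiple of the time step. -/
lemma exists_area_sub_relax_le (hρ : Continuous ρ) {δ : ℝ} (hδ : 0 < δ) (R : ℝ) :
    ∃ C, 0 ≤ C ∧ ∀ τ, 0 ≤ τ → ∀ x : IsoRegion, δ ≤ vol x → vol x ≤ R →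
      area (relax τ ρ x) ≤ R → area x - area (relax τ ρ x) ≤ τ * C := by
  have hc : Continuous fun x => ρ x * (area x - sphereArea (vol x)) :=
    hρ.mul (continuous_area.sub (continuous_sphereArea.comp continuous_vol))
  -- Only the area after the step is bounded by `R`; the area before it is then at most `2R`.
  obtain ⟨C, hC⟩ := ((isCompact_region_box (M := 2 * R) hδ).image hc).bddAbove
  refine ⟨max C 0, le_max_right _ _, fun τ hτ x h1 h2 h3 =>
    (area_sub_area_relax_le x).trans (mul_le_mul_of_nonneg_left ?_ hτ)⟩
  refine (hC ⟨x, ⟨h1, ?_, ?_⟩, rfl⟩).trans (le_max_left _ _)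
  · linarith [vol_pos x]
  · linarith [area_le_two_mul_area_relax (τ := τ) (ρ := ρ) x]

/-- A Lipschitz function on the plane whose support, within the region `{a ≥ c₀ v^{2/3}}`, is
contained in `{δ ≤ v ≤ R, a ≤ R}`, changes by at most a multiple of the step under relaxation. -/
lemma exists_abs_comp_relax_sub_le (hρ : Continuous ρ) (hρ0 : ∀ x, 0 ≤ ρ x) {δ : ℝ} (hδ : 0 < δ)
    (R L : ℝ) : ∃ C, 0 ≤ C ∧ ∀ g : ℝ × ℝ → ℝ,
      (∀ η η', |g η - g η'| ≤ L * ‖η - η'‖) →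
      (∀ x : IsoRegion, g x ≠ 0 → δ ≤ vol x ∧ vol x ≤ R ∧ area x ≤ R) →
      ∀ τ, 0 ≤ τ → ∀ x : IsoRegion, |g (relax τ ρ x) - g x| ≤ τ * C := by
  obtain ⟨C, hC0, hC⟩ := exists_area_sub_relax_le hρ hδ R
  refine ⟨|L| * C, by positivity, fun g hg hsupp τ hτ x => ?_⟩
  have hle := area_relax_le hτ hρ0 x
  -- If either value is nonzero, the relaxed point satisfies the box bounds, because relaxation
  -- keeps the volume and decreases the area.
  by_cases h : g (relax τ ρ x) = 0 ∧ g x = 0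
  · rw [h.1, h.2, sub_zero, abs_zero]
    positivity
  · have hx : δ ≤ vol x ∧ vol x ≤ R ∧ area (relax τ ρ x) ≤ R := by
      by_cases h1 : g x = 0
      · exact hsupp (relax τ ρ x) fun h2 => h ⟨h2, h1⟩
      · have := hsupp x h1
        exact ⟨this.1, this.2.1, hle.trans this.2.2⟩
    have hnorm : ‖((relax τ ρ x : IsoRegion) : ℝ × ℝ) - x‖ = area x - area (relax τ ρ x) := by
      rw [Prod.norm_def, Prod.fst_sub, Prod.snd_sub]
      change max ‖area (relax τ ρ x) - area x‖ ‖vol x - vol x‖ = _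
      rw [sub_self, norm_zero, max_eq_left (norm_nonneg _), Real.norm_eq_abs, abs_sub_comm,
        abs_of_nonneg (sub_nonneg.2 hle)]
    have hd := hC τ hτ x hx.1 hx.2.1 hx.2.2
    calc |g (relax τ ρ x) - g x| ≤ L * ‖((relax τ ρ x : IsoRegion) : ℝ × ℝ) - x‖ := hg _ _
      _ ≤ |L| * (τ * C) := by
          rw [hnorm]
          exact mul_le_mul (le_abs_self L) hd (sub_nonneg.2 hle) (abs_nonneg _)
      _ = _ := by ring

end Relax

/-! ### The Euler scheme with truncated kernel: positivity, moments, regularity in time -/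

section System

/-- The standing assumptions on the coagulation kernel and on the fusion rate. -/
structure IsFusionSystem (K : IsoRegion → IsoRegion → ℝ) (ρ : IsoRegion → ℝ) (α β k K₀ : ℝ) :
    Prop where
  exponents : ExponentRange α β k
  continuous_kernel : Continuous (Function.uncurry K)
  nonneg : ∀ x y, 0 ≤ K x y
  symm : ∀ x y, K x y = K y x
  le : ∀ x y, K x y ≤ K₀ * kernelPower α β x y
  bound_nonneg : 0 ≤ K₀
  continuous_rate : Continuous ρ
  rate_nonneg : ∀ x, 0 ≤ ρ x

/-- An initial datum with `∫ W dm ≤ M₀`. -/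
structure IsInitialDatum (k p M₀ : ℝ) (m : Measure IsoRegion) : Prop where
  bound_nonneg : 0 ≤ M₀
  moment_le : ∫⁻ x, ENNReal.ofReal (momentWeight k p x) ∂m ≤ ENNReal.ofReal M₀

/-- The time step of the `n`-th discretization. -/
def stepSize (M₀ : ℝ) (n : ℕ) : ℝ := 1 / (((n : ℝ) + 1) ^ 2 * (1 + M₀))

/-- The piecewise constant curve defined by the `n`-th discretization. -/
def approxSolution (K : IsoRegion → IsoRegion → ℝ) (ρ : IsoRegion → ℝ) (M₀ ε : ℝ)
    (m : Measure IsoRegion) (n : ℕ) (t : ℝ) : Measure IsoRegion :=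
  schemeIter (fun x y => min (K x y) n) (relax (stepSize M₀ n / ε) ρ) (stepSize M₀ n) m
    ⌊t / stepSize M₀ n⌋₊

variable {K : IsoRegion → IsoRegion → ℝ} {ρ : IsoRegion → ℝ} {α β k K₀ p M₀ ε : ℝ}
  {m : Measure IsoRegion}

lemma stepSize_pos (hM₀ : 0 ≤ M₀) (n : ℕ) : 0 < stepSize M₀ n := by
  unfold stepSize
  positivity

lemma tendsto_stepSize (hM₀ : 0 ≤ M₀) : Tendsto (stepSize M₀) atTop (𝓝 0) := by
  have h : Tendsto (fun n : ℕ => ((n : ℝ) + 1) ^ 2 * (1 + M₀)) atTop atTop := by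
    refine Tendsto.atTop_mul_const (by linarith) ?_
    exact (tendsto_pow_atTop (by norm_num)).comp
      (tendsto_atTop_add_const_right _ _ tendsto_natCast_atTop_atTop)
  exact (tendsto_inv_atTop_zero.comp h).congr fun n => (one_div _).symm

lemma stepSize_mul_floor_le (hM₀ : 0 ≤ M₀) (n : ℕ) {t : ℝ} (ht : 0 ≤ t) :
    stepSize M₀ n * ⌊t / stepSize M₀ n⌋₊ ≤ t := by
  have h := stepSize_pos hM₀ n
  have := Nat.floor_le (div_nonneg ht h.le)
  rw [le_div_iff₀ h] at this
  linarith

lemma lt_stepSize_mul_floor_add (hM₀ : 0 ≤ M₀) (n : ℕ) (t : ℝ) :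
    t < stepSize M₀ n * ⌊t / stepSize M₀ n⌋₊ + stepSize M₀ n := by
  have h := stepSize_pos hM₀ n
  have := Nat.lt_floor_add_one (t / stepSize M₀ n)
  rw [div_lt_iff₀ h] at this
  linarith

lemma tendsto_stepSize_mul_floor (hM₀ : 0 ≤ M₀) {t : ℝ} (ht : 0 ≤ t) :
    Tendsto (fun n => stepSize M₀ n * ⌊t / stepSize M₀ n⌋₊) atTop (𝓝 t) := by
  have h1 : Tendsto (fun n => t - stepSize M₀ n) atTop (𝓝 t) := by
    simpa using tendsto_const_nhds.sub (tendsto_stepSize hM₀)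
  exact tendsto_of_tendsto_of_tendsto_of_le_of_le h1 tendsto_const_nhds
    (fun n => by have := lt_stepSize_mul_floor_add hM₀ n t; simp only; linarith)
    fun n => stepSize_mul_floor_le hM₀ n ht

lemma ExponentRange.isProperWeight (he : ExponentRange α β k) :
    IsProperWeight (momentWeight k p) :=
  isProperWeight_momentWeight (by linarith [he.two_le])

lemma IsInitialDatum.measure_univ_le (hm : IsInitialDatum k p M₀ m) :
    m univ ≤ ENNReal.ofReal M₀ := by
  refine le_trans ?_ hm.moment_le
  rw [← lintegral_one]
  refine lintegral_mono fun x => ?_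
  rw [← ENNReal.ofReal_one]
  exact ENNReal.ofReal_le_ofReal (one_le_momentWeight k p x)

/-- The step size is chosen so that `stepSize · n · M₀ ≤ 1`: with the kernel truncated at `n`, the
factor `1 - h · lossRate` of an Euler step never becomes negative. -/
lemma IsFusionSystem.isScheme (hK : IsFusionSystem K ρ α β k K₀) (hm : IsInitialDatum k p M₀ m)
    (ε : ℝ) (n : ℕ) : IsScheme (fun x y => min (K x y) n) (relax (stepSize M₀ n / ε) ρ)
      (stepSize M₀ n) n m where
  kernel :=
    { measurable := (hK.continuous_kernel.min continuous_const).measurable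
      nonneg := fun x y => le_min (hK.nonneg x y) (Nat.cast_nonneg n)
      symm := fun x y => by rw [hK.symm]
      le := fun x y => min_le_right _ _ }
  measurable := (continuous_relax hK.continuous_rate _).measurable
  step_pos := stepSize_pos hm.bound_nonneg n
  finite := ⟨hm.measure_univ_le.trans_lt ENNReal.ofReal_lt_top⟩
  small := by
    have h0 := hm.bound_nonneg
    calc ENNReal.ofReal (stepSize M₀ n) * (ENNReal.ofReal n * m univ)
        ≤ ENNReal.ofReal (stepSize M₀ n) * (ENNReal.ofReal n * ENNReal.ofReal M₀) := by
          gcongr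
          exact hm.measure_univ_le
      _ = ENNReal.ofReal (stepSize M₀ n * (n * M₀)) := by
          rw [← ENNReal.ofReal_mul (Nat.cast_nonneg n),
            ← ENNReal.ofReal_mul (stepSize_pos h0 n).le]
      _ ≤ 1 := by
          rw [← ENNReal.ofReal_one]
          refine ENNReal.ofReal_le_ofReal ?_
          rw [stepSize, one_div_mul_eq_div, div_le_one (by positivity)]
          have hn : (0 : ℝ) ≤ n := Nat.cast_nonneg n
          nlinarith [mul_nonneg hn h0, mul_nonneg hn hn, mul_nonneg (mul_nonneg hn hn) h0]

/-- The moment bound for the approximate solutions, uniformly in `ε`. -/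
lemma IsFusionSystem.exists_weightBound (hK : IsFusionSystem K ρ α β k K₀)
    (hm : IsInitialDatum k p M₀ m) (T : ℝ) : ∃ C, 0 ≤ C ∧ ∀ ε, 0 < ε → ∀ (n j : ℕ),
      stepSize M₀ n * j ≤ T →
      ∫⁻ x, ENNReal.ofReal (momentWeight k p x) ∂(schemeIter (fun x y => min (K x y) n)
        (relax (stepSize M₀ n / ε) ρ) (stepSize M₀ n) m j) ≤ ENNReal.ofReal C := by
  obtain ⟨C, hC0, hC⟩ := exists_moment_bound hK.exponents p hK.bound_nonneg hm.bound_nonneg (T := T)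
  refine ⟨C, hC0, fun ε hε n j hj => hC _ _ _ _ m (hK.isScheme hm ε n)
    (fun x y => (min_le_left _ _).trans (hK.le x y)) (isAreaDecreasing_relax
      (div_nonneg (stepSize_pos hm.bound_nonneg n).le hε.le) hK.rate_nonneg) hm.moment_le j hj⟩

/-- The constant is `6 = 2 · 3`: the `2` of `kernelPower_le_sqrt`, and three values of a function
bounded by `B`. -/
lemma abs_kernel_mul_le {κ : IsoRegion → IsoRegion → ℝ} (hκ0 : ∀ x y, 0 ≤ κ x y)
    (hK₀ : 0 ≤ K₀) (he : ExponentRange α β k) (hκ : ∀ x y, κ x y ≤ K₀ * kernelPower α β x y)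
    {φ : IsoRegion → ℝ} {B : ℝ} (hB : ∀ x, |φ x| ≤ B) (p : ℝ) (x y : IsoRegion) :
    |κ x y * (φ (x + y) - φ x - φ y)|
      ≤ 6 * K₀ * B * √(momentWeight k p x) * √(momentWeight k p y) := by
  have h1 : |φ (x + y) - φ x - φ y| ≤ 3 * B := by
    have a1 := abs_le.1 (hB (x + y))
    have a2 := abs_le.1 (hB x)
    have a3 := abs_le.1 (hB y)
    rw [abs_le]
    constructor <;> linarith [a1.1, a1.2, a2.1, a2.2, a3.1, a3.2]
  have hB0 : 0 ≤ B := (abs_nonneg _).trans (hB x)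
  have h2 := mul_le_mul_of_nonneg_left (kernelPower_le_sqrt he p x y) hK₀
  have h3 := (hκ x y).trans h2
  rw [abs_mul, abs_of_nonneg (hκ0 x y)]
  calc κ x y * |φ (x + y) - φ x - φ y|
      ≤ K₀ * (2 * √(momentWeight k p x) * √(momentWeight k p y)) * (3 * B) :=
        mul_le_mul h3 h1 (abs_nonneg _) ((hκ0 x y).trans h3)
    _ = _ := by ring

lemma abs_coagulation_le {κ : IsoRegion → IsoRegion → ℝ} (hκ0 : ∀ x y, 0 ≤ κ x y)
    (hK₀ : 0 ≤ K₀) (he : ExponentRange α β k) (hκ : ∀ x y, κ x y ≤ K₀ * kernelPower α β x y)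
    {φ : IsoRegion → ℝ} {B : ℝ} (hB0 : 0 ≤ B) (hB : ∀ x, |φ x| ≤ B) {n : Measure IsoRegion}
    {C : ℝ} (hn : WeightBound (momentWeight k p) C n) :
    |(1 / 2) * ∫ x, ∫ y, κ x y * (φ (x + y) - φ x - φ y) ∂n ∂n| ≤ 3 * K₀ * B * C ^ 2 := by
  have hW := he.isProperWeight (p := p)
  have hC := hn.nonneg hW
  have inner : ∀ x, |∫ y, κ x y * (φ (x + y) - φ x - φ y) ∂n|
      ≤ 6 * K₀ * B * C * momentWeight k p x := by
    intro x
    have w0 := hW.one_le x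
    have := hn.abs_integral_le (G := fun y => κ x y * (φ (x + y) - φ x - φ y))
      (A := 6 * K₀ * B * momentWeight k p x) (by positivity) fun y =>
        (abs_kernel_mul_le hκ0 hK₀ he hκ hB p x y).trans (by
          have := hW.sqrt_le x
          have := hW.sqrt_le y
          gcongr)
    linarith
  have outer := hn.abs_integral_le (by positivity) inner
  rw [abs_mul, abs_of_pos (by norm_num : (0 : ℝ) < 1 / 2)]
  calc 1 / 2 * |∫ x, ∫ y, κ x y * (φ (x + y) - φ x - φ y) ∂n ∂n|
      ≤ 1 / 2 * (6 * K₀ * B * C * C) := by gcongr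
    _ = _ := by ring

lemma abs_sub_le_of_forall_succ {u : ℕ → ℝ} {c : ℝ} {J : ℕ}
    (h : ∀ j < J, |u (j + 1) - u j| ≤ c) {i j : ℕ} (hij : i ≤ j) (hj : j ≤ J) :
    |u j - u i| ≤ (j - i) * c := by
  induction j, hij using Nat.le_induction with
  | base => simp
  | succ j hij ih =>
    have h1 := h j (by omega)
    have h2 := ih (by omega)
    have h3 := abs_add_le (u (j + 1) - u j) (u j - u i)
    rw [sub_add_sub_cancel] at h3
    push_cast
    linarith

/-- Functions that change slowly under relaxation have integrals against the approximate solutions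
which are almost Lipschitz continuous in time. -/
lemma IsFusionSystem.abs_integral_approx_sub_le (hK : IsFusionSystem K ρ α β k K₀)
    (hm : IsInitialDatum k p M₀ m) {n : ℕ} {T C : ℝ}
    (hC : ∀ j : ℕ, stepSize M₀ n * j ≤ T → WeightBound (momentWeight k p) C
      (schemeIter (fun x y => min (K x y) n) (relax (stepSize M₀ n / ε) ρ) (stepSize M₀ n) m j))
    {φ : IsoRegion → ℝ} (hφ : Measurable φ) {B C₁ : ℝ} (hB0 : 0 ≤ B) (hB : ∀ x, |φ x| ≤ B)
    (hC₁0 : 0 ≤ C₁)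
    (hC₁ : ∀ x, |φ (relax (stepSize M₀ n / ε) ρ x) - φ x| ≤ stepSize M₀ n * C₁)
    {s t : ℝ} (hs : s ∈ Icc 0 T) (ht : t ∈ Icc 0 T) :
    |∫ x, φ x ∂(approxSolution K ρ M₀ ε m n s) - ∫ x, φ x ∂(approxSolution K ρ M₀ ε m n t)|
      ≤ (C₁ * C + 3 * K₀ * B * C ^ 2) * (|s - t| + stepSize M₀ n) := by
  wlog hst : t ≤ s generalizing s t
  · rw [abs_sub_comm, abs_sub_comm s]
    exact this ht hs (le_of_not_ge hst)
  have hh := stepSize_pos hm.bound_nonneg n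
  have hW := hK.exponents.isProperWeight (p := p)
  have hS := hK.isScheme hm ε n
  have hK₀ := hK.bound_nonneg
  set h := stepSize M₀ n
  set S := relax (h / ε) ρ
  set f := schemeIter (fun x y => min (K x y) n) S h m
  have hC0 : 0 ≤ C := (hC 0 (by simpa using ht.1.trans ht.2)).nonneg hW
  have hstep : ∀ j < ⌊s / h⌋₊, |∫ x, φ x ∂(f (j + 1)) - ∫ x, φ x ∂(f j)|
      ≤ h * (C₁ * C + 3 * K₀ * B * C ^ 2) := by
    intro j hj
    have hjT : h * j ≤ T := (mul_le_mul_of_nonneg_left (by exact_mod_cast hj.le) hh.le).trans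
      ((stepSize_mul_floor_le hm.bound_nonneg n hs.1).trans hs.2)
    have hw := hC j hjT
    have e := hS.integral_succ_sub hφ hφ hB hB j
    have b1 : |∫ x, (φ (S x) - φ x) / h ∂(f j)| ≤ C₁ * C := by
      refine hw.abs_integral_le hC₁0 fun x => ?_
      rw [abs_div, abs_of_pos hh, div_le_iff₀ hh]
      have w1 := hW.one_le x
      calc |φ (S x) - φ x| ≤ h * C₁ := hC₁ x
        _ ≤ h * C₁ * momentWeight k p x := le_mul_of_one_le_right (by positivity) w1
        _ = _ := by ring
    have b2 := abs_coagulation_le (φ := fun x => φ (S x)) hS.kernel.nonneg hK₀ hK.exponents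
      (fun x y => (min_le_left _ _).trans (hK.le x y)) hB0 (fun x => hB _) hw
    rw [e, abs_mul, abs_of_pos hh]
    exact mul_le_mul_of_nonneg_left ((abs_add_le _ _).trans (add_le_add b1 b2)) hh.le
  have hfl : ⌊t / h⌋₊ ≤ ⌊s / h⌋₊ := Nat.floor_mono (by gcongr)
  have key := abs_sub_le_of_forall_succ (u := fun j => ∫ x, φ x ∂(f j)) hstep hfl le_rfl
  refine key.trans ?_
  have c1 := stepSize_mul_floor_le hm.bound_nonneg n hs.1
  have c2 := lt_stepSize_mul_floor_add hm.bound_nonneg n t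
  rw [abs_of_nonneg (sub_nonneg.2 hst)]
  -- Rounding both times down to the grid lengthens the interval by at most one step; hence the
  -- extra `stepSize` in the bound.
  have c3 : ((⌊s / h⌋₊ : ℝ) - ⌊t / h⌋₊) * h ≤ s - t + h := by
    simp only [h] at c1 c2 ⊢
    linarith
  calc ((⌊s / h⌋₊ : ℝ) - ⌊t / h⌋₊) * (h * (C₁ * C + 3 * K₀ * B * C ^ 2))
      = (C₁ * C + 3 * K₀ * B * C ^ 2) * (((⌊s / h⌋₊ : ℝ) - ⌊t / h⌋₊) * h) := by ring
    _ ≤ _ := mul_le_mul_of_nonneg_left c3 (by positivity)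

end System

/-! ### Vague limits of the approximate solutions -/

section Limit

/-- Compactly supported functions on the region `{a ≥ c₀ v^{2/3}}` are uniform limits of `C¹`
functions. -/
lemma exists_contDiff_abs_sub_le {φ : IsoRegion → ℝ} (hφ : Continuous φ)
    (hφ' : HasCompactSupport φ) {e : ℝ} (he : 0 < e) :
    ∃ (g : ℝ × ℝ → ℝ) (δ R L : ℝ), 0 < δ ∧ Continuous g ∧ (∀ x : IsoRegion, |φ x - g x| ≤ e) ∧
      (∀ x : IsoRegion, g x ≠ 0 → δ ≤ vol x ∧ vol x ≤ R ∧ area x ≤ R) ∧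
      (∀ η η', |g η - g η'| ≤ L * ‖η - η'‖) := by
  have hk : (1 : ℝ) ≤ 1 := le_rfl
  obtain ⟨R₀, hR₀⟩ := exists_weight_bound_of_hasCompactSupport
    (isProperWeight_momentWeight (p := 1) hk) hφ'
  set M := max 1 R₀
  have hM : 0 < M := lt_max_of_lt_left one_pos
  have hsupp : ∀ x, φ x ≠ 0 → M⁻¹ ≤ vol x ∧ vol x ≤ M ∧ area x ≤ M := fun x hx =>
    mem_box_of_momentWeight_le hk (not_lt.1 fun h => hx (hR₀ x h))
  -- Strictly below every volume in the support, so that `proj`, which lifts smaller volumes to `δ`,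
  -- lands where `φ` vanishes.
  set δ := M⁻¹ / 2
  have hδ : 0 < δ := by positivity
  have hδM : δ < M⁻¹ := half_lt_self (by positivity)
  let proj : ℝ × ℝ → IsoRegion := fun η =>
    ⟨(max η.1 (sphereArea (max η.2 δ)), max η.2 δ), lt_max_of_lt_right hδ, le_max_right _ _⟩
  have hproj : Continuous proj := by
    have := continuous_sphereArea
    exact Continuous.subtype_mk (by fun_prop) _
  -- The retraction `proj` forgets negative areas; a factor equal to `1` for `a ≥ 0` and to `0` for
  -- `a ≤ -1` restores compact support.
  let Φ : ℝ × ℝ → ℝ := fun η => φ (proj η) * max 0 (min 1 (1 + η.1))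
  have hΦ : Continuous Φ := (hφ.comp hproj).mul (by fun_prop)
  have hΦeq : ∀ x : IsoRegion, Φ x = φ x := by
    intro x
    have h1 : max 0 (min 1 (1 + (x : ℝ × ℝ).1)) = 1 := by
      rw [min_eq_left (by linarith [area_pos x]), max_eq_right zero_le_one]
    change φ (proj x) * _ = _
    rw [h1, mul_one]
    rcases le_total δ (vol x) with h | h
    · congr 1
      apply Subtype.ext
      change (max (area x) (sphereArea (max (vol x) δ)), max (vol x) δ) = _
      rw [max_eq_left h, max_eq_left (sphereArea_vol_le x)]
    · have z1 : φ x = 0 := by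
        by_contra h0
        linarith [(hsupp x h0).1]
      have z2 : φ (proj x) = 0 := by
        by_contra h0
        have h2 := (hsupp _ h0).1
        change M⁻¹ ≤ max (vol x) δ at h2
        rw [max_eq_right h] at h2
        linarith
      rw [z1, z2]
  -- The approximation can be taken with support inside that of `Φ`, which keeps `g` in the box.
  obtain ⟨g, hg, hgd, hgs⟩ := hΦ.exists_contDiff_approx 1 (ε := fun _ => e) continuous_const
    fun _ => he
  have hgc : HasCompactSupport g := by
    refine HasCompactSupport.of_support_subset_isCompact (isCompact_Icc (a := ((-1 : ℝ), (0 : ℝ)))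
      (b := (M, M))) fun η hη => ?_
    have h0 : φ (proj η) * max 0 (min 1 (1 + η.1)) ≠ 0 := hgs hη
    obtain ⟨h1, h2⟩ := mul_ne_zero_iff.1 h0
    obtain ⟨b1, b2, b3⟩ := hsupp _ h1
    change M⁻¹ ≤ max η.2 δ at b1
    change max η.2 δ ≤ M at b2
    change max η.1 _ ≤ M at b3
    have b4 : -1 ≤ η.1 := by
      by_contra h
      push Not at h
      exact h2 (max_eq_left ((min_le_right _ _).trans (by linarith)))
    have b5 : 0 ≤ η.2 := by
      by_contra h
      push Not at h
      rw [max_eq_right (by linarith)] at b1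
      linarith
    exact ⟨⟨b4, b5⟩, (le_max_left _ _).trans b3, (le_max_left _ _).trans b2⟩
  obtain ⟨L, hL⟩ := ContDiff.lipschitzWith_of_hasCompactSupport hgc hg (by norm_num)
  refine ⟨g, M⁻¹, M, L, by positivity, hg.continuous, fun x => ?_, fun x hx => ?_,
    fun η η' => ?_⟩
  · have := (hgd x).le
    rwa [hΦeq, Real.dist_eq, abs_sub_comm] at this
  · refine hsupp x ?_
    have : Φ x ≠ 0 := hgs hx
    rwa [hΦeq] at this
  · simpa [dist_eq_norm] using hL.dist_le_mul η η'

variable {K : IsoRegion → IsoRegion → ℝ} {ρ : IsoRegion → ℝ} {α β k K₀ p M₀ ε : ℝ}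
  {m : Measure IsoRegion}

lemma IsFusionSystem.isFiniteMeasure_approx (hK : IsFusionSystem K ρ α β k K₀)
    (hm : IsInitialDatum k p M₀ m) (ε : ℝ) (n : ℕ) (t : ℝ) :
    IsFiniteMeasure (approxSolution K ρ M₀ ε m n t) := (hK.isScheme hm ε n).isFiniteMeasure _

lemma IsFusionSystem.approx_real_univ_le (hK : IsFusionSystem K ρ α β k K₀)
    (hm : IsInitialDatum k p M₀ m) (ε : ℝ) (n : ℕ) (t : ℝ) :
    (approxSolution K ρ M₀ ε m n t).real univ ≤ M₀ :=
  ENNReal.toReal_le_of_le_ofReal hm.bound_nonneg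
    (((hK.isScheme hm ε n).mass_le _).trans hm.measure_univ_le)

/-- A `C¹` approximation of `φ` has integrals that are Lipschitz in time up to an error of one step.
That error disappears only as `n → ∞`, hence the asymptotic form of equicontinuity. The constant
contains `C₁ / ε`, so nothing here is uniform in `ε`. -/
lemma IsFusionSystem.asympEquicontinuousAt_approx (hK : IsFusionSystem K ρ α β k K₀)
    (hm : IsInitialDatum k p M₀ m) (hε : 0 < ε) {φ : IsoRegion → ℝ} (hφ : Continuous φ)
    (hφ' : HasCompactSupport φ) {t : ℝ} (ht : 0 ≤ t) :
    AsympEquicontinuousAt (approxSolution K ρ M₀ ε m) (Ici 0) φ t := by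
  intro e he
  have hM₀ := hm.bound_nonneg
  have hW := hK.exponents.isProperWeight (p := p)
  obtain ⟨g, δ, R, L, hδ, hg, hφg, hgs, hgL⟩ := exists_contDiff_abs_sub_le hφ hφ'
    (e := e / (4 * (M₀ + 1))) (by positivity)
  obtain ⟨C₁, hC₁0, hC₁⟩ := exists_abs_comp_relax_sub_le hK.continuous_rate hK.rate_nonneg hδ R L
  obtain ⟨C, hC0, hC⟩ := hK.exists_weightBound hm (t + 1)
  obtain ⟨B₀, hB₀⟩ := hφ.bounded_above_of_compact_support hφ'
  set B := |B₀| + e / (4 * (M₀ + 1))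
  have hB0 : 0 ≤ B := by positivity
  have hgB : ∀ x : IsoRegion, |g x| ≤ B := fun x => by
    have h1 := hφg x
    have h2 : |φ x| ≤ |B₀| := (hB₀ x).trans (le_abs_self _)
    rw [abs_le] at h1 h2 ⊢
    constructor <;> linarith [h1.1, h1.2, h2.1, h2.2]
  have hgc : Continuous fun x : IsoRegion => g x := hg.comp continuous_subtype_val
  set D := C₁ / ε * C + 3 * K₀ * B * C ^ 2
  have hK₀ := hK.bound_nonneg
  have hD : 0 ≤ D := by positivity
  refine ⟨min 1 (e / (4 * (D + 1))), by positivity, fun s hs hst => ?_⟩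
  have hs1 : |s - t| < 1 := hst.trans_le (min_le_left _ _)
  have hs2 : |s - t| < e / (4 * (D + 1)) := hst.trans_le (min_le_right _ _)
  have hsmall := (tendsto_stepSize hM₀).eventually (gt_mem_nhds
    (by positivity : 0 < e / (4 * (D + 1))))
  filter_upwards [hsmall] with n hn
  have hh := stepSize_pos hM₀ n
  have := hK.isFiniteMeasure_approx hm ε n
  have close : ∀ u, |∫ x, φ x ∂(approxSolution K ρ M₀ ε m n u)
      - ∫ x, g x ∂(approxSolution K ρ M₀ ε m n u)| ≤ e / 4 := by
    intro u
    refine (abs_integral_sub_le (hK.approx_real_univ_le hm ε n u)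
      (integrable_of_hasCompactSupport hφ hφ') (integrable_of_bounded hgc.measurable hgB)
      (by positivity) hφg).trans ?_
    rw [div_mul_eq_mul_div, div_le_div_iff₀ (by positivity) (by positivity)]
    nlinarith
  have key := hK.abs_integral_approx_sub_le hm (n := n) (ε := ε) (T := t + 1) (C := C)
    (fun j hj => weightBound_of_lintegral hW hC0 (hC ε hε n j hj)) hgc.measurable hB0 hgB
    (C₁ := C₁ / ε) (by positivity)
    (fun x => (hC₁ g hgL hgs _ (by positivity) x).trans (le_of_eq (by ring)))
    (s := s) (t := t) ⟨hs, by linarith [abs_lt.1 hs1]⟩ ⟨ht, by linarith⟩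
  have hb : D * (|s - t| + stepSize M₀ n) ≤ e / 2 := by
    have h1 : |s - t| + stepSize M₀ n ≤ e / (2 * (D + 1)) := by
      have : e / (2 * (D + 1)) = e / (4 * (D + 1)) + e / (4 * (D + 1)) := by field_simp; ring
      linarith
    calc D * (|s - t| + stepSize M₀ n) ≤ D * (e / (2 * (D + 1))) := by gcongr
      _ = e / 2 * (D / (D + 1)) := by field_simp
      _ ≤ e / 2 * 1 := by
          gcongr
          rw [div_le_one (by positivity)]
          linarith
      _ = _ := mul_one _
  have a1 := abs_le.1 (close s)
  have a2 := abs_le.1 (close t)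
  have a3 := abs_le.1 (key.trans hb)
  rw [abs_le]
  constructor <;> linarith [a1.1, a1.2, a2.1, a2.2, a3.1, a3.2]

/-- The approximate solutions have a subsequence which converges vaguely at all times to a vaguely
continuous curve. -/
theorem IsFusionSystem.exists_subseq_approx (hK : IsFusionSystem K ρ α β k K₀)
    (hm : IsInitialDatum k p M₀ m) (hε : 0 < ε) :
    ∃ θ : ℕ → ℕ, StrictMono θ ∧ ∃ f : ℝ → Measure IsoRegion,
      (∀ t, IsFiniteMeasureOnCompacts (f t)) ∧
      (∀ t ∈ Ici (0 : ℝ), VagueTendsto (fun n => approxSolution K ρ M₀ ε m (θ n) t) atTop (f t)) ∧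
      ∀ φ : IsoRegion → ℝ, Continuous φ → HasCompactSupport φ →
        ContinuousOn (fun t => ∫ x, φ x ∂(f t)) (Ici 0) := by
  have := hK.isFiniteMeasure_approx hm ε
  exact exists_subseq_vagueTendsto (hK.exponents.isProperWeight (p := p)) (M := fun _ => M₀)
    (fun n t _ => hK.approx_real_univ_le hm ε n t)
    fun φ hφ hφ' t ht => hK.asympEquicontinuousAt_approx hm hε hφ hφ' ht

end Limit

/-! ### Time-dependent test functions -/

section TestFunctions

variable {φ : ℝ → ℝ × ℝ → ℝ}

lemma IsTestFunction.exists_bound (hφ : IsTestFunction φ) : ∃ B, 0 ≤ B ∧ ∀ t η, |φ t η| ≤ B := by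
  obtain ⟨B, hB⟩ := hφ.contDiff.continuous.bounded_above_of_compact_support hφ.hasCompactSupport
  exact ⟨|B|, abs_nonneg _, fun t η => (hB (t, η)).trans (le_abs_self B)⟩

lemma IsTestFunction.exists_lipschitz (hφ : IsTestFunction φ) :
    ∃ L, 0 ≤ L ∧ ∀ t η t' η', |φ t η - φ t' η'| ≤ L * ‖(t, η) - (t', η')‖ := by
  obtain ⟨L, hL⟩ := ContDiff.lipschitzWith_of_hasCompactSupport hφ.hasCompactSupport hφ.contDiff
    (by norm_num)
  exact ⟨L, L.2, fun t η t' η' => by simpa [dist_eq_norm] using! hL.dist_le_mul (t, η) (t', η')⟩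

lemma IsTestFunction.exists_fderiv_bound (hφ : IsTestFunction φ) :
    ∃ B, 0 ≤ B ∧ ∀ z, ‖fderiv ℝ (Function.uncurry φ) z‖ ≤ B := by
  obtain ⟨B, hB⟩ := (hφ.contDiff.continuous_fderiv (by norm_num)).bounded_above_of_compact_support
    (hφ.hasCompactSupport.fderiv ℝ)
  exact ⟨|B|, abs_nonneg _, fun z => (hB z).trans (le_abs_self B)⟩

lemma IsTestFunction.exists_box (hφ : IsTestFunction φ) : ∃ δ R, 0 < δ ∧
    ∀ t η, (t, η) ∈ tsupport (Function.uncurry φ) → δ ≤ η.2 ∧ η.2 ≤ R ∧ η.1 ≤ R := by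
  have hc := hφ.hasCompactSupport.isCompact
  obtain ⟨R₁, hR₁⟩ := (hc.image (by fun_prop : Continuous fun z : ℝ × ℝ × ℝ => z.2.2)).bddAbove
  obtain ⟨R₂, hR₂⟩ := (hc.image (by fun_prop : Continuous fun z : ℝ × ℝ × ℝ => z.2.1)).bddAbove
  have hinv : ContinuousOn (fun z : ℝ × ℝ × ℝ => z.2.2⁻¹) (tsupport (Function.uncurry φ)) :=
    ContinuousOn.inv₀ (by fun_prop) fun z hz => (ne_of_gt (hφ.tsupport_subset hz).2.2)
  obtain ⟨R₃, hR₃⟩ := (hc.image_of_continuousOn hinv).bddAbove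
  refine ⟨(max 1 R₃)⁻¹, max R₁ R₂, inv_pos.2 (lt_max_of_lt_left one_pos), fun t η hη =>
    ⟨?_, (hR₁ ⟨_, hη, rfl⟩).trans (le_max_left _ _), (hR₂ ⟨_, hη, rfl⟩).trans (le_max_right _ _)⟩⟩
  exact inv_le_of_inv_le₀ (hφ.tsupport_subset hη).2.2 ((hR₃ ⟨_, hη, rfl⟩).trans (le_max_right _ _))

lemma IsTestFunction.mem_tsupport {t : ℝ} {η : ℝ × ℝ} (h : φ t η ≠ 0) :
    (t, η) ∈ tsupport (Function.uncurry φ) := subset_tsupport _ h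

lemma IsTestFunction.continuous_comp (hφ : IsTestFunction φ) :
    Continuous fun z : ℝ × IsoRegion => φ z.1 z.2 :=
  hφ.contDiff.continuous.comp (continuous_fst.prodMk (continuous_subtype_val.comp continuous_snd))

lemma IsTestFunction.hasStrictFDerivAt (hφ : IsTestFunction φ) (z : ℝ × ℝ × ℝ) :
    HasStrictFDerivAt (Function.uncurry φ) (fderiv ℝ (Function.uncurry φ) z) z :=
  hφ.contDiff.contDiffAt.hasStrictFDerivAt (by norm_num)

lemma IsTestFunction.deriv_time (hφ : IsTestFunction φ) (s : ℝ) (η : ℝ × ℝ) :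
    deriv (fun τ => φ τ η) s = fderiv ℝ (Function.uncurry φ) (s, η) (1, 0) := by
  have h1 : HasDerivAt (fun τ : ℝ => (τ, η)) ((1 : ℝ), (0 : ℝ × ℝ)) s :=
    (hasDerivAt_id s).prodMk (hasDerivAt_const s η)
  exact ((hφ.hasStrictFDerivAt (s, η)).hasFDerivAt.comp_hasDerivAt s h1).deriv

lemma IsTestFunction.partialArea_eq (hφ : IsTestFunction φ) (s : ℝ) (η : ℝ × ℝ) :
    partialArea (φ s) η = fderiv ℝ (Function.uncurry φ) (s, η) (0, (1, 0)) := by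
  have h1 : HasDerivAt (fun a : ℝ => (s, (a, η.2))) ((0 : ℝ), ((1 : ℝ), (0 : ℝ))) η.1 :=
    (hasDerivAt_const _ s).prodMk ((hasDerivAt_id _).prodMk (hasDerivAt_const _ η.2))
  exact ((hφ.hasStrictFDerivAt (s, η)).hasFDerivAt.comp_hasDerivAt η.1 h1).deriv

/-- Difference quotients along converging directions and base points. -/
lemma tendsto_difference_quotient {E ι : Type*} [NormedAddCommGroup E] [NormedSpace ℝ E]
    {f : E → ℝ} {f' : E →L[ℝ] ℝ} {x₀ w₀ : E} (hf : HasStrictFDerivAt f f' x₀) {l : Filter ι}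
    {q w : ι → E} {h : ι → ℝ} (hq : Tendsto q l (𝓝 x₀)) (hw : Tendsto w l (𝓝 w₀))
    (hh : Tendsto h l (𝓝 0)) (hh0 : ∀ i, h i ≠ 0) :
    Tendsto (fun i => (f (q i + h i • w i) - f (q i)) / h i) l (𝓝 (f' w₀)) := by
  have hp : Tendsto (fun i => (q i + h i • w i, q i)) l (𝓝 (x₀, x₀)) := by
    have h1 : Tendsto (fun i => q i + h i • w i) l (𝓝 (x₀ + (0 : ℝ) • w₀)) :=
      hq.add (hh.smul hw)
    rw [zero_smul, add_zero] at h1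
    exact h1.prodMk_nhds hq
  -- Strict differentiability controls increments between two moving points; differentiability at
  -- `x₀` alone would require a fixed base point.
  have ho := hf.isLittleO.comp_tendsto hp
  have hO : (fun i => h i • w i) =O[l] h := by
    have := (Asymptotics.isBigO_refl h l).smul (hw.isBigO_one ℝ)
    simpa using this
  have ho' : (fun i => f (q i + h i • w i) - f (q i) - f' (h i • w i)) =o[l] h := by
    refine Asymptotics.IsLittleO.trans_isBigO ?_ hO
    refine (ho.congr (fun i => ?_) fun i => ?_)
    · simp
    · simp
  have h0 := ho'.tendsto_div_nhds_zero
  have h1 := h0.add ((f'.continuous.tendsto w₀).comp hw)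
  rw [zero_add] at h1
  refine h1.congr fun i => ?_
  have := hh0 i
  simp only [map_smul, smul_eq_mul, Function.comp_apply]
  field_simp
  ring

end TestFunctions

/-! ### Consistency of one discrete step with the transport operator -/

section Generator

variable {K : IsoRegion → IsoRegion → ℝ} {ρ : IsoRegion → ℝ} {α β k K₀ p M₀ ε : ℝ}
  {m : Measure IsoRegion} {φ : ℝ → ℝ × ℝ → ℝ}

/-- The difference quotient of a test function along one step of the discretization. -/
def stepQuotient (φ : ℝ → ℝ × ℝ → ℝ) (ρ : IsoRegion → ℝ) (M₀ ε : ℝ) (n : ℕ) (u : ℝ)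
    (x : IsoRegion) : ℝ :=
  (φ (u + stepSize M₀ n) (relax (stepSize M₀ n / ε) ρ x) - φ u x) / stepSize M₀ n

/-- The action of the transport operator `∂ₜ - ε⁻¹ ρ (a - c₀ v^{2/3}) ∂ₐ` on a test function. -/
def transportRate (φ : ℝ → ℝ × ℝ → ℝ) (ρ : IsoRegion → ℝ) (ε s : ℝ) (x : IsoRegion) : ℝ :=
  fderiv ℝ (Function.uncurry φ) (s, x)
    (1, (-(1 / ε * (ρ x * (area x - sphereArea (vol x)))), 0))

lemma transportRate_eq (hφ : IsTestFunction φ) (ε s : ℝ) (x : IsoRegion) :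
    transportRate φ ρ ε s x = deriv (fun τ => φ τ x) s
      + 1 / ε * (ρ x * (sphereArea (vol x) - area x) * partialArea (φ s) x) := by
  rw [hφ.deriv_time, hφ.partialArea_eq, transportRate]
  have : ((1 : ℝ), (-(1 / ε * (ρ x * (area x - sphereArea (vol x)))), (0 : ℝ)))
      = ((1 : ℝ), (0 : ℝ × ℝ)) + (1 / ε * (ρ x * (sphereArea (vol x) - area x))) •
        ((0 : ℝ), ((1 : ℝ), (0 : ℝ))) := by
    ext <;> simp
    ring
  rw [this, map_add, map_smul, smul_eq_mul]
  ring

lemma tendsto_relax (hρ : Continuous ρ) {τ : ℕ → ℝ} (hτ : Tendsto τ atTop (𝓝 0)) {l : Filter ℕ}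
    (hl : l ≤ atTop) (x : IsoRegion) :
    Tendsto (fun z : ℕ × IsoRegion => relax (τ z.1) ρ z.2) (l ×ˢ 𝓝 x) (𝓝 x) := by
  rw [tendsto_subtype_rng]
  have hx : Tendsto (fun z : ℕ × IsoRegion => z.2) (l ×ˢ 𝓝 x) (𝓝 x) := tendsto_snd
  have hτ' : Tendsto (fun z : ℕ × IsoRegion => τ z.1) (l ×ˢ 𝓝 x) (𝓝 0) :=
    (hτ.mono_left hl).comp tendsto_fst
  have c1 : Tendsto (fun z : ℕ × IsoRegion => sphereArea (vol z.2)) (l ×ˢ 𝓝 x)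
      (𝓝 (sphereArea (vol x))) := ((continuous_sphereArea.comp continuous_vol).tendsto x).comp hx
  have c2 := (continuous_area.tendsto x).comp hx
  have c3 := (hρ.tendsto x).comp hx
  have c4 : Tendsto (fun z : ℕ × IsoRegion => max (1 / 2 : ℝ) (1 - τ z.1 * ρ z.2)) (l ×ˢ 𝓝 x)
      (𝓝 (max (1 / 2) (1 - 0 * ρ x))) :=
    tendsto_const_nhds.max (tendsto_const_nhds.sub (hτ'.mul c3))
  have c5 := c1.add (c4.mul (c2.sub c1))
  have c6 : sphereArea (vol x) + max (1 / 2) (1 - 0 * ρ x) * (area x - sphereArea (vol x))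
      = area x := by
    rw [zero_mul, sub_zero, max_eq_right (by norm_num)]
    ring
  rw [c6] at c5
  exact c5.prodMk_nhds ((continuous_vol.tendsto x).comp hx)

lemma tendsto_stepSize_div (hM₀ : 0 ≤ M₀) (ε : ℝ) :
    Tendsto (fun n => stepSize M₀ n / ε) atTop (𝓝 0) := by
  simpa using (tendsto_stepSize hM₀).div_const ε

/-- Near `x` the floor `1 / 2` of the relaxation is eventually inactive, so the step is an exact
displacement `h • w` in time and area, and the quotient is a difference quotient at a moving base
point. -/
lemma tendsto_stepQuotient (hφ : IsTestFunction φ) (hρ : Continuous ρ) (hM₀ : 0 ≤ M₀)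
    {l : Filter ℕ} (hl : l ≤ atTop) {u : ℕ → ℝ} {s : ℝ} (hu : Tendsto u l (𝓝 s))
    (x : IsoRegion) :
    Tendsto (fun z : ℕ × IsoRegion => stepQuotient φ ρ M₀ ε z.1 (u z.1) z.2) (l ×ˢ 𝓝 x)
      (𝓝 (transportRate φ ρ ε s x)) := by
  have hx : Tendsto (fun z : ℕ × IsoRegion => z.2) (l ×ˢ 𝓝 x) (𝓝 x) := tendsto_snd
  have hh : Tendsto (fun z : ℕ × IsoRegion => stepSize M₀ z.1) (l ×ˢ 𝓝 x) (𝓝 0) :=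
    ((tendsto_stepSize hM₀).mono_left hl).comp tendsto_fst
  have hτ : Tendsto (fun z : ℕ × IsoRegion => stepSize M₀ z.1 / ε) (l ×ˢ 𝓝 x) (𝓝 0) :=
    ((tendsto_stepSize_div hM₀ ε).mono_left hl).comp tendsto_fst
  have hc : Continuous fun y => ρ y * (area y - sphereArea (vol y)) :=
    hρ.mul (continuous_area.sub (continuous_sphereArea.comp continuous_vol))
  have hw : Tendsto (fun z : ℕ × IsoRegion => ((1 : ℝ),
      (-(1 / ε * (ρ z.2 * (area z.2 - sphereArea (vol z.2)))), (0 : ℝ)))) (l ×ˢ 𝓝 x)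
      (𝓝 ((1 : ℝ), (-(1 / ε * (ρ x * (area x - sphereArea (vol x)))), (0 : ℝ)))) :=
    tendsto_const_nhds.prodMk_nhds
      ((((hc.tendsto x).comp hx).const_mul (1 / ε)).neg.prodMk_nhds tendsto_const_nhds)
  have hq : Tendsto (fun z : ℕ × IsoRegion => (u z.1, (z.2 : ℝ × ℝ))) (l ×ˢ 𝓝 x)
      (𝓝 (s, (x : ℝ × ℝ))) :=
    (hu.comp tendsto_fst).prodMk_nhds ((continuous_subtype_val.tendsto x).comp hx)
  have key := tendsto_difference_quotient (hφ.hasStrictFDerivAt (s, x)) hq hw hh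
    fun z => (stepSize_pos hM₀ z.1).ne'
  refine key.congr' ?_
  have hsmall : ∀ᶠ z : ℕ × IsoRegion in l ×ˢ 𝓝 x, stepSize M₀ z.1 / ε * ρ z.2 < 1 / 2 := by
    have h0 := hτ.mul ((hρ.tendsto x).comp hx)
    rw [zero_mul] at h0
    exact h0.eventually (gt_mem_nhds (by norm_num))
  filter_upwards [hsmall] with z hz
  unfold stepQuotient
  congr 2
  change φ _ _ = φ _ _
  congr 1
  · simp
  · ext
    · change area z.2 + stepSize M₀ z.1 * _ = area (relax _ ρ z.2)
      rw [area_relax, max_eq_right (by linarith)]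
      ring
    · change vol z.2 + stepSize M₀ z.1 * 0 = vol z.2
      ring

lemma continuous_stepQuotient (hφ : IsTestFunction φ) (hρ : Continuous ρ) (n : ℕ) (u : ℝ) :
    Continuous (stepQuotient φ ρ M₀ ε n u) := by
  have h1 := hφ.continuous_comp.comp (continuous_const (y := u + stepSize M₀ n) |>.prodMk
    (continuous_relax hρ (stepSize M₀ n / ε)))
  have h2 := hφ.continuous_comp.comp (Continuous.prodMk_right u)
  exact (h1.sub h2).div_const _

/-- The increment splits into one in time, controlled by the Lipschitz constant, and one in area,
controlled by `exists_abs_comp_relax_sub_le`. Both are proportional to the step, so the quotient is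
bounded uniformly in `n`. -/
lemma exists_abs_stepQuotient_le (hφ : IsTestFunction φ) (hρ : Continuous ρ)
    (hρ0 : ∀ x, 0 ≤ ρ x) (hM₀ : 0 ≤ M₀) (hε : 0 < ε) :
    ∃ A, 0 ≤ A ∧ ∀ n u x, |stepQuotient φ ρ M₀ ε n u x| ≤ A := by
  obtain ⟨L, hL0, hL⟩ := hφ.exists_lipschitz
  obtain ⟨δ, R, hδ, hbox⟩ := hφ.exists_box
  obtain ⟨C, hC0, hC⟩ := exists_abs_comp_relax_sub_le hρ hρ0 hδ R L
  refine ⟨L + C / ε, by positivity, fun n u x => ?_⟩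
  have hh := stepSize_pos hM₀ n
  have e1 : |φ (u + stepSize M₀ n) (relax (stepSize M₀ n / ε) ρ x)
      - φ u (relax (stepSize M₀ n / ε) ρ x)| ≤ L * stepSize M₀ n := by
    refine (hL _ _ _ _).trans (le_of_eq ?_)
    rw [Prod.mk_sub_mk, sub_self, add_sub_cancel_left, Prod.norm_mk, norm_zero,
      max_eq_left (norm_nonneg _), Real.norm_of_nonneg hh.le]
  have e2 := hC (φ u) (fun η η' => (hL u η u η').trans (le_of_eq (by
    rw [Prod.mk_sub_mk, sub_self, Prod.norm_mk, norm_zero, max_eq_right (norm_nonneg _)])))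
    (fun x hx => hbox u x (IsTestFunction.mem_tsupport hx)) (stepSize M₀ n / ε) (by positivity) x
  rw [stepQuotient, abs_div, abs_of_pos hh, div_le_iff₀ hh]
  have e3 := abs_add_le (φ (u + stepSize M₀ n) (relax (stepSize M₀ n / ε) ρ x)
    - φ u (relax (stepSize M₀ n / ε) ρ x)) (φ u (relax (stepSize M₀ n / ε) ρ x) - φ u x)
  rw [sub_add_sub_cancel] at e3
  calc _ ≤ L * stepSize M₀ n + stepSize M₀ n / ε * C := e3.trans (add_le_add e1 e2)
    _ = _ := by ring

/-- The time derivative and the area derivative, multiplied by the fusion rate, of a test function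
are continuous and bounded. -/
lemma IsTestFunction.continuous_fderiv_apply (hφ : IsTestFunction φ) (w : ℝ × ℝ × ℝ) :
    Continuous fun z : ℝ × IsoRegion => fderiv ℝ (Function.uncurry φ) (z.1, z.2) w :=
  ((hφ.contDiff.continuous_fderiv (by norm_num)).clm_apply continuous_const).comp
    (continuous_fst.prodMk (continuous_subtype_val.comp continuous_snd))

/-- The derivative of a test function vanishes off a compact box, on which the otherwise unbounded
fusion rate is bounded. -/
lemma IsTestFunction.exists_abs_fusion_le (hφ : IsTestFunction φ) (hρ : Continuous ρ) :
    ∃ A, 0 ≤ A ∧ ∀ s x, |ρ x * (sphereArea (vol x) - area x) *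
      fderiv ℝ (Function.uncurry φ) (s, x) (0, (1, 0))| ≤ A := by
  obtain ⟨B, hB0, hB⟩ := hφ.exists_fderiv_bound
  obtain ⟨δ, R, hδ, hbox⟩ := hφ.exists_box
  have hc : Continuous fun x => |ρ x * (sphereArea (vol x) - area x)| :=
    (hρ.mul ((continuous_sphereArea.comp continuous_vol).sub continuous_area)).abs
  obtain ⟨C, hC⟩ := ((isCompact_region_box (M := R) hδ).image hc).bddAbove
  refine ⟨|C| * B, by positivity, fun s x => ?_⟩
  by_cases h : fderiv ℝ (Function.uncurry φ) (s, x) = 0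
  · rw [h]
    simp only [zero_apply, mul_zero, abs_zero]
    positivity
  · have hx := hbox s x (support_fderiv_subset ℝ h)
    have h1 : |ρ x * (sphereArea (vol x) - area x)| ≤ |C| :=
      (hC ⟨x, hx, rfl⟩).trans (le_abs_self C)
    have h2 : |fderiv ℝ (Function.uncurry φ) (s, x) (0, (1, 0))| ≤ B := by
      refine (((fderiv ℝ (Function.uncurry φ) (s, x)).le_opNorm _).trans ?_)
      rw [show ‖((0 : ℝ), ((1 : ℝ), (0 : ℝ)))‖ = 1 by simp [Prod.norm_mk], mul_one]
      exact hB _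
    rw [abs_mul]
    exact mul_le_mul h1 h2 (abs_nonneg _) (abs_nonneg _)

lemma IsTestFunction.exists_abs_deriv_time_le (hφ : IsTestFunction φ) :
    ∃ A, 0 ≤ A ∧ ∀ s (x : IsoRegion), |fderiv ℝ (Function.uncurry φ) (s, x) (1, 0)| ≤ A := by
  obtain ⟨B, hB0, hB⟩ := hφ.exists_fderiv_bound
  refine ⟨B, hB0, fun s x => (((fderiv ℝ (Function.uncurry φ) (s, x)).le_opNorm _).trans ?_)⟩
  rw [show ‖((1 : ℝ), (0 : ℝ × ℝ))‖ = 1 by simp [Prod.norm_mk], mul_one]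
  exact hB _

end Generator

/-! ### The weak formulation in the limit -/

section StepFunctions

/-- On the open cell from `h j` to `h (j + 1)` the floor is `j`; the right end, where it jumps, is a
null set. -/
lemma integral_floor_div_eq_sum {h : ℝ} (hh : 0 < h) (g : ℕ → ℝ) (N : ℕ) :
    ∫ s in (0 : ℝ)..(h * N), g ⌊s / h⌋₊ = h * ∑ j ∈ Finset.range N, g j := by
  have hcongr : ∀ j : ℕ, EqOn (fun _ => g j) (fun s => g ⌊s / h⌋₊)
      (Ioo (h * j) (h * (j + 1 : ℕ))) := by
    intro j s hs
    have h1 : (j : ℝ) ≤ s / h := by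
      rw [le_div_iff₀ hh]
      linarith [hs.1]
    have h2 : s / h < j + 1 := by
      rw [div_lt_iff₀ hh]
      have := hs.2
      push_cast at this
      linarith
    simp only
    rw [(Nat.floor_eq_iff ((Nat.cast_nonneg j).trans h1)).2 ⟨h1, h2⟩]
  have hle : ∀ j : ℕ, h * j ≤ h * (j + 1 : ℕ) := fun j => by
    push_cast
    linarith
  have hcongr' : ∀ j : ℕ, ∀ᵐ s ∂volume, s ∈ uIoc (h * j) (h * (j + 1 : ℕ)) →
      g j = g ⌊s / h⌋₊ := by
    intro j
    have hne : ∀ᵐ s : ℝ ∂volume, s ≠ h * (j + 1 : ℕ) := by simp [ae_iff]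
    filter_upwards [hne] with s hs hs'
    rw [uIoc_of_le (hle j)] at hs'
    exact hcongr j ⟨hs'.1, lt_of_le_of_ne hs'.2 hs⟩
  have hii : ∀ j : ℕ, IntervalIntegrable (fun s => g ⌊s / h⌋₊) volume (h * j) (h * (j + 1 : ℕ)) :=
    fun j => (intervalIntegrable_const (c := g j)).congr_ae
      ((ae_restrict_iff' measurableSet_uIoc).2 (hcongr' j))
  have := intervalIntegral.sum_integral_adjacent_intervals (a := fun j : ℕ => h * (j : ℝ))
    (n := N) fun j _ => hii j
  simp only [Nat.cast_zero, mul_zero] at this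
  rw [← this, Finset.mul_sum]
  refine Finset.sum_congr rfl fun j _ => ?_
  rw [← intervalIntegral.integral_congr_ae (hcongr' j), intervalIntegral.integral_const,
    smul_eq_mul]
  push_cast
  ring

end StepFunctions

/-! ### Passage to the limit in the discrete weak formulation -/

section WeakForm

variable {K : IsoRegion → IsoRegion → ℝ} {ρ : IsoRegion → ℝ} {α β k K₀ p M₀ ε : ℝ}
  {m : Measure IsoRegion} {φ : ℝ → ℝ × ℝ → ℝ}

/-- A vague limit of the approximate solutions along a filter. -/
structure IsApproxLimit (K : IsoRegion → IsoRegion → ℝ) (ρ : IsoRegion → ℝ) (M₀ ε : ℝ)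
    (m : Measure IsoRegion) (l : Filter ℕ) (f : ℝ → Measure IsoRegion) : Prop where
  neBot : l.NeBot
  le_atTop : l ≤ atTop
  countable : l.IsCountablyGenerated
  finite : ∀ t, IsFiniteMeasureOnCompacts (f t)
  tendsto : ∀ t ∈ Ici (0 : ℝ), VagueTendsto (fun n => approxSolution K ρ M₀ ε m n t) l (f t)
  continuousOn : ∀ φ : IsoRegion → ℝ, Continuous φ → HasCompactSupport φ →
    ContinuousOn (fun t => ∫ x, φ x ∂(f t)) (Ici 0)

/-- The filter `map θ atTop` encodes the subsequence without reindexing; it is countably generated,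
as dominated convergence in time requires. -/
lemma IsFusionSystem.exists_approxLimit (hK : IsFusionSystem K ρ α β k K₀)
    (hm : IsInitialDatum k p M₀ m) (hε : 0 < ε) :
    ∃ l f, IsApproxLimit K ρ M₀ ε m l f := by
  obtain ⟨θ, hθ, f, h1, h2, h3⟩ := hK.exists_subseq_approx hm hε
  exact ⟨map θ atTop, f, inferInstance, hθ.tendsto_atTop, inferInstance, h1,
    fun t ht φ hφ hφ' => tendsto_map'_iff.2 (h2 t ht φ hφ hφ'), h3⟩

/-- The weak coagulation operator on the region `{a ≥ c₀ v^{2/3}}`. -/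
def coagIntegral (K : IsoRegion → IsoRegion → ℝ) (n : Measure IsoRegion) (ψ : IsoRegion → ℝ) : ℝ :=
  (1 / 2) * ∫ x, ∫ y, K x y * (ψ (x + y) - ψ x - ψ y) ∂n ∂n

/-- The increment of a test function over the `j`-th step, divided by the step size. -/
def discreteRate (K : IsoRegion → IsoRegion → ℝ) (ρ : IsoRegion → ℝ) (φ : ℝ → ℝ × ℝ → ℝ)
    (M₀ ε : ℝ) (m : Measure IsoRegion) (n j : ℕ) : ℝ :=
  ∫ x, stepQuotient φ ρ M₀ ε n (stepSize M₀ n * j) x ∂(schemeIter (fun x y => min (K x y) n)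
      (relax (stepSize M₀ n / ε) ρ) (stepSize M₀ n) m j)
    + coagIntegral (fun x y => min (K x y) n) (schemeIter (fun x y => min (K x y) n)
      (relax (stepSize M₀ n / ε) ρ) (stepSize M₀ n) m j)
      fun x => φ (stepSize M₀ n * j + stepSize M₀ n) (relax (stepSize M₀ n / ε) ρ x)

lemma IsTestFunction.continuous_apply (hφ : IsTestFunction φ) (t : ℝ) :
    Continuous fun x : IsoRegion => φ t x :=
  hφ.continuous_comp.comp (Continuous.prodMk_right t)

/-- Telescoping of the one-step identity `IsScheme.integral_succ_sub`, with the test function taken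
at the grid times. -/
lemma IsFusionSystem.integral_approx_sub_eq_sum (hK : IsFusionSystem K ρ α β k K₀)
    (hm : IsInitialDatum k p M₀ m) (hφ : IsTestFunction φ) (ε : ℝ) (n N : ℕ) :
    ∫ x, φ (stepSize M₀ n * N) x ∂(schemeIter (fun x y => min (K x y) n)
        (relax (stepSize M₀ n / ε) ρ) (stepSize M₀ n) m N) - ∫ x, φ 0 x ∂m
      = stepSize M₀ n * ∑ j ∈ Finset.range N, discreteRate K ρ φ M₀ ε m n j := by
  obtain ⟨B, -, hB⟩ := hφ.exists_bound
  have h := Finset.sum_range_sub (fun j : ℕ => ∫ x, φ (stepSize M₀ n * j) x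
    ∂(schemeIter (fun x y => min (K x y) n) (relax (stepSize M₀ n / ε) ρ) (stepSize M₀ n) m j)) N
  simp only [Nat.cast_zero, mul_zero] at h
  rw [Finset.mul_sum]
  refine h.symm.trans (Finset.sum_congr rfl fun j _ => ?_)
  have e := (hK.isScheme hm ε n).integral_succ_sub
    (hφ.continuous_apply (stepSize M₀ n * j)).measurable
    (hφ.continuous_apply (stepSize M₀ n * j + stepSize M₀ n)).measurable
    (fun x => hB _ x) (fun x => hB _ x) j
  have hcast : stepSize M₀ n * ((j + 1 : ℕ) : ℝ) = stepSize M₀ n * j + stepSize M₀ n := by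
    push_cast
    ring
  rw [hcast]
  exact e

variable {l : Filter ℕ} {f : ℝ → Measure IsoRegion}

lemma IsApproxLimit.lintegral_le (hf : IsApproxLimit K ρ M₀ ε m l f)
    (hK : IsFusionSystem K ρ α β k K₀) (hm : IsInitialDatum k p M₀ m) {t : ℝ} (ht : 0 ≤ t)
    {g : IsoRegion → ℝ} (hg : Continuous g) (hg0 : ∀ x, 0 ≤ g x) {c : ℝ≥0∞}
    (hc : ∀ᶠ n in l, ∫⁻ x, ENNReal.ofReal (g x) ∂(approxSolution K ρ M₀ ε m n t) ≤ c) :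
    ∫⁻ x, ENNReal.ofReal (g x) ∂(f t) ≤ c := by
  have := hf.neBot
  have := hf.finite t
  have := fun n => hK.isFiniteMeasure_approx hm ε n t
  exact lintegral_le_of_vagueTendsto (hK.exponents.isProperWeight (p := p)) (hf.tendsto t ht) hg
    hg0 hc

/-- The moment bound for the limits, uniform in `ε`. -/
lemma IsFusionSystem.exists_limit_weightBound (hK : IsFusionSystem K ρ α β k K₀)
    (hm : IsInitialDatum k p M₀ m) (T : ℝ) : ∃ C, 0 ≤ C ∧
      (∀ ε, 0 < ε → ∀ (n j : ℕ), stepSize M₀ n * j ≤ T → WeightBound (momentWeight k p) C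
        (schemeIter (fun x y => min (K x y) n) (relax (stepSize M₀ n / ε) ρ) (stepSize M₀ n) m j)) ∧
      ∀ ε, 0 < ε → ∀ l f, IsApproxLimit K ρ M₀ ε m l f → ∀ t ∈ Icc 0 T,
        ∫⁻ x, ENNReal.ofReal (momentWeight k p x) ∂(f t) ≤ ENNReal.ofReal C := by
  obtain ⟨C, hC0, hC⟩ := hK.exists_weightBound hm T
  have hW := hK.exponents.isProperWeight (p := p)
  refine ⟨C, hC0, fun ε hε n j hj => weightBound_of_lintegral hW hC0 (hC ε hε n j hj),
    fun ε hε l f hf t ht => hf.lintegral_le hK hm ht.1 hW.continuous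
      (fun x => zero_le_one.trans (hW.one_le x)) (Eventually.of_forall fun n => ?_)⟩
  exact hC ε hε n _ ((stepSize_mul_floor_le hm.bound_nonneg n ht.1).trans ht.2)

/-- A continuous kernel is locally bounded, so near any pair the truncation at `n` is eventually
inactive. -/
lemma tendsto_min_natCast {g : IsoRegion × IsoRegion → ℝ} (hg : Continuous g) {l : Filter ℕ}
    (hl : l ≤ atTop) (z : IsoRegion × IsoRegion) :
    Tendsto (fun w : ℕ × (IsoRegion × IsoRegion) => min (g w.2) (w.1 : ℝ)) (l ×ˢ 𝓝 z)
      (𝓝 (g z)) := by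
  have h1 : Tendsto (fun w : ℕ × (IsoRegion × IsoRegion) => g w.2) (l ×ˢ 𝓝 z) (𝓝 (g z)) :=
    (hg.tendsto z).comp tendsto_snd
  refine h1.congr' ?_
  have h2 : ∀ᶠ w : ℕ × (IsoRegion × IsoRegion) in l ×ˢ 𝓝 z, g w.2 < g z + 1 :=
    h1.eventually (gt_mem_nhds (by linarith))
  have h3 : ∀ᶠ w : ℕ × (IsoRegion × IsoRegion) in l ×ˢ 𝓝 z, g z + 1 ≤ (w.1 : ℝ) :=
    (tendsto_natCast_atTop_atTop.comp (tendsto_fst.mono_right hl)).eventually_ge_atTop _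
  filter_upwards [h2, h3] with w a b
  rw [min_eq_left (a.le.trans b)]

/-- The transport and coagulation rates of the approximate solutions converge. -/
lemma IsApproxLimit.tendsto_discreteRate (hf : IsApproxLimit K ρ M₀ ε m l f)
    (hK : IsFusionSystem K ρ α β k K₀) (hm : IsInitialDatum k p M₀ m) (hε : 0 < ε)
    (hφ : IsTestFunction φ) {s : ℝ} (hs : 0 ≤ s) :
    Tendsto (fun n => discreteRate K ρ φ M₀ ε m n ⌊s / stepSize M₀ n⌋₊) l
      (𝓝 (∫ x, transportRate φ ρ ε s x ∂(f s) + coagIntegral K (f s) fun x => φ s x)) := by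
  have hM₀ := hm.bound_nonneg
  have hW := hK.exponents.isProperWeight (p := p)
  obtain ⟨C, hC0, hC, hCf⟩ := hK.exists_limit_weightBound hm s
  have hfC := weightBound_of_lintegral hW hC0 (hCf ε hε l f hf s ⟨hs, le_rfl⟩)
  have hnC : ∀ n, WeightBound (momentWeight k p) C (approxSolution K ρ M₀ ε m n s) := fun n =>
    hC ε hε n _ (stepSize_mul_floor_le hM₀ n hs)
  have hu : Tendsto (fun n => stepSize M₀ n * ⌊s / stepSize M₀ n⌋₊) l (𝓝 s) :=
    (tendsto_stepSize_mul_floor hM₀ hs).mono_left hf.le_atTop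
  have hu' : Tendsto (fun n => stepSize M₀ n * ⌊s / stepSize M₀ n⌋₊ + stepSize M₀ n) l (𝓝 s) := by
    simpa using hu.add ((tendsto_stepSize hM₀).mono_left hf.le_atTop)
  obtain ⟨A, hA0, hA⟩ := exists_abs_stepQuotient_le (ε := ε) hφ hK.continuous_rate hK.rate_nonneg
    hM₀ hε
  obtain ⟨B, hB0, hB⟩ := hφ.exists_bound
  have hK₀ := hK.bound_nonneg
  have hne := hf.neBot
  refine Tendsto.add ?_ (Tendsto.const_mul _ ?_)
  · have hlim := fun x => tendsto_stepQuotient (ε := ε) hφ hK.continuous_rate hM₀ hf.le_atTop hu x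
    have hcont : Continuous (transportRate φ ρ ε s) := by
      have h1 : Continuous fun x : IsoRegion => fderiv ℝ (Function.uncurry φ) (s, (x : ℝ × ℝ)) :=
        (hφ.contDiff.continuous_fderiv (by norm_num)).comp
          (continuous_const.prodMk continuous_subtype_val)
      have h2 := continuous_sphereArea.comp continuous_vol
      have h3 := hK.continuous_rate
      have h4 := continuous_area
      refine h1.clm_apply (continuous_const.prodMk (Continuous.prodMk ?_ continuous_const))
      exact (continuous_const.mul (h3.mul (h4.sub h2))).neg
    have hone : ∀ x, A ≤ A * √(momentWeight k p x) := fun x =>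
      le_mul_of_one_le_right hA0 (hW.one_le_sqrt x)
    exact tendsto_integral_of_vagueTendsto hW (hf.tendsto s hs) (Eventually.of_forall hnC) hfC
      hcont (Eventually.of_forall fun n => continuous_stepQuotient hφ hK.continuous_rate n _) hlim
      (A := A) (Eventually.of_forall fun n x => (hA n _ x).trans (hone x))
      (fun x => (le_of_tendsto ((hlim x).abs) (Eventually.of_forall fun z => hA z.1 _ z.2)).trans
        (hone x))
  · have hrelax : ∀ x, Tendsto (fun z : ℕ × IsoRegion => relax (stepSize M₀ z.1 / ε) ρ z.2)
        (l ×ˢ 𝓝 x) (𝓝 x) := fun x =>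
      tendsto_relax hK.continuous_rate (tendsto_stepSize_div hM₀ ε) hf.le_atTop x
    have hφS : ∀ x, Tendsto (fun z : ℕ × IsoRegion => φ (stepSize M₀ z.1 * ⌊s / stepSize M₀ z.1⌋₊
        + stepSize M₀ z.1) (relax (stepSize M₀ z.1 / ε) ρ z.2)) (l ×ˢ 𝓝 x) (𝓝 (φ s x)) := fun x =>
      (hφ.continuous_comp.tendsto (s, x)).comp ((hu'.comp tendsto_fst).prodMk_nhds (hrelax x))
    have hcφ : ∀ t τ, Continuous fun x => φ t (relax τ ρ x) := fun t τ =>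
      (hφ.continuous_apply t).comp (continuous_relax hK.continuous_rate τ)
    have hsum : ∀ {ψ : IsoRegion → ℝ}, Continuous ψ →
        Continuous fun z : IsoRegion × IsoRegion => ψ (z.1 + z.2) - ψ z.1 - ψ z.2 := fun hψ =>
      ((hψ.comp continuous_add).sub (hψ.comp continuous_fst)).sub (hψ.comp continuous_snd)
    -- Kernel and test function both vary with `n`, but the bound by `6 K₀ B √W √W` does not, since
    -- truncation only lowers the kernel.
    refine tendsto_integral_integral_of_vagueTendsto hW (hf.tendsto s hs)
      (Eventually.of_forall hnC) hfC
      (hK.continuous_kernel.mul (hsum (hφ.continuous_apply s)))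
      (Eventually.of_forall fun n => (hK.continuous_kernel.min continuous_const).mul
        (hsum (hcφ _ _))) (fun z => ?_) (A := 6 * K₀ * B) (by positivity)
      (Eventually.of_forall fun n => abs_kernel_mul_le (κ := fun x y => min (K x y) n)
        (φ := fun x => φ (stepSize M₀ n * ⌊s / stepSize M₀ n⌋₊ + stepSize M₀ n)
          (relax (stepSize M₀ n / ε) ρ x)) (hK.isScheme hm ε n).kernel.nonneg hK₀
        hK.exponents (fun x y => (min_le_left _ _).trans (hK.le x y)) (fun x => hB _ _) p)
      (abs_kernel_mul_le hK.nonneg hK₀ hK.exponents hK.le (fun x => hB _ _) p)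
    have hz : Tendsto (fun w : ℕ × (IsoRegion × IsoRegion) => w.2) (l ×ˢ 𝓝 z) (𝓝 z) := tendsto_snd
    have t1 := (hφS (z.1 + z.2)).comp (tendsto_fst.prodMk
      ((continuous_add.tendsto z).comp hz) : Tendsto (fun w : ℕ × (IsoRegion × IsoRegion) =>
        (w.1, w.2.1 + w.2.2)) (l ×ˢ 𝓝 z) (l ×ˢ 𝓝 (z.1 + z.2)))
    have t2 := (hφS z.1).comp (tendsto_fst.prodMk
      ((continuous_fst.tendsto z).comp hz) : Tendsto (fun w : ℕ × (IsoRegion × IsoRegion) =>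
        (w.1, w.2.1)) (l ×ˢ 𝓝 z) (l ×ˢ 𝓝 z.1))
    have t3 := (hφS z.2).comp (tendsto_fst.prodMk
      ((continuous_snd.tendsto z).comp hz) : Tendsto (fun w : ℕ × (IsoRegion × IsoRegion) =>
        (w.1, w.2.2)) (l ×ˢ 𝓝 z) (l ×ˢ 𝓝 z.2))
    exact (tendsto_min_natCast hK.continuous_kernel hf.le_atTop z).mul ((t1.sub t2).sub t3)

/-- Provides the dominating constant for the limit under the time integral. -/
lemma IsFusionSystem.exists_abs_discreteRate_le (hK : IsFusionSystem K ρ α β k K₀)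
    (hm : IsInitialDatum k p M₀ m) (hε : 0 < ε) (hφ : IsTestFunction φ) (T : ℝ) :
    ∃ A, 0 ≤ A ∧ ∀ n j : ℕ, stepSize M₀ n * j ≤ T → |discreteRate K ρ φ M₀ ε m n j| ≤ A := by
  have hM₀ := hm.bound_nonneg
  have hW := hK.exponents.isProperWeight (p := p)
  obtain ⟨C, hC0, hC, -⟩ := hK.exists_limit_weightBound hm T
  obtain ⟨A, hA0, hA⟩ := exists_abs_stepQuotient_le (ε := ε) hφ hK.continuous_rate hK.rate_nonneg
    hM₀ hε
  obtain ⟨B, hB0, hB⟩ := hφ.exists_bound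
  have hK₀ := hK.bound_nonneg
  refine ⟨A * C + 3 * K₀ * B * C ^ 2, by positivity, fun n j hj => ?_⟩
  have hw := hC ε hε n j hj
  refine (abs_add_le _ _).trans (add_le_add ?_ ?_)
  · exact hw.abs_integral_le hA0 fun x =>
      (hA n _ x).trans (le_mul_of_one_le_right hA0 (hW.one_le x))
  · exact abs_coagulation_le (κ := fun x y => min (K x y) n)
      (φ := fun x => φ (stepSize M₀ n * j + stepSize M₀ n) (relax (stepSize M₀ n / ε) ρ x))
      (hK.isScheme hm ε n).kernel.nonneg hK₀ hK.exponents
      (fun x y => (min_le_left _ _).trans (hK.le x y)) hB0 (fun x => hB _ _) hw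

/-- The weak formulation, with the transport terms collected. -/
theorem IsApproxLimit.integral_sub_eq (hf : IsApproxLimit K ρ M₀ ε m l f)
    (hK : IsFusionSystem K ρ α β k K₀) (hm : IsInitialDatum k p M₀ m) (hε : 0 < ε)
    (hφ : IsTestFunction φ) {t : ℝ} (ht : 0 ≤ t) :
    ∫ x, φ t x ∂(f t) - ∫ x, φ 0 x ∂m = ∫ s in (0 : ℝ)..t,
      (∫ x, transportRate φ ρ ε s x ∂(f s) + coagIntegral K (f s) fun x => φ s x) := by
  have hM₀ := hm.bound_nonneg
  have hW := hK.exponents.isProperWeight (p := p)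
  obtain ⟨C, hC0, hC, hCf⟩ := hK.exists_limit_weightBound hm t
  obtain ⟨B, hB0, hB⟩ := hφ.exists_bound
  have hne := hf.neBot
  have hcg := hf.countable
  have hu : Tendsto (fun n => stepSize M₀ n * ⌊t / stepSize M₀ n⌋₊) l (𝓝 t) :=
    (tendsto_stepSize_mul_floor hM₀ ht).mono_left hf.le_atTop
  have hone : ∀ x, B ≤ B * √(momentWeight k p x) := fun x =>
    le_mul_of_one_le_right hB0 (hW.one_le_sqrt x)
  have lhs : Tendsto (fun n => ∫ x, φ (stepSize M₀ n * ⌊t / stepSize M₀ n⌋₊) x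
      ∂(approxSolution K ρ M₀ ε m n t)) l (𝓝 (∫ x, φ t x ∂(f t))) :=
    tendsto_integral_of_vagueTendsto hW (hf.tendsto t ht) (Eventually.of_forall fun n =>
      hC ε hε n _ (stepSize_mul_floor_le hM₀ n ht))
      (weightBound_of_lintegral hW hC0 (hCf ε hε l f hf t ⟨ht, le_rfl⟩))
      (hφ.continuous_apply t) (Eventually.of_forall fun n => hφ.continuous_apply _)
      (fun x => (hφ.continuous_comp.tendsto (t, x)).comp ((hu.comp tendsto_fst).prodMk_nhds
        tendsto_snd)) (A := B)
      (Eventually.of_forall fun n x => (hB _ _).trans (hone x))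
      (fun x => (hB _ _).trans (hone x))
  obtain ⟨A, hA0, hA⟩ := hK.exists_abs_discreteRate_le hm hε hφ t
  let v : ℕ → ℝ → ℝ := fun n s => discreteRate K ρ φ M₀ ε m n ⌊s / stepSize M₀ n⌋₊
  have hmeas : ∀ n, Measurable (v n) := fun n =>
    (measurable_from_nat (f := discreteRate K ρ φ M₀ ε m n)).comp
      (Nat.measurable_floor.comp (measurable_id.div_const _))
  -- The discrete sum is the integral of a step function over the completed steps only. The
  -- indicator moves it to the fixed interval `[0, t]`, and for each `s < t` it is eventually `1`.
  have rhs : Tendsto (fun n => ∫ s in (0 : ℝ)..t,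
      indicator {s | s ≤ stepSize M₀ n * ⌊t / stepSize M₀ n⌋₊} (v n) s) l
      (𝓝 (∫ s in (0 : ℝ)..t,
        (∫ x, transportRate φ ρ ε s x ∂(f s) + coagIntegral K (f s) fun x => φ s x))) := by
    refine intervalIntegral.tendsto_integral_filter_of_dominated_convergence (fun _ => A)
      (Eventually.of_forall fun n => ((hmeas n).indicator measurableSet_Iic).aestronglyMeasurable)
      (Eventually.of_forall fun n => ae_of_all _ fun s hs => ?_) intervalIntegrable_const ?_
    · rw [uIoc_of_le ht] at hs
      refine (norm_indicator_le_norm_self _ _).trans (hA n _ ?_)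
      exact (stepSize_mul_floor_le hM₀ n hs.1.le).trans hs.2
    · have hne' : ∀ᵐ s : ℝ ∂volume, s ≠ t := by simp [ae_iff]
      filter_upwards [hne'] with s hst hs
      rw [uIoc_of_le ht] at hs
      refine (hf.tendsto_discreteRate hK hm hε hφ hs.1.le).congr' ?_
      filter_upwards [hu.eventually (lt_mem_nhds (lt_of_le_of_ne hs.2 hst))] with n hn
      rw [indicator_of_mem (show s ∈ {s | s ≤ stepSize M₀ n * ⌊t / stepSize M₀ n⌋₊} from hn.le)]
  refine tendsto_nhds_unique (lhs.sub_const _) (rhs.congr fun n => ?_)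
  have hmem : stepSize M₀ n * ⌊t / stepSize M₀ n⌋₊ ∈ Icc 0 t :=
    ⟨mul_nonneg (stepSize_pos hM₀ n).le (Nat.cast_nonneg _), stepSize_mul_floor_le hM₀ n ht⟩
  rw [intervalIntegral.integral_indicator hmem,
    integral_floor_div_eq_sum (stepSize_pos hM₀ n)]
  exact (hK.integral_approx_sub_eq_sum hm hφ ε n _).symm

end WeakForm

/-! ### Continuity in time of the separate terms and the weak equation -/

section WeakSolution

variable {K : IsoRegion → IsoRegion → ℝ} {ρ : IsoRegion → ℝ} {α β k K₀ p M₀ ε : ℝ}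
  {m : Measure IsoRegion} {φ : ℝ → ℝ × ℝ → ℝ} {l : Filter ℕ} {f : ℝ → Measure IsoRegion}

lemma IsApproxLimit.exists_weightBound (hf : IsApproxLimit K ρ M₀ ε m l f)
    (hK : IsFusionSystem K ρ α β k K₀) (hm : IsInitialDatum k p M₀ m) (hε : 0 < ε) (T : ℝ) :
    ∃ C, ∀ t ∈ Icc 0 T, WeightBound (momentWeight k p) C (f t) := by
  obtain ⟨C, hC0, -, hC⟩ := hK.exists_limit_weightBound hm T
  exact ⟨C, fun t ht => weightBound_of_lintegral (hK.exponents.isProperWeight (p := p)) hC0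
    (hC ε hε l f hf t ht)⟩

lemma IsApproxLimit.vagueTendsto_nhdsWithin (hf : IsApproxLimit K ρ M₀ ε m l f) {s T : ℝ}
    (hs : 0 ≤ s) : VagueTendsto f (𝓝[Icc 0 T] s) (f s) := fun ψ hψ hψ' =>
  (hf.continuousOn ψ hψ hψ' s hs).mono_left (nhdsWithin_mono _ Icc_subset_Ici_self)

lemma tendsto_nhdsWithin_prod {X : Type*} [TopologicalSpace X] {g : ℝ × X → ℝ} (hg : Continuous g)
    (J : Set ℝ) (s : ℝ) (x : X) : Tendsto g (𝓝[J] s ×ˢ 𝓝 x) (𝓝 (g (s, x))) := by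
  refine (hg.tendsto (s, x)).mono_left ?_
  rw [nhds_prod_eq]
  exact prod_mono nhdsWithin_le_nhds le_rfl

lemma IsApproxLimit.continuousOn_integral (hf : IsApproxLimit K ρ M₀ ε m l f)
    (hK : IsFusionSystem K ρ α β k K₀) (hm : IsInitialDatum k p M₀ m) (hε : 0 < ε)
    {g : ℝ → IsoRegion → ℝ} (hg : Continuous fun z : ℝ × IsoRegion => g z.1 z.2) {A : ℝ}
    (hA : 0 ≤ A) (hgA : ∀ s x, |g s x| ≤ A) (T : ℝ) :
    ContinuousOn (fun s => ∫ x, g s x ∂(f s)) (Icc 0 T) := by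
  intro s hs
  have hW := hK.exponents.isProperWeight (p := p)
  obtain ⟨C, hC⟩ := hf.exists_weightBound hK hm hε T
  have hone : ∀ s x, |g s x| ≤ A * √(momentWeight k p x) := fun s x =>
    (hgA s x).trans (le_mul_of_one_le_right hA (hW.one_le_sqrt x))
  exact tendsto_integral_of_vagueTendsto hW (hf.vagueTendsto_nhdsWithin hs.1)
    (eventually_mem_nhdsWithin.mono hC) (hC s hs) (hg.comp (Continuous.prodMk_right s))
    (Eventually.of_forall fun u => hg.comp (Continuous.prodMk_right u))
    (fun x => tendsto_nhdsWithin_prod hg _ s x) (Eventually.of_forall hone) (hone s)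

lemma IsApproxLimit.continuousOn_coagIntegral (hf : IsApproxLimit K ρ M₀ ε m l f)
    (hK : IsFusionSystem K ρ α β k K₀) (hm : IsInitialDatum k p M₀ m) (hε : 0 < ε)
    (hφ : IsTestFunction φ) (T : ℝ) :
    ContinuousOn (fun s => coagIntegral K (f s) fun x => φ s x) (Icc 0 T) := by
  intro s hs
  have hW := hK.exponents.isProperWeight (p := p)
  have hK₀ := hK.bound_nonneg
  obtain ⟨C, hC⟩ := hf.exists_weightBound hK hm hε T
  obtain ⟨B, hB0, hB⟩ := hφ.exists_bound
  have hg : Continuous fun z : ℝ × (IsoRegion × IsoRegion) =>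
      K z.2.1 z.2.2 * (φ z.1 (z.2.1 + z.2.2 : IsoRegion) - φ z.1 z.2.1 - φ z.1 z.2.2) := by
    have h0 : ∀ u : ℝ × (IsoRegion × IsoRegion) → IsoRegion, Continuous u →
        Continuous fun z : ℝ × (IsoRegion × IsoRegion) => φ z.1 (u z) := fun u hu =>
      hφ.continuous_comp.comp (continuous_fst.prodMk hu)
    exact (hK.continuous_kernel.comp continuous_snd).mul
      (((h0 _ (continuous_add.comp continuous_snd)).sub (h0 _ (by fun_prop))).sub
        (h0 _ (by fun_prop)))
  have hb : ∀ s x y, |K x y * (φ s (x + y : IsoRegion) - φ s x - φ s y)|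
      ≤ 6 * K₀ * B * √(momentWeight k p x) * √(momentWeight k p y) := fun s =>
    abs_kernel_mul_le (φ := fun x => φ s x) hK.nonneg hK₀ hK.exponents hK.le (fun x => hB _ _) p
  exact (tendsto_integral_integral_of_vagueTendsto
    (G := fun s x y => K x y * (φ s (x + y : IsoRegion) - φ s x - φ s y))
    (g := fun x y => K x y * (φ s (x + y : IsoRegion) - φ s x - φ s y)) hW
    (hf.vagueTendsto_nhdsWithin hs.1) (eventually_mem_nhdsWithin.mono hC) (hC s hs)
    (hg.comp (Continuous.prodMk_right s))
    (Eventually.of_forall fun u => hg.comp (Continuous.prodMk_right u))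
    (fun x => tendsto_nhdsWithin_prod hg _ s x) (A := 6 * K₀ * B) (by positivity)
    (Eventually.of_forall hb) (hb s)).const_mul _

/-- The limits of the approximate solutions are weak solutions. -/
theorem IsApproxLimit.weak_form (hf : IsApproxLimit K ρ M₀ ε m l f)
    (hK : IsFusionSystem K ρ α β k K₀) (hm : IsInitialDatum k p M₀ m) (hε : 0 < ε)
    (hφ : IsTestFunction φ) {t : ℝ} (ht : 0 ≤ t) :
    ∫ x, φ t x ∂(f t) - ∫ x, φ 0 x ∂m
        - ∫ s in (0 : ℝ)..t, ∫ x : IsoRegion, deriv (fun τ => φ τ x) s ∂(f s)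
      = (∫ s in (0 : ℝ)..t, coagIntegral K (f s) fun x => φ s x)
        + (1 / ε) * ∫ s in (0 : ℝ)..t, ∫ x,
          ρ x * (sphereArea (vol x) - area x) * partialArea (φ s) x ∂(f s) := by
  have hW := hK.exponents.isProperWeight (p := p)
  obtain ⟨C, hC⟩ := hf.exists_weightBound hK hm hε t
  obtain ⟨A₁, hA₁0, hA₁⟩ := hφ.exists_abs_deriv_time_le
  obtain ⟨A₂, hA₂0, hA₂⟩ := hφ.exists_abs_fusion_le hK.continuous_rate
  have c1 : Continuous fun z : ℝ × IsoRegion => deriv (fun τ => φ τ z.2) z.1 := by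
    simp only [hφ.deriv_time]
    exact hφ.continuous_fderiv_apply _
  have c2 : Continuous fun z : ℝ × IsoRegion =>
      ρ z.2 * (sphereArea (vol z.2) - area z.2) * partialArea (φ z.1) z.2 := by
    simp only [hφ.partialArea_eq]
    exact ((hK.continuous_rate.comp continuous_snd).mul
      (((continuous_sphereArea.comp continuous_vol).sub continuous_area).comp
        continuous_snd)).mul (hφ.continuous_fderiv_apply _)
  have b1 : ∀ s (x : IsoRegion), |deriv (fun τ => φ τ x) s| ≤ A₁ := fun s x => by
    rw [hφ.deriv_time]
    exact hA₁ s x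
  have b2 : ∀ s x, |ρ x * (sphereArea (vol x) - area x) * partialArea (φ s) x| ≤ A₂ :=
    fun s x => by
      rw [hφ.partialArea_eq]
      exact hA₂ s x
  have ii : ∀ {u : ℝ → ℝ}, ContinuousOn u (Icc 0 t) → IntervalIntegrable u volume 0 t :=
    fun hu => ContinuousOn.intervalIntegrable (by rwa [uIcc_of_le ht])
  have i1 := ii (hf.continuousOn_integral hK hm hε c1 hA₁0 b1 t)
  have i2 := ii (hf.continuousOn_integral hK hm hε c2 hA₂0 b2 t)
  have i3 := ii (hf.continuousOn_coagIntegral hK hm hε hφ t)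
  have split : ∫ s in (0 : ℝ)..t,
      (∫ x, transportRate φ ρ ε s x ∂(f s) + coagIntegral K (f s) fun x => φ s x)
      = ∫ s in (0 : ℝ)..t, ((∫ x : IsoRegion, deriv (fun τ => φ τ x) s ∂(f s)
        + (1 / ε) * ∫ x, ρ x * (sphereArea (vol x) - area x) * partialArea (φ s) x ∂(f s))
        + coagIntegral K (f s) fun x => φ s x) := by
    refine intervalIntegral.integral_congr fun s hs => ?_
    rw [uIcc_of_le ht] at hs
    have := hW.isFiniteMeasure (hC s hs).1
    have m1 : Integrable (fun x : IsoRegion => deriv (fun τ => φ τ x) s) (f s) :=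
      integrable_of_bounded (c1.comp (Continuous.prodMk_right s)).measurable (b1 s)
    have m2 : Integrable (fun x => ρ x * (sphereArea (vol x) - area x) * partialArea (φ s) x)
        (f s) := integrable_of_bounded (c2.comp (Continuous.prodMk_right s)).measurable (b2 s)
    simp only [transportRate_eq hφ]
    rw [integral_add m1 (m2.const_mul _), integral_const_mul]
  rw [hf.integral_sub_eq hK hm hε hφ ht, split,
    intervalIntegral.integral_add (i1.add (i2.const_mul _)) i3,
    intervalIntegral.integral_add i1 (i2.const_mul _), intervalIntegral.integral_const_mul]
  ring

end WeakSolution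

/-! ### Fast fusion -/

section FastFusion

/-- The excess of the area over that of the ball of the same volume. -/
def excess (x : IsoRegion) : ℝ := area x - sphereArea (vol x)

/-- The ball with the volume of a given particle. -/
def toBall (x : IsoRegion) : IsoRegion := ⟨(sphereArea (vol x), vol x), vol_pos x, le_rfl⟩

/-- A cutoff in the volume variable, localizing it away from `0` and `∞`. -/
def volCutoff (R : ℝ) : IsoRegion → ℝ := cutoff (fun x => vol x + (vol x)⁻¹) R

lemma excess_nonneg (x : IsoRegion) : 0 ≤ excess x := sub_nonneg.2 (sphereArea_vol_le x)

lemma excess_le_area (x : IsoRegion) : excess x ≤ area x :=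
  sub_le_self _ (sphereArea_pos (vol_pos x)).le

lemma continuous_excess : Continuous excess :=
  continuous_area.sub (continuous_sphereArea.comp continuous_vol)

lemma continuous_toBall : Continuous toBall :=
  ((continuous_sphereArea.comp continuous_vol).prodMk continuous_vol).subtype_mk _

lemma continuous_volCutoff (R : ℝ) : Continuous (volCutoff R) :=
  continuous_cutoff (continuous_vol.add (continuous_vol.inv₀ fun x => (vol_pos x).ne')) R

lemma dist_toBall (x : IsoRegion) : dist x (toBall x) = excess x := by
  rw [Subtype.dist_eq, Prod.dist_eq]
  change max (dist (area x) (sphereArea (vol x))) (dist (vol x) (vol x)) = excess x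
  rw [dist_self, max_eq_left dist_nonneg, Real.dist_eq]
  exact abs_of_nonneg (excess_nonneg x)

lemma toBall_relax (τ : ℝ) (ρ : IsoRegion → ℝ) (x : IsoRegion) :
    toBall (relax τ ρ x) = toBall x := rfl

lemma volCutoff_relax (R τ : ℝ) (ρ : IsoRegion → ℝ) (x : IsoRegion) :
    volCutoff R (relax τ ρ x) = volCutoff R x := rfl

lemma excess_relax (τ : ℝ) (ρ : IsoRegion → ℝ) (x : IsoRegion) :
    excess (relax τ ρ x) = max (1 / 2) (1 - τ * ρ x) * excess x := by
  unfold excess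
  rw [vol_relax, area_relax]
  ring

lemma vol_mem_of_volCutoff_ne_zero {R : ℝ} {x : IsoRegion} (h : volCutoff R x ≠ 0) :
    (R + 1)⁻¹ ≤ vol x ∧ vol x ≤ R + 1 := by
  have h1 : vol x + (vol x)⁻¹ < R + 1 := by
    by_contra h'
    exact h (cutoff_eq_zero (not_lt.1 h'))
  have h2 := vol_pos x
  have h3 := inv_pos.2 h2
  exact ⟨inv_le_of_inv_le₀ h2 (by linarith), by linarith⟩

/-- The fusion rate is bounded below where the volume is bounded from above and below. -/
def IsLocallyPositive (ρ : IsoRegion → ℝ) : Prop :=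
  ∀ δ R : ℝ, 0 < δ → ∃ r₀ > 0, ∀ x, δ ≤ vol x → vol x ≤ R → r₀ ≤ ρ x

/-- The level `A` is not exceeded under `u ↦ q u + b`, so whatever lies above it decays like `q^j`.
-/
lemma le_geometric_of_succ_le {u : ℕ → ℝ≥0∞} {q b A E₀ : ℝ} {J : ℕ} (hq : 0 ≤ q) (hb : 0 ≤ b)
    (hA : 0 ≤ A) (hE : 0 ≤ E₀) (hqb : q * A + b ≤ A) (h0 : u 0 ≤ ENNReal.ofReal E₀)
    (h : ∀ j < J, u (j + 1) ≤ ENNReal.ofReal q * u j + ENNReal.ofReal b) (j : ℕ) (hj : j ≤ J) :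
    u j ≤ ENNReal.ofReal (q ^ j * E₀ + A) := by
  induction j with
  | zero =>
    refine h0.trans (ENNReal.ofReal_le_ofReal ?_)
    simpa using hA
  | succ j ih =>
    calc u (j + 1) ≤ ENNReal.ofReal q * u j + ENNReal.ofReal b := h j hj
      _ ≤ ENNReal.ofReal q * ENNReal.ofReal (q ^ j * E₀ + A) + ENNReal.ofReal b := by
          gcongr
          exact ih (by omega)
      _ = ENNReal.ofReal (q * (q ^ j * E₀ + A) + b) := by
          rw [← ENNReal.ofReal_mul hq, ENNReal.ofReal_add (by positivity) hb]
      _ ≤ _ := ENNReal.ofReal_le_ofReal (by rw [pow_succ]; linarith)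

variable {K : IsoRegion → IsoRegion → ℝ} {ρ : IsoRegion → ℝ} {α β k K₀ p M₀ ε : ℝ}
  {m : Measure IsoRegion} {l : Filter ℕ} {f : ℝ → Measure IsoRegion}

/-- Relaxation multiplies the excess by at most `1 - (h / ε) r₀` where the cutoff is active, and
does not change the cutoff, which depends on the volume alone. Coagulation adds at most `h / 2`
times `8 K₀ C²`, by `kernelPower_mul_area_le`. -/
lemma IsFusionSystem.excess_succ_le (hK : IsFusionSystem K ρ α β k K₀)
    (hm : IsInitialDatum k p M₀ m) (hε : 0 < ε) {R r₀ C : ℝ} (hC0 : 0 ≤ C) (hr₀ : 0 < r₀)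
    (hr : ∀ x, volCutoff R x ≠ 0 → r₀ ≤ ρ x) {n : ℕ} (hn : stepSize M₀ n / ε * r₀ ≤ 1 / 2) {j : ℕ}
    (hC : ∫⁻ x, ENNReal.ofReal (momentWeight k p x) ∂(schemeIter (fun x y => min (K x y) n)
      (relax (stepSize M₀ n / ε) ρ) (stepSize M₀ n) m j) ≤ ENNReal.ofReal C) :
    ∫⁻ x, ENNReal.ofReal (volCutoff R x * excess x) ∂(schemeIter (fun x y => min (K x y) n)
        (relax (stepSize M₀ n / ε) ρ) (stepSize M₀ n) m (j + 1))
      ≤ ENNReal.ofReal (1 - stepSize M₀ n / ε * r₀) *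
        ∫⁻ x, ENNReal.ofReal (volCutoff R x * excess x) ∂(schemeIter (fun x y => min (K x y) n)
          (relax (stepSize M₀ n / ε) ρ) (stepSize M₀ n) m j)
        + ENNReal.ofReal (stepSize M₀ n * (4 * K₀ * C ^ 2)) := by
  have hh := stepSize_pos hm.bound_nonneg n
  have hK₀ := hK.bound_nonneg
  set h := stepSize M₀ n
  set τ := h / ε
  set μ := schemeIter (fun x y => min (K x y) n) (relax τ ρ) h m j
  have hq : 0 ≤ 1 - τ * r₀ := by linarith
  have hcont : Continuous fun x => volCutoff R x * excess x :=
    (continuous_volCutoff R).mul continuous_excess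
  have hnn : ∀ x, 0 ≤ volCutoff R x * excess x := fun x =>
    mul_nonneg (cutoff_nonneg _ _ _) (excess_nonneg x)
  -- The contraction factor is put into `ψ`. The whole excess of the merged particle is charged to
  -- the gain `D`, so no subadditivity of the localized excess is needed.
  have step := (hK.isScheme hm ε n).lintegral_succ_le
    (ψ := fun x => ENNReal.ofReal ((1 - τ * r₀) * (volCutoff R x * excess x)))
    (ψ' := fun x => ENNReal.ofReal (volCutoff R x * excess x))
    (D := fun x y => ENNReal.ofReal (area x + area y))
    (hcont.const_mul _).measurable.ennreal_ofReal hcont.measurable.ennreal_ofReal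
    (fun x => ENNReal.ofReal_le_ofReal ?_) (fun x y => le_add_left (ENNReal.ofReal_le_ofReal ?_)) j
  · refine step.trans (add_le_add (le_of_eq ?_) ?_)
    · simp_rw [ENNReal.ofReal_mul hq]
      exact lintegral_const_mul' _ _ ENNReal.ofReal_ne_top
    · have hD : ∫⁻ x, ∫⁻ y, ENNReal.ofReal (min (K x y) n) * ENNReal.ofReal (area x + area y) ∂μ ∂μ
          ≤ ENNReal.ofReal (8 * K₀ * C * C) := by
        have inner : ∀ x, ∫⁻ y, ENNReal.ofReal (min (K x y) n) *
            ENNReal.ofReal (area x + area y) ∂μ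
            ≤ ENNReal.ofReal (8 * K₀ * C * momentWeight k p x) := by
          intro x
          have hx := one_le_momentWeight k p x
          simp_rw [← ENNReal.ofReal_mul (le_min (hK.nonneg x _) (Nat.cast_nonneg n))]
          refine (lintegral_ofReal_le_mul (c := 8 * K₀ * momentWeight k p x) (by positivity)
            (fun y => ?_) hC).trans (le_of_eq (by congr 1; ring))
          have h1 : min (K x y) n ≤ K₀ * kernelPower α β x y := (min_le_left _ _).trans (hK.le x y)
          have h2 := kernelPower_mul_area_le hK.exponents p x y
          have h3 := area_pos x
          have h4 := area_pos y
          calc min (K x y) n * (area x + area y)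
              ≤ K₀ * kernelPower α β x y * (area x + area y) := by gcongr
            _ = K₀ * (kernelPower α β x y * (area x + area y)) := by ring
            _ ≤ K₀ * (8 * momentWeight k p x * momentWeight k p y) := by gcongr
            _ = _ := by ring
        exact (lintegral_mono inner).trans
          (lintegral_ofReal_le_mul (by positivity) (fun x => le_rfl) hC)
      calc _ ≤ ENNReal.ofReal (h / 2) * ENNReal.ofReal (8 * K₀ * C * C) := by gcongr
        _ = _ := by
          rw [← ENNReal.ofReal_mul (by positivity)]
          congr 1
          ring
  · rw [volCutoff_relax, excess_relax]
    by_cases hx : volCutoff R x = 0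
    · simp [hx]
    · have h1 : τ * r₀ ≤ τ * ρ x := mul_le_mul_of_nonneg_left (hr x hx) (by positivity)
      have h2 : max (1 / 2) (1 - τ * ρ x) ≤ 1 - τ * r₀ := max_le (by linarith) (by linarith)
      calc volCutoff R x * (max (1 / 2) (1 - τ * ρ x) * excess x)
          = max (1 / 2) (1 - τ * ρ x) * (volCutoff R x * excess x) := by ring
        _ ≤ _ := mul_le_mul_of_nonneg_right h2 (hnn x)
  · have h1 : (1 - τ * r₀) * (volCutoff R (x + y) * excess (x + y)) ≤ 1 * (1 * excess (x + y)) := by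
      refine mul_le_mul ?_ (mul_le_mul_of_nonneg_right (cutoff_le_one _ _ _) (excess_nonneg _))
        (hnn _) zero_le_one
      have : 0 ≤ τ * r₀ := by positivity
      linarith
    have h2 := excess_le_area (x + y)
    rw [area_add] at h2
    linarith

/-- For small `ε`, the solutions concentrate on balls, at any positive time. -/
theorem IsFusionSystem.exists_excess_le (hK : IsFusionSystem K ρ α β k K₀)
    (hρ : IsLocallyPositive ρ) (hm : IsInitialDatum k p M₀ m) (R : ℝ) (hR : 0 ≤ R) (T : ℝ) :
    ∃ D, 0 ≤ D ∧ ∀ ε, 0 < ε → ∀ l f, IsApproxLimit K ρ M₀ ε m l f → ∀ t ∈ Ioc 0 T,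
      ∫⁻ x, ENNReal.ofReal (volCutoff R x * excess x) ∂(f t) ≤ ENNReal.ofReal (ε * D / t) := by
  have hM₀ := hm.bound_nonneg
  have hK₀ := hK.bound_nonneg
  obtain ⟨C, hC0, hC⟩ := hK.exists_weightBound hm (max T 0)
  obtain ⟨r₀, hr₀, hr⟩ := hρ (R + 1)⁻¹ (R + 1) (by positivity)
  set A := 4 * K₀ * C ^ 2
  have hA : 0 ≤ A := by positivity
  -- The first term bounds what remains of the initial excess, through `exp (-y) ≤ 1 / y` with `y =
  -- t r₀ / (2ε)`. The second is the balance `ε A / r₀` between creation and damping, enlarged by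
  -- `max T 0 / t ≥ 1` so that both share the factor `1 / t`.
  refine ⟨2 * C / r₀ + A / r₀ * max T 0, by positivity, fun ε hε l f hf t ht => ?_⟩
  have hcont : Continuous fun x => volCutoff R x * excess x :=
    (continuous_volCutoff R).mul continuous_excess
  refine hf.lintegral_le hK hm ht.1.le hcont
    (fun x => mul_nonneg (cutoff_nonneg _ _ _) (excess_nonneg x)) ?_
  -- A step below `t / 2` ensures that the completed steps cover at least half of `[0, t]`.
  have s1 := ((tendsto_stepSize hM₀).eventually (gt_mem_nhds (half_pos ht.1)))
  have s2 : ∀ᶠ n in atTop, stepSize M₀ n / ε * r₀ < 1 / 2 := by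
    have := (tendsto_stepSize_div hM₀ ε).mul_const r₀
    rw [zero_mul] at this
    exact this.eventually (gt_mem_nhds (by norm_num))
  filter_upwards [hf.le_atTop s1, hf.le_atTop s2] with n hn1 hn2
  have hh := stepSize_pos hM₀ n
  have hfl := stepSize_mul_floor_le hM₀ n ht.1.le
  have hlt := lt_stepSize_mul_floor_add hM₀ n t
  have hT : t ≤ max T 0 := ht.2.trans (le_max_left _ _)
  set h := stepSize M₀ n
  set J := ⌊t / h⌋₊
  have hq : 0 ≤ 1 - h / ε * r₀ := by linarith
  -- The level `ε A / r₀` is exactly the fixed point of the recursion.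
  have key := le_geometric_of_succ_le (q := 1 - h / ε * r₀) (b := h * A) (A := ε * A / r₀)
    (E₀ := C) (J := J) (u := fun j => ∫⁻ x, ENNReal.ofReal (volCutoff R x * excess x)
      ∂(schemeIter (fun x y => min (K x y) n) (relax (h / ε) ρ) h m j)) hq (by positivity)
    (by positivity) hC0 (le_of_eq (by field_simp; ring)) ?_ (fun j hj => ?_) J le_rfl
  · refine key.trans (ENNReal.ofReal_le_ofReal ?_)
    have e1 : (1 - h / ε * r₀) ^ J ≤ 2 * ε / (t * r₀) := by
      have hy : 0 < t * r₀ / (2 * ε) := by have := ht.1; positivity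
      calc (1 - h / ε * r₀) ^ J ≤ Real.exp (-(h / ε * r₀)) ^ J := by
            gcongr
            linarith [Real.add_one_le_exp (-(h / ε * r₀))]
        _ = Real.exp (-(h * J * (r₀ / ε))) := by
            rw [← Real.exp_nat_mul]
            congr 1
            ring
        _ ≤ Real.exp (-(t * r₀ / (2 * ε))) := by
            gcongr
            calc t * r₀ / (2 * ε) = t / 2 * (r₀ / ε) := by field_simp
              _ ≤ h * J * (r₀ / ε) := by
                gcongr
                linarith
        _ ≤ (t * r₀ / (2 * ε))⁻¹ := by
            rw [Real.exp_neg]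
            gcongr
            linarith [Real.add_one_le_exp (t * r₀ / (2 * ε))]
        _ = _ := by rw [inv_div]
    have ht0 := ht.1
    calc (1 - h / ε * r₀) ^ J * C + ε * A / r₀
        ≤ 2 * ε / (t * r₀) * C + ε * A / r₀ * (max T 0 / t) := by
          gcongr
          refine le_mul_of_one_le_right (by positivity) ?_
          rwa [one_le_div ht0]
      _ = _ := by field_simp
  · refine le_trans (lintegral_mono fun x => ENNReal.ofReal_le_ofReal ?_)
      (hC ε hε n 0 (by simp))
    calc volCutoff R x * excess x ≤ 1 * area x :=
          mul_le_mul (cutoff_le_one _ _ _) (excess_le_area x) (excess_nonneg x) zero_le_one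
      _ = area x ^ (1 : ℝ) := by rw [one_mul, Real.rpow_one]
      _ ≤ _ := rpow_area_le_momentWeight zero_le_one (by linarith [hK.exponents.two_le]) x
  · refine hK.excess_succ_le hm hε hC0 hr₀ (fun x hx => ?_) hn2.le (hC ε hε n j ?_)
    · obtain ⟨h1, h2⟩ := vol_mem_of_volCutoff_ne_zero hx
      exact hr x h1 h2
    · calc h * j ≤ h * J := by gcongr
        _ ≤ _ := hfl.trans hT

/-- Observables of the volume alone are Lipschitz in time, uniformly in `ε`. -/
lemma IsFusionSystem.exists_abs_integral_toBall_sub_le (hK : IsFusionSystem K ρ α β k K₀)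
    (hm : IsInitialDatum k p M₀ m) {φ : IsoRegion → ℝ} (hφ : Continuous φ) {B : ℝ}
    (hB0 : 0 ≤ B) (hB : ∀ x, |φ x| ≤ B) (T : ℝ) :
    ∃ L, 0 ≤ L ∧ ∀ ε, 0 < ε → ∀ l f, IsApproxLimit K ρ M₀ ε m l f → ∀ s ∈ Icc 0 T, ∀ t ∈ Icc 0 T,
      |∫ x, φ (toBall x) ∂(f s) - ∫ x, φ (toBall x) ∂(f t)| ≤ L * |s - t| := by
  have hW := hK.exponents.isProperWeight (p := p)
  have hK₀ := hK.bound_nonneg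
  have hM₀ := hm.bound_nonneg
  obtain ⟨C, hC0, hC, hCf⟩ := hK.exists_limit_weightBound hm T
  refine ⟨3 * K₀ * B * C ^ 2, by positivity, fun ε hε l f hf s hs t ht => ?_⟩
  have hne := hf.neBot
  have hc : Continuous fun x => φ (toBall x) := hφ.comp continuous_toBall
  have hone : ∀ x, |φ (toBall x)| ≤ B * √(momentWeight k p x) := fun x =>
    (hB _).trans (le_mul_of_one_le_right hB0 (hW.one_le_sqrt x))
  have lim : ∀ u ∈ Icc 0 T, Tendsto (fun n => ∫ x, φ (toBall x) ∂(approxSolution K ρ M₀ ε m n u)) l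
      (𝓝 (∫ x, φ (toBall x) ∂(f u))) := fun u hu =>
    tendsto_integral_of_vagueTendsto hW (hf.tendsto u hu.1) (C := C)
      (Eventually.of_forall fun n => hC ε hε n _ ((stepSize_mul_floor_le hM₀ n hu.1).trans hu.2))
      (weightBound_of_lintegral hW hC0 (hCf ε hε l f hf u hu)) hc
      (Eventually.of_forall fun n => hc) (fun x => (hc.tendsto x).comp tendsto_snd)
      (Eventually.of_forall fun n => hone) hone
  -- Relaxation leaves `toBall` unchanged, so the transport constant is `0` and no `1 / ε` appears;
  -- the grid error vanishes with the step.
  have hr : Tendsto (fun n => (0 * C + 3 * K₀ * B * C ^ 2) * (|s - t| + stepSize M₀ n)) l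
      (𝓝 ((0 * C + 3 * K₀ * B * C ^ 2) * (|s - t| + 0))) :=
    (((tendsto_stepSize hM₀).mono_left hf.le_atTop).const_add _).const_mul _
  have := le_of_tendsto_of_tendsto ((lim s hs).sub (lim t ht)).abs hr
    (Eventually.of_forall fun n => hK.abs_integral_approx_sub_le hm
      (φ := fun x => φ (toBall x)) (fun j hj => hC ε hε n j hj) hc.measurable hB0 (fun x => hB _)
      le_rfl (fun x => by simp [toBall_relax]) hs ht)
  simpa using this

/-- The deviation of a test function from its values on balls is controlled by the excess area. -/
lemma exists_abs_sub_toBall_le {φ : IsoRegion → ℝ} (hφ : Continuous φ)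
    (hφ' : HasCompactSupport φ) : ∃ R, 0 ≤ R ∧ ∀ δ > 0, ∃ A, 0 ≤ A ∧
      ∀ x, |φ x - φ (toBall x)| ≤ δ + A * (volCutoff R x * excess x) := by
  have hk : (1 : ℝ) ≤ 1 := le_rfl
  obtain ⟨R₀, hR₀⟩ := exists_weight_bound_of_hasCompactSupport
    (isProperWeight_momentWeight (p := 1) hk) hφ'
  have hbox : ∀ x, φ x ≠ 0 → vol x + (vol x)⁻¹ ≤ 2 * max 1 R₀ := fun x hx => by
    have h1 : momentWeight 1 1 x ≤ R₀ := by
      by_contra h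
      exact hx (hR₀ x (not_le.1 h))
    obtain ⟨h2, h3, -⟩ := mem_box_of_momentWeight_le hk h1
    have h4 := inv_le_of_inv_le₀ (lt_max_of_lt_left one_pos) h2
    linarith
  refine ⟨2 * max 1 R₀, by positivity, fun δ hδ => ?_⟩
  obtain ⟨η, hη, huc⟩ := Metric.uniformContinuous_iff.1
    (hφ'.uniformContinuous_of_continuous hφ) δ hδ
  obtain ⟨B, hB⟩ := hφ.bounded_above_of_compact_support hφ'
  refine ⟨2 * |B| / η, by positivity, fun x => ?_⟩
  have hG : 0 ≤ volCutoff (2 * max 1 R₀) x * excess x :=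
    mul_nonneg (cutoff_nonneg _ _ _) (excess_nonneg x)
  -- The excess is the distance from `x` to its ball. If it is below `η`, uniform continuity
  -- applies; otherwise `excess x / η ≥ 1` absorbs the trivial bound `2 |B|`.
  rcases lt_or_ge (excess x) η with h | h
  · have := huc ((dist_toBall x).trans_lt h)
    rw [Real.dist_eq] at this
    have h2 : 0 ≤ 2 * |B| / η * (volCutoff (2 * max 1 R₀) x * excess x) := by positivity
    linarith
  · by_cases h0 : φ x = 0 ∧ φ (toBall x) = 0
    · rw [h0.1, h0.2, sub_zero, abs_zero]
      positivity
    -- A particle and its ball have the same volume, so whichever of the two values is nonzero, the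
    -- cutoff is `1` at `x`.
    · have hv : vol x + (vol x)⁻¹ ≤ 2 * max 1 R₀ := by
        rw [not_and_or] at h0
        rcases h0 with h0 | h0
        · exact hbox x h0
        · exact hbox (toBall x) h0
      rw [show volCutoff (2 * max 1 R₀) x = 1 from cutoff_eq_one hv, one_mul]
      have h1 : |φ x| ≤ |B| := (hB x).trans (le_abs_self B)
      have h2 : |φ (toBall x)| ≤ |B| := (hB _).trans (le_abs_self B)
      calc |φ x - φ (toBall x)| ≤ |φ x| + |φ (toBall x)| := abs_sub _ _
        _ ≤ 2 * |B| / η * η := by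
          rw [div_mul_cancel₀ _ hη.ne']
          linarith
        _ ≤ 2 * |B| / η * excess x := by gcongr
        _ ≤ _ := by linarith

end FastFusion

/-! ### Equicontinuity away from time zero and the limit `ε → 0` -/

section FastFusionLimit

variable {K : IsoRegion → IsoRegion → ℝ} {ρ : IsoRegion → ℝ} {α β k K₀ p M₀ ε : ℝ}
  {m : Measure IsoRegion}

lemma WeightBound.measureReal_univ_le {X : Type*} [TopologicalSpace X] [MeasurableSpace X]
    {W : X → ℝ} {n : Measure X} {C : ℝ} (hn : WeightBound W C n) (hW : IsProperWeight W) :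
    n.real univ ≤ C := by
  have h := hn.abs_integral_le (G := fun _ => (1 : ℝ)) zero_le_one
    fun x => by simpa using hW.one_le x
  rw [integral_const, smul_eq_mul, mul_one, one_mul] at h
  exact (le_abs_self _).trans h

/-- Solutions of fast fusion problems are asymptotically equicontinuous at positive times. -/
lemma IsFusionSystem.asympEquicontinuousAt_fastFusion (hK : IsFusionSystem K ρ α β k K₀)
    (hρ : IsLocallyPositive ρ) (hm : IsInitialDatum k p M₀ m) {e : ℕ → ℝ} (he : ∀ n, 0 < e n)
    (he' : Tendsto e atTop (𝓝 0)) {l : ℕ → Filter ℕ} {F : ℕ → ℝ → Measure IsoRegion}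
    (hF : ∀ n, IsApproxLimit K ρ M₀ (e n) m (l n) (F n)) {φ : IsoRegion → ℝ} (hφ : Continuous φ)
    (hφ' : HasCompactSupport φ) {t T : ℝ} (ht : t ∈ Ioc 0 T) :
    AsympEquicontinuousAt F (Ioc 0 T) φ t := by
  intro δ hδ
  have hW := hK.exponents.isProperWeight (p := p)
  obtain ⟨C, hC0, -, hC⟩ := hK.exists_limit_weightBound hm T
  obtain ⟨R, hR0, hR⟩ := exists_abs_sub_toBall_le hφ hφ'
  -- Budget: at each of the two times `δ / 8` for the uniform error integrated against the mass and
  -- `δ / 8` for the excess, then `δ / 2` for the motion of the volume observable.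
  obtain ⟨A, hA0, hA⟩ := hR (δ / (8 * (C + 1))) (by positivity)
  obtain ⟨D, hD0, hD⟩ := hK.exists_excess_le hρ hm R hR0 T
  obtain ⟨B, hB⟩ := hφ.bounded_above_of_compact_support hφ'
  have hB' : ∀ x, |φ x| ≤ |B| := fun x => (hB x).trans (le_abs_self B)
  obtain ⟨L, hL0, hL⟩ := hK.exists_abs_integral_toBall_sub_le hm hφ (abs_nonneg B) hB' T
  have ht0 := ht.1
  have hcb : Continuous fun x => φ (toBall x) := hφ.comp continuous_toBall
  have hcG : Continuous fun x => volCutoff R x * excess x :=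
    (continuous_volCutoff R).mul continuous_excess
  have hG0 : ∀ x, 0 ≤ volCutoff R x * excess x := fun x =>
    mul_nonneg (cutoff_nonneg _ _ _) (excess_nonneg x)
  have near : ∀ n, ∀ s ∈ Ioc 0 T, |∫ x, φ x ∂(F n s) - ∫ x, φ (toBall x) ∂(F n s)|
      ≤ δ / 8 + A * (e n * D / s) := by
    intro n s hs
    have hw := weightBound_of_lintegral hW hC0
      (hC (e n) (he n) _ _ (hF n) s (Ioc_subset_Icc_self hs))
    have := hW.isFiniteMeasure hw.1
    have hs0 := hs.1
    have hen := he n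
    have hE := hD (e n) (he n) _ _ (hF n) s hs
    have hiG : Integrable (fun x => volCutoff R x * excess x) (F n s) := by
      refine ⟨hcG.aestronglyMeasurable, ?_⟩
      rw [hasFiniteIntegral_iff_ofReal (ae_of_all _ hG0)]
      exact hE.trans_lt ENNReal.ofReal_lt_top
    have hGE : ∫ x, volCutoff R x * excess x ∂(F n s) ≤ e n * D / s := by
      rw [integral_eq_lintegral_of_nonneg_ae (ae_of_all _ hG0) hcG.aestronglyMeasurable]
      exact ENNReal.toReal_le_of_le_ofReal (by positivity) hE
    have hmass := hw.measureReal_univ_le hW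
    rw [← integral_sub (hφ.integrable_of_hasCompactSupport hφ')
      (integrable_of_bounded hcb.measurable fun x => hB' _)]
    refine (norm_integral_le_of_norm_le (f := fun x => φ x - φ (toBall x))
      ((integrable_const (δ / (8 * (C + 1)))).add (hiG.const_mul A)) (ae_of_all _ hA)).trans ?_
    simp only [Pi.add_apply]
    rw [integral_add (integrable_const _) (hiG.const_mul A), integral_const, integral_const_mul,
      smul_eq_mul]
    refine add_le_add ?_ (mul_le_mul_of_nonneg_left hGE hA0)
    calc (F n s).real univ * (δ / (8 * (C + 1))) ≤ (C + 1) * (δ / (8 * (C + 1))) := by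
          gcongr
          linarith
      _ = δ / 8 := by field_simp
  -- Staying above `t / 2` keeps the bound on the excess, which degenerates like `1 / s`, uniform
  -- over the nearby times.
  refine ⟨min (t / 2) (δ / (2 * (L + 1))), by positivity, fun s hs hst => ?_⟩
  have hs1 : t / 2 < s := by
    have := abs_lt.1 (hst.trans_le (min_le_left _ _))
    linarith [this.1]
  have hs2 : L * |s - t| ≤ δ / 2 := by
    have h1 := hst.le.trans (min_le_right _ _)
    calc L * |s - t| ≤ (L + 1) * (δ / (2 * (L + 1))) := by
          gcongr
          linarith
      _ = δ / 2 := by field_simp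
  have hsmall : ∀ᶠ n in atTop, A * (e n * D / (t / 2)) < δ / 8 := by
    have : Tendsto (fun n => A * (e n * D / (t / 2))) atTop (𝓝 (A * (0 * D / (t / 2)))) :=
      ((he'.mul_const D).div_const _).const_mul A
    rw [zero_mul, zero_div, mul_zero] at this
    exact this.eventually (gt_mem_nhds (by positivity))
  filter_upwards [hsmall] with n hn
  have hen := he n
  have small : ∀ u, t / 2 < u → A * (e n * D / u) ≤ δ / 8 := fun u hu => by
    refine le_trans ?_ hn.le
    gcongr
  have a1 := abs_le.1 ((near n s hs).trans (add_le_add_right (small s hs1) _))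
  have a2 := abs_le.1 ((near n t ht).trans (add_le_add_right (small t (by linarith)) _))
  have a3 := abs_le.1 ((hL (e n) hen _ _ (hF n) s (Ioc_subset_Icc_self hs) t
    (Ioc_subset_Icc_self ht)).trans hs2)
  rw [abs_le]
  constructor <;> linarith [a1.1, a1.2, a2.1, a2.2, a3.1, a3.2]

/-- The fast fusion limit, on the region `{a ≥ c₀ v^{2/3}}`. -/
theorem IsFusionSystem.exists_fastFusion_limit (hK : IsFusionSystem K ρ α β k K₀)
    (hρ : IsLocallyPositive ρ) (hm : IsInitialDatum k p M₀ m) {F : ℝ → ℝ → Measure IsoRegion}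
    {l : ℝ → Filter ℕ} (hF : ∀ ε, 0 < ε → IsApproxLimit K ρ M₀ ε m (l ε) (F ε)) (T : ℝ) :
    ∃ (e : ℕ → ℝ) (g : ℝ → Measure IsoRegion), (∀ n, e n ∈ Ioo (0 : ℝ) 1) ∧
      Tendsto e atTop (𝓝 0) ∧ (∀ t, IsFiniteMeasureOnCompacts (g t)) ∧
      (∀ t ∈ Ioc 0 T, VagueTendsto (fun n => F (e n) t) atTop (g t)) ∧
      ∀ φ : IsoRegion → ℝ, Continuous φ → HasCompactSupport φ →
        ContinuousOn (fun t => ∫ x, φ x ∂(g t)) (Ioc 0 T) := by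
  have hW := hK.exponents.isProperWeight (p := p)
  -- The shift by two keeps every parameter strictly below `1`.
  let d : ℕ → ℝ := fun n => 1 / ((n : ℝ) + 1 + 1)
  have hd : ∀ n, d n ∈ Ioo (0 : ℝ) 1 := fun n => by
    have : (0 : ℝ) ≤ n := Nat.cast_nonneg n
    refine ⟨by positivity, ?_⟩
    rw [div_lt_one (by positivity)]
    linarith
  have hd' : Tendsto d atTop (𝓝 0) := by
    have := tendsto_one_div_add_atTop_nhds_zero_nat (𝕜 := ℝ)
    exact ((tendsto_add_atTop_iff_nat 1).2 this).congr fun n => by simp [d]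
  have hw : ∀ S, ∃ C, 0 ≤ C ∧ ∀ n, ∀ t ∈ Icc 0 S, WeightBound (momentWeight k p) C (F (d n) t) := by
    intro S
    obtain ⟨C, hC0, -, hC⟩ := hK.exists_limit_weightBound hm S
    exact ⟨C, hC0, fun n t ht =>
      weightBound_of_lintegral hW hC0 (hC _ (hd n).1 _ _ (hF _ (hd n).1) t ht)⟩
  -- The compactness theorem asks for finite measures at every real time; freezing negative times at
  -- `0` provides them and changes nothing on `(0, T]`.
  have hfin : ∀ n t, IsFiniteMeasure (F (d n) (max 0 t)) := fun n t => by
    obtain ⟨C, -, hC⟩ := hw (max 0 t)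
    exact hW.isFiniteMeasure (hC n _ ⟨le_max_left _ _, le_rfl⟩).1
  have hmax : ∀ t ∈ Ioc 0 T, max 0 t = t := fun t ht => max_eq_right ht.1.le
  obtain ⟨C, hC0, hC⟩ := hw T
  have hmass : ∀ n, ∀ t ∈ Ioc 0 T, (F (d n) (max 0 t)).real univ ≤ C := fun n t ht => by
    rw [hmax t ht]
    exact (hC n t (Ioc_subset_Icc_self ht)).measureReal_univ_le hW
  have hequi : ∀ φ : IsoRegion → ℝ, Continuous φ → HasCompactSupport φ → ∀ t ∈ Ioc 0 T,
      AsympEquicontinuousAt (fun n t => F (d n) (max 0 t)) (Ioc 0 T) φ t := by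
    intro φ hφ hφ' t ht δ hδ
    obtain ⟨r, hr, h⟩ := hK.asympEquicontinuousAt_fastFusion hρ hm (fun n => (hd n).1) hd'
      (fun n => hF (d n) (hd n).1) hφ hφ' ht δ hδ
    refine ⟨r, hr, fun s hs hst => ?_⟩
    simp only [hmax t ht, hmax s hs]
    exact h s hs hst
  obtain ⟨θ, hθ, g, h1, h2, h3⟩ := exists_subseq_vagueTendsto hW (M := fun _ => C) hmass hequi
  refine ⟨d ∘ θ, g, fun n => hd _, hd'.comp hθ.tendsto_atTop, h1, fun t ht => ?_, h3⟩
  have := h2 t ht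
  rwa [hmax t ht] at this

end FastFusionLimit

/-! ### Transfer to the quadrant -/

section Transfer

/-- The inclusion of the region `{a ≥ c₀ v^{2/3}}` into the quadrant. -/
def toQuadrant (x : IsoRegion) : Quadrant := ⟨x, coe_mem_quadrant x⟩

lemma range_toQuadrant :
    range toQuadrant = {η : Quadrant | sphereArea (η : ℝ × ℝ).2 ≤ (η : ℝ × ℝ).1} := by
  ext η
  constructor
  · rintro ⟨x, rfl⟩
    exact sphereArea_vol_le x
  · intro h
    exact ⟨⟨η, η.2.2, h⟩, rfl⟩

lemma isClosedEmbedding_toQuadrant : Topology.IsClosedEmbedding toQuadrant := by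
  refine ⟨⟨⟨?_⟩, fun x y h => Subtype.ext (congrArg (fun z : Quadrant => (z : ℝ × ℝ)) h)⟩, ?_⟩
  · exact (induced_compose (f := toQuadrant) (g := ((↑) : Quadrant → ℝ × ℝ))
      (tγ := inferInstance)).symm
  · rw [range_toQuadrant]
    exact isClosed_le ((continuous_sphereArea.comp continuous_snd).comp continuous_subtype_val)
      (continuous_fst.comp continuous_subtype_val)

lemma measurableEmbedding_toQuadrant : MeasurableEmbedding toQuadrant :=
  isClosedEmbedding_toQuadrant.measurableEmbedding

instance : LocallyCompactSpace Quadrant := (isOpen_Ioi.prod isOpen_Ioi).locallyCompactSpace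

/-- A Radon measure on the region `{a ≥ c₀ v^{2/3}}`, extended by zero to the quadrant. -/
def toIsoMeasure (n : Measure IsoRegion) (hn : IsFiniteMeasureOnCompacts n) : IsoMeasure where
  toMeasure := n.map toQuadrant
  locallyFinite := by
    have : IsFiniteMeasureOnCompacts (n.map toQuadrant) := by
      refine ⟨fun Q hQ => ?_⟩
      rw [measurableEmbedding_toQuadrant.map_apply]
      exact (isClosedEmbedding_toQuadrant.isCompact_preimage hQ).measure_lt_top
    infer_instance
  isoperimetric := by
    rw [measurableEmbedding_toQuadrant.map_apply]
    convert measure_empty (μ := n)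
    ext x
    simpa [toQuadrant] using! sphereArea_vol_le x

lemma tendsto_toIsoMeasure {ι : Type*} {l : Filter ι} {F : ι → Measure IsoRegion}
    {g : Measure IsoRegion} (hF : ∀ i, IsFiniteMeasureOnCompacts (F i))
    (hg : IsFiniteMeasureOnCompacts g) (h : VagueTendsto F l g) :
    Tendsto (fun i => toIsoMeasure (F i) (hF i)) l (𝓝 (toIsoMeasure g hg)) := by
  rw [nhds_induced, tendsto_comap_iff, tendsto_pi_nhds]
  intro φ
  have := h (fun x => φ (toQuadrant x)) (φ.continuous.comp isClosedEmbedding_toQuadrant.continuous)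
    (φ.hasCompactSupport.comp_isClosedEmbedding isClosedEmbedding_toQuadrant)
  simpa only [Function.comp_def, toIsoMeasure, measurableEmbedding_toQuadrant.integral_map]
    using this

/-- By the isoperimetric condition nothing lies outside the range of the inclusion, so restricting
to the region loses no mass. -/
lemma map_comap_toQuadrant (h : IsoMeasure) :
    (h.toMeasure.comap toQuadrant).map toQuadrant = h.toMeasure := by
  rw [measurableEmbedding_toQuadrant.map_comap, range_toQuadrant]
  refine Measure.restrict_eq_self_of_ae_mem ?_
  rw [ae_iff]
  simpa using h.isoperimetric

lemma coagulationForm_map (K : ℝ × ℝ → ℝ × ℝ → ℝ) (n : Measure IsoRegion) (φ : ℝ × ℝ → ℝ) :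
    coagulationForm K (n.map toQuadrant) φ
      = coagIntegral (fun x y => K x y) n fun x => φ x := by
  unfold coagulationForm coagIntegral
  simp only [measurableEmbedding_toQuadrant.integral_map]
  rfl

lemma highMoment_map_le (μ σ : ℝ) (n : Measure IsoRegion) :
    highMoment μ σ (n.map toQuadrant)
      ≤ ∫⁻ x, ENNReal.ofReal (momentWeight (μ + 3) (σ * (μ + 3)) x) ∂n := by
  rw [highMoment, measurableEmbedding_toQuadrant.lintegral_map]
  refine lintegral_mono fun x => ENNReal.ofReal_le_ofReal ?_
  change vol x ^ (-μ - 3) + vol x ^ (μ + 3) + vol x ^ (σ * (μ + 3)) + area x ^ (μ + 3) ≤ _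
  rw [show -μ - 3 = -(μ + 3) by ring]
  unfold momentWeight
  linarith

/-- The extra `1` in the weight is at most `v^(-k) + v^k`, already part of the moment; hence the
factor `2`. -/
lemma lintegral_momentWeight_le {μ : ℝ} (hμ : 0 < μ) (σ : ℝ) (n : Measure IsoRegion) :
    ∫⁻ x, ENNReal.ofReal (momentWeight (μ + 3) (σ * (μ + 3)) x) ∂n
      ≤ 2 * highMoment μ σ (n.map toQuadrant) := by
  rw [highMoment, measurableEmbedding_toQuadrant.lintegral_map,
    ← lintegral_const_mul' _ _ ENNReal.ofNat_ne_top]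
  refine lintegral_mono fun x => ?_
  rw [← ENNReal.ofReal_ofNat 2, ← ENNReal.ofReal_mul zero_le_two]
  refine ENNReal.ofReal_le_ofReal ?_
  change _ ≤ 2 * (vol x ^ (-μ - 3) + vol x ^ (μ + 3) + vol x ^ (σ * (μ + 3)) + area x ^ (μ + 3))
  rw [show -μ - 3 = -(μ + 3) by ring]
  have h0 := rpow_le_rpow_add_rpow (vol_pos x) (q₁ := -(μ + 3)) (q := 0) (q₂ := μ + 3)
    (by linarith) (by linarith)
  rw [Real.rpow_zero] at h0
  have h1 := fun q : ℝ => Real.rpow_pos_of_pos (vol_pos x) q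
  have h2 := Real.rpow_pos_of_pos (area_pos x) (μ + 3)
  unfold momentWeight
  linarith [h1 (-(μ + 3)), h1 (μ + 3), h1 (σ * (μ + 3))]

end Transfer

/-! ### From the hypotheses on the kernels to the abstract system -/

section Kernels

variable {K : ℝ × ℝ → ℝ × ℝ → ℝ} {r : ℝ × ℝ → ℝ} {α β μ σ : ℝ}

/-- On the region the area is at least that of a ball of volume `δ`, so for `μ > 0` the factor `a^μ`
stays away from zero. The power `v^σ` is bounded below by its value at one end of the volume range,
according to the sign of `σ`. -/
lemma IsFusionKernel.isLocallyPositive (hr : IsFusionKernel r μ σ) (hμ : 0 < μ) :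
    IsLocallyPositive fun x => r x := by
  obtain ⟨R₀, hR₀, _, _, hb⟩ := hr.bounds
  intro δ R hδ
  have hR : 0 < max δ R := lt_max_of_lt_left hδ
  have hc := sphereArea_pos hδ
  refine ⟨R₀ * (sphereArea δ ^ μ * min (δ ^ σ) (max δ R ^ σ)), ?_, fun x h1 h2 => ?_⟩
  · exact mul_pos hR₀ (mul_pos (Real.rpow_pos_of_pos hc _)
      (lt_min (Real.rpow_pos_of_pos hδ _) (Real.rpow_pos_of_pos hR _)))
  · refine le_trans ?_ (hb x (coe_mem_quadrant x)).1
    have e1 : sphereArea δ ^ μ ≤ area x ^ μ :=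
      Real.rpow_le_rpow hc.le ((sphereArea_mono hδ.le h1).trans (sphereArea_vol_le x)) hμ.le
    have e2 : min (δ ^ σ) (max δ R ^ σ) ≤ vol x ^ σ := by
      rcases le_total 0 σ with h | h
      · exact (min_le_left _ _).trans (Real.rpow_le_rpow hδ.le h1 h)
      · exact (min_le_right _ _).trans
          (Real.rpow_le_rpow_of_nonpos (vol_pos x) (h2.trans (le_max_right _ _)) h)
    gcongr
    exact Real.rpow_nonneg (area_pos x).le _

lemma IsCoagulationKernel.exists_isFusionSystem (hK : IsCoagulationKernel K α β)
    (hr : IsFusionKernel r μ σ) (hμ : 0 < μ) :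
    ∃ K₀, IsFusionSystem (fun x y => K x y) (fun x => r x) α β (μ + 3) K₀ := by
  obtain ⟨_, _, K₀, hK₀, hb⟩ := hK.bounds
  refine ⟨K₀, ⟨hK.alpha_pos, ?_, hK.beta_mem.1, hK.beta_mem.2, ?_, by linarith⟩, ?_,
    fun x y => hK.nonneg x (coe_mem_quadrant x) y (coe_mem_quadrant y),
    fun x y => hK.symm x (coe_mem_quadrant x) y (coe_mem_quadrant y),
    fun x y => (hb x (coe_mem_quadrant x) y (coe_mem_quadrant y)).2, hK₀.le,
    hr.contDiffOn.continuousOn.comp_continuous continuous_subtype_val coe_mem_quadrant,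
    fun x => ?_⟩
  · linarith [hK.beta_sub_alpha_mem.1, hK.beta_mem.2]
  · linarith [hK.beta_sub_alpha_mem.1]
  · exact hK.continuousOn.comp_continuous (continuous_subtype_val.prodMap continuous_subtype_val)
      fun z => ⟨coe_mem_quadrant z.1, coe_mem_quadrant z.2⟩
  · obtain ⟨R₀, hR₀, _, _, h⟩ := hr.bounds
    refine le_trans ?_ (h x (coe_mem_quadrant x)).1
    exact mul_nonneg hR₀.le (mul_nonneg (Real.rpow_nonneg (area_pos x).le _)
      (Real.rpow_nonneg (vol_pos x).le _))

/-- Pushing forward along the closed embedding turns integrals over the quadrant into integrals over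
the region; the initial datum is the pushforward of its own restriction. -/
lemma IsApproxLimit.isWeakSolution {k K₀ p M₀ ε : ℝ} {fin : IsoMeasure} {l : Filter ℕ}
    {f : ℝ → Measure IsoRegion}
    (hf : IsApproxLimit (fun x y => K x y) (fun x => r x) M₀ ε
      (fin.toMeasure.comap toQuadrant) l f)
    (hK : IsFusionSystem (fun x y => K x y) (fun x => r x) α β k K₀)
    (hm : IsInitialDatum k p M₀ (fin.toMeasure.comap toQuadrant)) (hε : 0 < ε)
    (hfin : ∀ t, IsFiniteMeasureOnCompacts (f t)) :
    IsWeakSolution K r α β ε fin fun t => toIsoMeasure (f t) (hfin t) where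
  continuousOn := fun t ht => tendsto_toIsoMeasure hfin (hfin t)
    fun φ hφ hφ' => hf.continuousOn φ hφ hφ' t ht
  moment_bound := fun T hT => by
    obtain ⟨C, hC0, -, hC⟩ := hK.exists_limit_weightBound hm T
    refine lt_of_le_of_lt (iSup₂_le fun t ht => ?_) (ENNReal.ofReal_lt_top (r := 2 * C))
    rw [toIsoMeasure, measurableEmbedding_toQuadrant.lintegral_map]
    refine lintegral_ofReal_le_mul zero_le_two (fun x => ?_) (hC ε hε l f hf t ht)
    have he := hK.exponents
    have h1 := rpow_vol_le_momentWeight (k := k) (p := p) (q := -α)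
      (by linarith [he.alpha_lt, he.two_le]) (by linarith [he.alpha_pos, he.two_le]) x
    have h2 := rpow_vol_le_momentWeight (k := k) (p := p) (q := β)
      (by linarith [he.beta_pos, he.two_le]) (by linarith [he.beta_lt, he.two_le]) x
    change vol x ^ (-α) + vol x ^ β ≤ _
    linarith
  weak_form := fun φ hφ t ht => by
    have h := hf.weak_form hK hm hε hφ ht
    have h0 : ∫ η : Quadrant, φ 0 η ∂fin.toMeasure
        = ∫ x : IsoRegion, φ 0 x ∂(fin.toMeasure.comap toQuadrant) := by
      conv_lhs => rw [← map_comap_toQuadrant fin]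
      exact measurableEmbedding_toQuadrant.integral_map _
    rw [h0]
    simp only [toIsoMeasure, coagulationForm_map, measurableEmbedding_toQuadrant.integral_map]
    exact h

end Kernels

end AreaVolume

end

theorem theorem1p4
    (K : ℝ × ℝ → ℝ × ℝ → ℝ) (α β : ℝ) (hK : AreaVolume.IsCoagulationKernel K α β)
    (r : ℝ × ℝ → ℝ) (μ σ : ℝ) (hr : AreaVolume.IsFusionKernel r μ σ) (hμ : 0 < μ)
    (fin : AreaVolume.IsoMeasure)
    (hfin : AreaVolume.highMoment μ σ fin.toMeasure < ⊤)
    (T : ℝ) (hT : 0 < T) :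
    ∃ f : ℝ → ℝ → AreaVolume.IsoMeasure,
      (∀ ε ∈ Ioo (0 : ℝ) 1, AreaVolume.IsWeakSolution K r α β ε fin (f ε)) ∧
      (∃ C : ℝ, 0 < C ∧ ∀ ε ∈ Ioo (0 : ℝ) 1,
        (⨆ t ∈ Icc 0 T, AreaVolume.highMoment μ σ (f ε t).toMeasure) ≤ ENNReal.ofReal C) ∧
      (∃ (e : ℕ → ℝ) (fbar : ℝ → AreaVolume.IsoMeasure),
        (∀ n, e n ∈ Ioo (0 : ℝ) 1) ∧ Tendsto e atTop (𝓝 0) ∧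
        ContinuousOn fbar (Ioc 0 T) ∧
        ∀ σbar : ℝ, 0 < σbar → ∀ t ∈ Icc σbar T,
          Tendsto (fun n => f (e n) t) atTop (𝓝 (fbar t))) := by
  obtain ⟨K₀, hS⟩ := hK.exists_isFusionSystem hr hμ
  have hm : AreaVolume.IsInitialDatum (μ + 3) (σ * (μ + 3))
      (2 * AreaVolume.highMoment μ σ fin.toMeasure).toReal
      (fin.toMeasure.comap AreaVolume.toQuadrant) := by
    refine ⟨ENNReal.toReal_nonneg, ?_⟩
    rw [ENNReal.ofReal_toReal (ENNReal.mul_ne_top ENNReal.ofNat_ne_top hfin.ne)]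
    have := AreaVolume.lintegral_momentWeight_le hμ σ (fin.toMeasure.comap AreaVolume.toQuadrant)
    rwa [AreaVolume.map_comap_toQuadrant] at this
  set M₀ := (2 * AreaVolume.highMoment μ σ fin.toMeasure).toReal
  have hex : ∀ ε : ℝ, ∃ (l : Filter ℕ) (F : ℝ → Measure AreaVolume.IsoRegion),
      (∀ t, IsFiniteMeasureOnCompacts (F t)) ∧ (0 < ε → AreaVolume.IsApproxLimit (fun x y => K x y)
        (fun x => r x) M₀ ε (fin.toMeasure.comap AreaVolume.toQuadrant) l F) := by
    intro ε
    by_cases hε : 0 < ε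
    · obtain ⟨l, F, hF⟩ := hS.exists_approxLimit hm hε
      exact ⟨l, F, hF.finite, fun _ => hF⟩
    -- For `ε ≤ 0` the zero curve is a default value, so that a family indexed by all reals can be
    -- chosen.
    · exact ⟨⊥, 0, fun t => inferInstanceAs (IsFiniteMeasureOnCompacts
        (0 : Measure AreaVolume.IsoRegion)), fun h => absurd h hε⟩
  choose l F hFfin hF using hex
  refine ⟨fun ε t => AreaVolume.toIsoMeasure (F ε t) (hFfin ε t), fun ε hε =>
    (hF ε hε.1).isWeakSolution hS hm hε.1 (hFfin ε), ?_, ?_⟩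
  · obtain ⟨C, hC0, -, hC⟩ := hS.exists_limit_weightBound hm T
    -- The moment bound is only known to be nonnegative; adding `1` makes it positive.
    refine ⟨C + 1, by linarith, fun ε hε => iSup₂_le fun t ht => ?_⟩
    exact (AreaVolume.highMoment_map_le μ σ _).trans ((hC ε hε.1 _ _ (hF ε hε.1) t ht).trans
      (ENNReal.ofReal_le_ofReal (by linarith)))
  · obtain ⟨e, g, he, he', hg, hlim, hcont⟩ :=
      hS.exists_fastFusion_limit (hr.isLocallyPositive hμ) hm hF T
    refine ⟨e, fun t => AreaVolume.toIsoMeasure (g t) (hg t), he, he', fun t ht =>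
      AreaVolume.tendsto_toIsoMeasure hg (hg t) fun φ hφ hφ' => hcont φ hφ hφ' t ht,
      fun σbar hσ t ht => ?_⟩
    exact AreaVolume.tendsto_toIsoMeasure (fun n => hFfin (e n) t) (hg t)
      (hlim t ⟨hσ.trans_le ht.1, ht.2⟩)
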